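/- Let $\Bbbk$ be an algebraically closed field of characteristic $0$, let $n\ge 2$ and $q\in\Bbbk^\times$. Let $R$ be the $\Bbbk$-algebra with generators $a_0,\dots,a_n,\bar a_0,\dots,\bar a_n$ and relations $$a_ja_i=a_ia_j,\qquad \bar a_j\bar a_i=\bar a_i\bar a_j,\qquad \bar a_ja_i=q\,a_i\bar a_j,\qquad a_0\bar a_0=a_i\bar a_i\qquad(0\le i,j\le n).$$ Give $R$ the $\mathbb Z^{n+1}$-grading with $\deg a_i=e_{i+1}-e_i$ and $\deg\bar a_i=e_i-e_{i+1}$ (indices modulo $n+1$), put $\chi=(-n,1,\dots,1)$, and let $T=\bigoplus_{d\ge0}T_d$ with $T_d=R_{d\chi}$, an $\mathbb N$-graded ring. Put $T_+=\bigoplus_{d\ge1}T_d$. In $T$ consider $x=a_0a_1\cdots a_n$, $y=\bar a_0\bar a_1\cdots\bar a_n$ (both in $T_0$) and, for $0\le i\le n$, $$t_i=a_0^{n-i}a_1^{n-i-1}\cdots a_{n-i-1}\,\bar a_{n-i+1}\bar a_{n-i+2}^2\cdots\bar a_n^{\,i}\in T_1 ,$$ and write $t_{-1}=x$, $t_{n+1}=y$.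 The elements $t_{-1},\dots,t_{n+1}$ are normal nonzerodivisors of the domain $T$, and $T[t_i^{-1}\mid i\in I]$, for $I\subseteq\{-1,\dots,n+1\}$, is $\mathbb Z$-graded. The ring $T$ also carries the $\mathbb Z^3$-grading induced by $\deg a_i=(\delta_{i,n},0,\delta_{i,n-1}-\delta_{i,n})$ and $\deg\bar a_i=(1-\delta_{i,n},1,-\delta_{i,n-1}+\delta_{i,n})$. Let $\mathfrak X$ be the set of $\mathbb Z^3$-graded (two-sided) prime ideals of $T$ that do not contain $\{t_0,\dots,t_n\}$, with the topology generated by the open sets $U_i=\{\mathfrak p\in\mathfrak X\mid t_i\notin\mathfrak p\}$, $-1\le i\le n+1$. The sets $U_I=\bigcap_{i\in I}U_i$ with $\varnothing\ne I\subseteq\{-1,\dots,n+1\}$ are called principal; every point $\mathfrak p$ has the smallest neighbourhood $U_{I(\mathfrak p)}$, $I(\mathfrak p)=\{i\mid t_i\notin\mathfrak p\}$. Let $\mathscr O_{\mathfrak X}$ be the sheaf of noncommutative rings on $\mathfrak X$ with $$\mathscr O_{\mathfrak X}(U_{I(\mathfrak p)})=T[t_i^{-1}\mid i\in I(\mathfrak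 p)]_0\quad(\mathfrak p\in\mathfrak X),\qquad \mathscr O_{\mathfrak X}(V)=\bigcap_{\mathfrak p\in V}\mathscr O_{\mathfrak X}(U_{I(\mathfrak p)})\quad(V\ne\varnothing\text{ open}),\qquad \mathscr O_{\mathfrak X}(\varnothing)=0 .$$ Modules are right modules. For $0\le i\le n$ and an $\mathscr O_{\mathfrak X}(U_i)$-module $N$, let $\widetilde N$ be the sheaf of $\mathscr O_{U_i}$-modules with $\widetilde N(U_{I(\mathfrak p)})=N\otimes_{\mathscr O_{\mathfrak X}(U_i)}\mathscr O_{\mathfrak X}(U_{I(\mathfrak p)})$ for $\mathfrak p\in U_i$ (these sets form a basis of the topology of $U_i$, and the sections over other open sets are determined by glueing). An $\mathscr O_{\mathfrak X}$-module $\mathscr M$ is quasicoherent (coherent) if for every $0\le i\le n$ there is an (a finitely generated) $\mathscr O_{\mathfrak X}(U_i)$-module $N$ with $\mathscr M|_{U_i}\cong\widetilde N$. Let $\mathrm{Mod}\,\mathscr O_{\mathfrak X}$ and $\mathrm{mod}\,\mathscr O_{\mathfrak X}$ be the full subcategories of quasicoherent and of coherent modules in the category of all $\mathscr O_{\mathfrak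 X}$-modules. Let $\mathrm{Gr}\,T$ be the category of $\mathbb Z$-graded $T$-modules with degree-preserving homomorphisms. A graded module is torsion if each of its elements is annihilated by some power of $T_+$; let $\mathrm{QGr}\,T$ be the quotient of $\mathrm{Gr}\,T$ by the torsion modules, with quotient functor $\pi:\mathrm{Gr}\,T\to\mathrm{QGr}\,T$, and let $\mathrm{qgr}\,T$ be the full subcategory of noetherian objects of $\mathrm{QGr}\,T$. For $M\in\mathrm{Gr}\,T$ let $\boldsymbol\pi M$ be the $\mathscr O_{\mathfrak X}$-module with $(\boldsymbol\pi M)(U_{I(\mathfrak p)})=M[t_i^{-1}\mid i\in I(\mathfrak p)]_0$ for $\mathfrak p\in\mathfrak X$, extended to all open sets by glueing. For an $\mathscr O_{\mathfrak X}$-module $\mathscr M$ and $d\in\mathbb Z$ let $\mathscr M(d)=\mathscr M\otimes_{\mathfrak X}\mathscr O(d)$, where $\mathscr O(d)=\boldsymbol\pi(T(d))$; that is, $\mathscr M(d)$ is the sheaf with $\mathscr M(d)(U_{I(\mathfrak p)})=\mathscr M(U_{I(\mathfrak p)})\otimes_{\mathscr O_{\mathfrak X}(U_{I(\mathfrak p)})}T[t_i^{-1}\mid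 i\in I(\mathfrak p)]_d$. Let $\boldsymbol\Gamma_*(\mathscr M)=\bigoplus_{d\in\mathbb Z}H^0(\mathfrak X,\mathscr M(d))$, a graded $T$-module through right multiplication on the second tensor factor. Then $\boldsymbol\pi M$ is quasicoherent for every $M\in\mathrm{Gr}\,T$, and $\boldsymbol\pi$ inverts the homomorphisms with torsion kernel and cokernel, so that it induces a functor $\overline{\boldsymbol\pi}:\mathrm{QGr}\,T\to\mathrm{Mod}\,\mathscr O_{\mathfrak X}$. The functors $\pi\boldsymbol\Gamma_*$ and $\overline{\boldsymbol\pi}$ are quasi-inverse equivalences between $\mathrm{Mod}\,\mathscr O_{\mathfrak X}$ and $\mathrm{QGr}\,T$, and they restrict to quasi-inverse equivalences between $\mathrm{mod}\,\mathscr O_{\mathfrak X}$ and $\mathrm{qgr}\,T$. -/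

import Mathlib

open CategoryTheory TopologicalSpace MulOpposite
open scoped TensorProduct DirectSum

universe u

noncomputable section

namespace QKleinian

/-! ### Quantum torus -/

/-- Exponents `(i, j, w)` of the monomials `u ^ i v ^ j s ^ w`, where
`s ^ w = s_0 ^ (w 0) ⋯ s_n ^ (w n)`. -/
abbrev Exps (n : ℕ) : Type := ℤ × ℤ × (Fin (n + 1) → ℤ)

/-- The quantum torus `k_q[u^{±1}, v^{±1}][s_0^{±1}, …, s_n^{±1}]`, where `v u = q u v` and the `s_i`
are central: finite linear combinations of the monomials `u ^ i v ^ j s ^ w`. -/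
def Torus (k : Type u) [Field k] (n : ℕ) (_q : kˣ) : Type u := Exps n →₀ k

section Torus

variable (k : Type u) [Field k] (n : ℕ) (q : kˣ)

instance : AddCommGroup (Torus k n q) := inferInstanceAs (AddCommGroup (Exps n →₀ k))

instance : Module k (Torus k n q) := inferInstanceAs (Module k (Exps n →₀ k))

/-- The monomial with exponents `g`. -/
def Torus.mono (g : Exps n) : Torus k n q := Finsupp.single g (1 : k)

variable {k n q} in
theorem Torus.lhom_ext {N : Type*} [AddCommMonoid N] [Module k N]
    {f f' : Torus k n q →ₗ[k] N} (h : ∀ g, f (Torus.mono k n q g) = f' (Torus.mono k n q g)) :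
    f = f' := by
  refine Finsupp.lhom_ext (M := k) (R := k) (fun g c => ?_)
  have e : (Finsupp.single g c : Exps n →₀ k) = c • Finsupp.single g (1 : k) := by simp
  rw [e]
  exact (f.map_smul c _).trans ((congrArg (c • ·) (h g)).trans (f'.map_smul c _).symm)

variable {k n q} in
@[elab_as_elim]
theorem Torus.induction {P : Torus k n q → Prop} (x : Torus k n q) (zero : P 0)
    (add : ∀ x y, P x → P y → P (x + y)) (smul_mono : ∀ (c : k) g, P (c • Torus.mono k n q g)) :
    P x := by
  refine Finsupp.induction_linear (motive := P) x zero add (fun g c => ?_)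
  have e : (Finsupp.single g c : Exps n →₀ k) = c • Finsupp.single g (1 : k) := by simp
  rw [e]
  exact smul_mono c g

variable {k n q} in
/-- The linear map with prescribed values on the monomials. -/
def Torus.lift {N : Type*} [AddCommGroup N] [Module k N] (f : Exps n → N) :
    Torus k n q →ₗ[k] N :=
  Finsupp.lift N k (Exps n) f

variable {k n q} in
theorem Torus.lift_mono {N : Type*} [AddCommGroup N] [Module k N] (f : Exps n → N) (g : Exps n) :
    Torus.lift (k := k) (q := q) f (Torus.mono k n q g) = f g := by
  change (Finsupp.lift N k (Exps n) f) (Finsupp.single g 1) = f g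
  simp

/-- Bilinear multiplication, given on monomials by
`(u ^ i v ^ j s ^ w) (u ^ i' v ^ j' s ^ w') = q ^ (j i') u ^ (i + i') v ^ (j + j') s ^ (w + w')`. -/
def Torus.mulL : Torus k n q →ₗ[k] Torus k n q →ₗ[k] Torus k n q :=
  Torus.lift fun g => Torus.lift fun h =>
    ((q ^ (g.2.1 * h.1) : kˣ) : k) • Torus.mono k n q (g + h)

theorem Torus.mulL_mono (g h : Exps n) :
    Torus.mulL k n q (Torus.mono k n q g) (Torus.mono k n q h) =
      ((q ^ (g.2.1 * h.1) : kˣ) : k) • Torus.mono k n q (g + h) := by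
  unfold Torus.mulL
  rw [Torus.lift_mono, Torus.lift_mono]

instance : Ring (Torus k n q) :=
  { (inferInstance : AddCommGroup (Torus k n q)) with
    mul := fun x y => Torus.mulL k n q x y
    one := Torus.mono k n q 0
    left_distrib := fun x y z => (Torus.mulL k n q x).map_add y z
    right_distrib := fun x y z => by
      change Torus.mulL k n q (x + y) z = _
      rw [map_add]; rfl
    zero_mul := fun x => by
      change Torus.mulL k n q 0 x = 0
      rw [map_zero]; rfl
    mul_zero := fun x => (Torus.mulL k n q x).map_zero
    one_mul := fun x => by
      refine LinearMap.congr_fun (f := Torus.mulL k n q (Torus.mono k n q 0))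
        (g := LinearMap.id) (Torus.lhom_ext fun g => ?_) x
      rw [Torus.mulL_mono]; simp
    mul_one := fun x => by
      refine LinearMap.congr_fun (f := (Torus.mulL k n q).flip (Torus.mono k n q 0))
        (g := LinearMap.id) (Torus.lhom_ext fun g => ?_) x
      rw [LinearMap.flip_apply, Torus.mulL_mono]; simp
    mul_assoc := fun x y z => by
      change Torus.mulL k n q (Torus.mulL k n q x y) z = Torus.mulL k n q x (Torus.mulL k n q y z)
      have h1 : ∀ g h : Exps n, ∀ z, Torus.mulL k n q (Torus.mulL k n q (Torus.mono k n q g)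
          (Torus.mono k n q h)) z =
          Torus.mulL k n q (Torus.mono k n q g) (Torus.mulL k n q (Torus.mono k n q h) z) := by
        intro g h z
        refine LinearMap.congr_fun (f := Torus.mulL k n q (Torus.mulL k n q (Torus.mono k n q g)
          (Torus.mono k n q h))) (g := Torus.mulL k n q (Torus.mono k n q g) ∘ₗ
            Torus.mulL k n q (Torus.mono k n q h)) (Torus.lhom_ext fun l => ?_) z
        simp only [LinearMap.comp_apply, Torus.mulL_mono, map_smul, LinearMap.smul_apply, smul_smul,
          add_assoc]
        congr 1
        rw [← Units.val_mul, ← Units.val_mul, ← zpow_add, ← zpow_add]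
        congr 2
        simp only [Prod.fst_add, Prod.snd_add]
        ring
      induction x using Torus.induction with
      | zero => simp
      | add x x' hx hx' => simp only [map_add, LinearMap.add_apply, hx, hx']
      | smul_mono c g =>
        induction y using Torus.induction with
        | zero => simp
        | add y y' hy hy' => simp only [map_add, LinearMap.add_apply, hy, hy']
        | smul_mono d h => simp only [map_smul, LinearMap.smul_apply, h1] }

theorem Torus.mono_mul (g h : Exps n) :
    Torus.mono k n q g * Torus.mono k n q h =
      ((q ^ (g.2.1 * h.1) : kˣ) : k) • Torus.mono k n q (g + h) :=
  Torus.mulL_mono k n q g h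

theorem Torus.one_def : (1 : Torus k n q) = Torus.mono k n q 0 := rfl

instance : Algebra k (Torus k n q) :=
  Algebra.ofModule
    (fun c x y => by
      change Torus.mulL k n q (c • x) y = c • Torus.mulL k n q x y
      rw [map_smul]; rfl)
    (fun c x y => (Torus.mulL k n q x).map_smul c y)

end Torus

/-! ### The representation ring and its ring of semi-invariants -/

/-- The generators `a_i` and `ā_i` (written `b i`), `0 ≤ i ≤ n`, of the representation ring. -/
inductive Gen (n : ℕ) : Type
  | a (i : Fin (n + 1))
  | b (i : Fin (n + 1))

/-- The defining relations of the representation ring. -/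
inductive Rel (k : Type u) [Field k] (n : ℕ) (q : kˣ) :
    FreeAlgebra k (Gen n) → FreeAlgebra k (Gen n) → Prop
  | aa (i j : Fin (n + 1)) : Rel k n q
      (FreeAlgebra.ι k (Gen.a j) * FreeAlgebra.ι k (Gen.a i))
      (FreeAlgebra.ι k (Gen.a i) * FreeAlgebra.ι k (Gen.a j))
  | bb (i j : Fin (n + 1)) : Rel k n q
      (FreeAlgebra.ι k (Gen.b j) * FreeAlgebra.ι k (Gen.b i))
      (FreeAlgebra.ι k (Gen.b i) * FreeAlgebra.ι k (Gen.b j))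
  | ba (i j : Fin (n + 1)) : Rel k n q
      (FreeAlgebra.ι k (Gen.b j) * FreeAlgebra.ι k (Gen.a i))
      ((q : k) • (FreeAlgebra.ι k (Gen.a i) * FreeAlgebra.ι k (Gen.b j)))
  | ab (i : Fin (n + 1)) : Rel k n q
      (FreeAlgebra.ι k (Gen.a 0) * FreeAlgebra.ι k (Gen.b 0))
      (FreeAlgebra.ι k (Gen.a i) * FreeAlgebra.ι k (Gen.b i))

/-- The representation ring `R = R_q^{(n)}`. -/
def RepRing (k : Type u) [Field k] (n : ℕ) (q : kˣ) : Type u := RingQuot (Rel k n q)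

section RepRing

variable (k : Type u) [Field k] (n : ℕ) (q : kˣ)

instance : Ring (RepRing k n q) := inferInstanceAs (Ring (RingQuot (Rel k n q)))

instance : Algebra k (RepRing k n q) := inferInstanceAs (Algebra k (RingQuot (Rel k n q)))

/-- The image in `R` of a generator. -/
def RepRing.gen (g : Gen n) : RepRing k n q :=
  RingQuot.mkAlgHom k (Rel k n q) (FreeAlgebra.ι k g)

/-- The product in `R` of a word in the generators. -/
def RepRing.word (l : List (Gen n)) : RepRing k n q := (l.map (RepRing.gen k n q)).prod

/-- If every generator `g` is given the degree `deg g`, this is the component of degree `d` of `R`: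
the span of the words of total degree `d`. -/
def RepRing.piece {G : Type} [AddCommMonoid G] (deg : Gen n → G) (d : G) :
    Submodule k (RepRing k n q) :=
  Submodule.span k {r | ∃ l : List (Gen n), (l.map deg).sum = d ∧ RepRing.word k n q l = r}

theorem RepRing.one_mem_piece {G : Type} [AddCommMonoid G] (deg : Gen n → G) :
    (1 : RepRing k n q) ∈ RepRing.piece k n q deg 0 :=
  Submodule.subset_span ⟨[], by simp, by simp [RepRing.word]⟩

theorem RepRing.mul_mem_piece {G : Type} [AddCommMonoid G] (deg : Gen n → G) {d e : G}
    {r s : RepRing k n q} (hr : r ∈ RepRing.piece k n q deg d)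
    (hs : s ∈ RepRing.piece k n q deg e) : r * s ∈ RepRing.piece k n q deg (d + e) := by
  have h := Submodule.mul_mem_mul hr hs
  unfold RepRing.piece at h ⊢
  rw [Submodule.span_mul_span] at h
  refine Submodule.span_mono ?_ h
  rintro _ ⟨_, ⟨l, rfl, rfl⟩, _, ⟨l', rfl, rfl⟩, rfl⟩
  exact ⟨l ++ l', by simp, by simp [RepRing.word]⟩

/-- The weights `wt a_i = e_{i+1} - e_i` and `wt ā_i = e_i - e_{i+1}`, with indices modulo `n + 1`;
this is the weight grading induced by the embedding `a_i ↦ u s_{i+1} s_i⁻¹`,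
`ā_i ↦ v s_i s_{i+1}⁻¹`. -/
def wt : Gen n → (Fin (n + 1) → ℤ)
  | .a i => Pi.single (i + 1) 1 - Pi.single i 1
  | .b i => Pi.single i 1 - Pi.single (i + 1) 1

/-- The toric degrees of the generators. -/
def toricDeg : Gen n → ℤ × ℤ × ℤ
  | .a i => (if (i : ℕ) = n then 1 else 0, 0,
      (if (i : ℕ) + 1 = n then 1 else 0) - (if (i : ℕ) = n then 1 else 0))
  | .b i => (1 - (if (i : ℕ) = n then 1 else 0), 1,
      -(if (i : ℕ) + 1 = n then 1 else 0) + (if (i : ℕ) = n then 1 else 0))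

/-- The character `χ = (-n, 1, …, 1)`. -/
def chi : Fin (n + 1) → ℤ := fun i => if i = 0 then -(n : ℤ) else 1

/-- `T_d = R_{d χ}`, the component of degree `d` of `T` for the projective grading. -/
def TPiece (d : ℕ) : Submodule k (RepRing k n q) :=
  RepRing.piece k n q (wt n) (d • chi n)

theorem one_mem_TPiece : (1 : RepRing k n q) ∈ TPiece k n q 0 := by
  unfold TPiece
  rw [zero_smul]
  exact RepRing.one_mem_piece k n q _

variable {k n q} in
theorem mul_mem_TPiece {d e : ℕ} {r s : RepRing k n q} (hr : r ∈ TPiece k n q d)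
    (hs : s ∈ TPiece k n q e) : r * s ∈ TPiece k n q (d + e) := by
  unfold TPiece at *
  rw [add_smul]
  exact RepRing.mul_mem_piece k n q _ hr hs

/-- The ring of semi-invariants `T = ⨁_{d ∈ ℕ} R_{d χ}`, as a subalgebra of `R`. -/
def T : Subalgebra k (RepRing k n q) where
  carrier := (⨆ d, TPiece k n q d : Submodule k (RepRing k n q))
  zero_mem' := Submodule.zero_mem _
  add_mem' := fun ha hb => Submodule.add_mem _ ha hb
  algebraMap_mem' := fun c => by
    rw [Algebra.algebraMap_eq_smul_one]
    exact Submodule.smul_mem _ _ (Submodule.mem_iSup_of_mem 0 (one_mem_TPiece k n q))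
  mul_mem' := fun {a b} ha hb => by
    change a ∈ (⨆ d, TPiece k n q d) at ha
    change b ∈ (⨆ d, TPiece k n q d) at hb
    change a * b ∈ (⨆ d, TPiece k n q d)
    induction ha using Submodule.iSup_induction' with
    | zero => simp
    | add x y _ _ hx hy => rw [add_mul]; exact Submodule.add_mem _ hx hy
    | mem d x hx =>
      induction hb using Submodule.iSup_induction' with
      | zero => simp
      | add y z _ _ hy hz => rw [mul_add]; exact Submodule.add_mem _ hy hz
      | mem e y hy => exact Submodule.mem_iSup_of_mem (d + e) (mul_mem_TPiece hx hy)

variable {k n q} in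
theorem TPiece_le {d : ℕ} {r : RepRing k n q} (hr : r ∈ TPiece k n q d) : r ∈ T k n q :=
  (le_iSup (TPiece k n q) d) hr

/-- `T_+ = ⨁_{d ≥ 1} T_d`, as a subspace of `R`. -/
def TPlus : Submodule k (RepRing k n q) := ⨆ d : ℕ, TPiece k n q (d + 1)

/-- The word `a_0 a_1 ⋯ a_n`. -/
def xWord : List (Gen n) := List.ofFn fun i => Gen.a i

/-- The word `ā_0 ā_1 ⋯ ā_n`. -/
def yWord : List (Gen n) := List.ofFn fun i => Gen.b i

/-- The word `a_0^{n-i} a_1^{n-i-1} ⋯ a_{n-i-1} ā_{n-i+1} ā_{n-i+2}^2 ⋯ ā_n^i` (the truncated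
differences vanish at the indices that do not occur). -/
def tWord (i : Fin (n + 1)) : List (Gen n) :=
  (List.ofFn fun j : Fin (n + 1) => List.replicate (n - i - j) (Gen.a j)).flatten ++
    (List.ofFn fun j : Fin (n + 1) => List.replicate (i + j - n) (Gen.b j)).flatten

theorem sum_shift (c : Fin (n + 1) → ℤ) (l : Fin (n + 1)) :
    (∑ j, c j • (Pi.single (j + 1) (1 : ℤ) - Pi.single j 1 : Fin (n + 1) → ℤ)) l =
      c (l - 1) - c l := by
  simp only [Finset.sum_apply, Pi.smul_apply, Pi.sub_apply, smul_eq_mul, mul_sub,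
    Finset.sum_sub_distrib, Pi.single_apply, mul_ite, mul_one, mul_zero]
  rw [Finset.sum_eq_single (l - 1), Finset.sum_eq_single l]
  · simp
  · intro j _ hj; simp [hj.symm]
  · simp
  · intro j _ hj
    rw [if_neg]
    rintro rfl
    exact hj (by simp)
  · simp

theorem wt_xWord : ((xWord n).map (wt n)).sum = 0 := by
  have h : ((xWord n).map (wt n)).sum =
      ∑ j, (1 : ℤ) • (Pi.single (j + 1) (1 : ℤ) - Pi.single j 1 : Fin (n + 1) → ℤ) := by
    simp only [xWord, List.map_ofFn, List.sum_ofFn, Function.comp_def, wt, one_smul]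
  rw [h]
  ext l
  rw [sum_shift n (fun _ => 1) l]
  simp

theorem wt_yWord : ((yWord n).map (wt n)).sum = 0 := by
  have h : ((yWord n).map (wt n)).sum =
      ∑ j, (-1 : ℤ) • (Pi.single (j + 1) (1 : ℤ) - Pi.single j 1 : Fin (n + 1) → ℤ) := by
    simp only [yWord, List.map_ofFn, List.sum_ofFn, Function.comp_def, wt, neg_smul, one_smul,
      neg_sub]
  rw [h]
  ext l
  rw [sum_shift n (fun _ => -1) l]
  simp

theorem wt_tWord (i : Fin (n + 1)) : ((tWord n i).map (wt n)).sum = chi n := by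
  have h : ((tWord n i).map (wt n)).sum =
      ∑ j : Fin (n + 1), ((n : ℤ) - i - j) •
        (Pi.single (j + 1) (1 : ℤ) - Pi.single j 1 : Fin (n + 1) → ℤ) := by
    simp only [tWord, List.map_append, List.sum_append, List.map_flatten, List.sum_flatten,
      List.map_ofFn, List.sum_ofFn, Function.comp_def, wt, List.map_replicate, List.sum_replicate]
    rw [← Finset.sum_add_distrib]
    refine Finset.sum_congr rfl fun j _ => ?_
    rw [← neg_sub (Pi.single (j + 1) (1 : ℤ) : Fin (n + 1) → ℤ) (Pi.single j 1), smul_neg, ← sub_eq_add_neg,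
      ← natCast_zsmul, ← natCast_zsmul, ← sub_smul]
    congr 1
    omega
  rw [h]
  ext l
  rw [sum_shift n (fun j : Fin (n + 1) => (n : ℤ) - i - j) l]
  unfold chi
  by_cases hl : l = 0
  · subst hl
    rw [if_pos rfl]
    have : ((0 - 1 : Fin (n + 1)) : ℕ) = n := by
      rw [zero_sub, Fin.coe_neg_one]
    rw [this]
    simp only [Fin.val_zero]
    push_cast
    ring
  · rw [if_neg hl]
    have h0 : (l : ℕ) ≠ 0 := fun h => hl (Fin.ext h)
    have : ((l - 1 : Fin (n + 1)) : ℕ) = l - 1 := Fin.val_sub_one_of_ne_zero hl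
    rw [this]
    omega

/-- The index set `{-1, 0, …, n + 1}`, where `t_{-1} = x` and `t_{n+1} = y`. -/
inductive Idx (n : ℕ) : Type
  | x
  | t (i : Fin (n + 1))
  | y

/-- The word of `t_c`. -/
def Idx.word : Idx n → List (Gen n)
  | .x => xWord n
  | .t i => tWord n i
  | .y => yWord n

/-- The elements `t_{-1} = x, t_0, …, t_n, t_{n+1} = y` of `T`. -/
def tElt (c : Idx n) : T k n q :=
  ⟨RepRing.word k n q (c.word n), by
    cases c with
    | x => exact TPiece_le (d := 0) (Submodule.subset_span ⟨_, by
        simpa [Idx.word] using wt_xWord n, rfl⟩)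
    | t i => exact TPiece_le (d := 1) (Submodule.subset_span ⟨_, by
        simpa [Idx.word] using wt_tWord n i, rfl⟩)
    | y => exact TPiece_le (d := 0) (Submodule.subset_span ⟨_, by
        simpa [Idx.word] using wt_yWord n, rfl⟩)⟩

/-! ### Embedding into the quantum torus -/

/-- The images `a_i ↦ u s_{i+1} s_i⁻¹` and `ā_i ↦ v s_i s_{i+1}⁻¹` of the generators. -/
def genExp : Gen n → Exps n
  | .a i => (1, 0, wt n (.a i))
  | .b i => (0, 1, wt n (.b i))

/-- The embedding of `R` into the quantum torus. -/
def phi : RepRing k n q →ₐ[k] Torus k n q :=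
  RingQuot.liftAlgHom k ⟨FreeAlgebra.lift k fun g => Torus.mono k n q (genExp n g), by
    intro x y h
    cases h <;>
      simp only [map_mul, map_smul, FreeAlgebra.lift_ι_apply, Torus.mono_mul, genExp, mul_zero,
        mul_one, zpow_zero, zpow_one, Units.val_one, one_smul]
    · rw [add_comm]
    · rw [add_comm]
    · rw [add_comm]
    · congr 1
      simp [wt]⟩

theorem phi_gen (g : Gen n) : phi k n q (RepRing.gen k n q g) = Torus.mono k n q (genExp n g) := by
  unfold phi RepRing.gen
  erw [RingQuot.liftAlgHom_mkAlgHom_apply]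
  simp

/-- Elements of projective degree `d` of the torus: combinations of the monomials
`u ^ i v ^ j s ^ (d χ)`. -/
def Torus.deg (d : ℤ) : Submodule k (Torus k n q) :=
  Submodule.span k {x | ∃ g : Exps n, g.2.2 = d • chi n ∧ Torus.mono k n q g = x}

theorem Torus.one_mem_deg : (1 : Torus k n q) ∈ Torus.deg k n q 0 :=
  Submodule.subset_span ⟨0, by simp, rfl⟩

variable {k n q} in
theorem Torus.mul_mem_deg {d e : ℤ} {x y : Torus k n q} (hx : x ∈ Torus.deg k n q d)
    (hy : y ∈ Torus.deg k n q e) : x * y ∈ Torus.deg k n q (d + e) := by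
  have h := Submodule.mul_mem_mul hx hy
  unfold Torus.deg at h
  rw [Submodule.span_mul_span] at h
  refine (Submodule.span_le.2 ?_) h
  rintro _ ⟨_, ⟨g, hg, rfl⟩, _, ⟨g', hg', rfl⟩, rfl⟩
  change Torus.mono k n q g * Torus.mono k n q g' ∈ _
  rw [Torus.mono_mul]
  exact Submodule.smul_mem _ _ (Submodule.subset_span
    ⟨g + g', by simp [hg, hg', add_smul], rfl⟩)

variable {k n q} in
theorem phi_mem_deg {d : ℕ} {r : RepRing k n q} (hr : r ∈ TPiece k n q d) :
    phi k n q r ∈ Torus.deg k n q d := by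
  have key : ∀ l : List (Gen n), ∃ (c : k) (g : Exps n), g.2.2 = (l.map (wt n)).sum ∧
      phi k n q (RepRing.word k n q l) = c • Torus.mono k n q g := by
    intro l
    induction l with
    | nil => exact ⟨1, 0, by simp, by simp [RepRing.word, Torus.one_def]⟩
    | cons x l ih =>
      obtain ⟨c, g, hg, h⟩ := ih
      refine ⟨c * ((q ^ ((genExp n x).2.1 * g.1) : kˣ) : k), genExp n x + g, ?_, ?_⟩
      · cases x <;> simp [genExp, hg]
      · have : RepRing.word k n q (x :: l) = RepRing.gen k n q x * RepRing.word k n q l := by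
          simp [RepRing.word]
        rw [this, map_mul, h, phi_gen, mul_smul_comm, Torus.mono_mul, smul_smul]
  unfold TPiece RepRing.piece at hr
  refine Submodule.span_induction (p := fun r _ => phi k n q r ∈ Torus.deg k n q d)
    ?_ (by simp) (fun x y _ _ hx hy => by rw [map_add]; exact Submodule.add_mem _ hx hy)
    (fun c x _ hx => by rw [map_smul]; exact Submodule.smul_mem _ _ hx) hr
  rintro _ ⟨l, hl, rfl⟩
  obtain ⟨c, g, hg, h⟩ := key l
  rw [h]
  exact Submodule.smul_mem _ _ (Submodule.subset_span ⟨g, by rw [hg, hl]; simp, rfl⟩)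

/-! ### The space of graded primes -/

/-- `P` is a prime two-sided ideal of `A`. -/
def IsPrimeIdeal {A : Type*} [Ring A] (P : TwoSidedIdeal A) : Prop :=
  P ≠ ⊤ ∧ ∀ a b : A, (∀ r : A, a * r * b ∈ P) → a ∈ P ∨ b ∈ P

/-- The two-sided ideal `P` of `T` is graded for the toric `ℤ³`-grading: every element of `P` is a
sum of homogeneous elements of `P`. -/
def IsToricGraded (P : TwoSidedIdeal (T k n q)) : Prop :=
  ∀ a ∈ P, a ∈ AddSubgroup.closure
    {b : T k n q | b ∈ P ∧ ∃ d, (b : RepRing k n q) ∈ RepRing.piece k n q (toricDeg n) d}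

/-- The set `𝔛` of `ℤ³`-graded primes of `T` that do not contain the irrelevant ideal
`(t_0, …, t_n)`. -/
def X : Type u :=
  {P : TwoSidedIdeal (T k n q) // IsPrimeIdeal P ∧ IsToricGraded k n q P ∧
    ¬ ∀ i : Fin (n + 1), tElt k n q (.t i) ∈ P}

variable {k n q} in
/-- `p.Inv c` says that `t_c ∉ p`. -/
def X.Inv (p : X k n q) (c : Idx n) : Prop := tElt k n q c ∉ p.1

/-- The topology with the complements of the `V(t_c)`, `-1 ≤ c ≤ n + 1`, as a subbasis of open
sets. Its closed sets are the intersections of the sets `V(I) = ⋃_{c ∈ I} V(t_c)`. -/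
instance : TopologicalSpace (X k n q) :=
  TopologicalSpace.generateFrom (Set.range fun c : Idx n => {p : X k n q | p.Inv c})

/-- The open set `U_c = {p | t_c ∉ p}`. -/
def U (c : Idx n) : Opens (X k n q) :=
  ⟨{p | p.Inv c}, TopologicalSpace.isOpen_generateFrom_of_mem ⟨c, rfl⟩⟩

variable {k n q} in
/-- `p.Generizes p'` says that `I(p) ⊆ I(p')`, where `I(p) = {c | t_c ∉ p}`; equivalently, that `p'` lies
in the smallest open neighbourhood `U_{I(p)} = ⋂_{c ∈ I(p)} U_c` of `p`. -/
def X.Generizes (p p' : X k n q) : Prop := ∀ c, p.Inv c → p'.Inv c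

theorem X.Generizes.mem {p p' : X k n q} (h : p.Generizes p') {V : Opens (X k n q)} (hp : p ∈ V) :
    p' ∈ V := by
  obtain ⟨V, hV⟩ := V
  change p ∈ V at hp
  change p' ∈ V
  induction hV with
  | basic s hs => obtain ⟨c, rfl⟩ := hs; exact h c hp
  | univ => trivial
  | inter s t _ _ hs ht => exact ⟨hs hp.1, ht hp.2⟩
  | sUnion S _ ih => obtain ⟨s, hs, hps⟩ := hp; exact ⟨s, hs, ih s hs hps⟩

instance : Finite (Idx n) :=
  Finite.of_injective (β := Fin (n + 1) ⊕ Bool)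
    (fun c => match c with | .x => .inr true | .t i => .inl i | .y => .inr false)
    (by rintro (_ | _ | _) (_ | _ | _) h <;> simp_all)

/-- The principal open set `U_{I(p)}`, where `I(p) = {c | t_c ∉ p}`; it is the smallest open
neighbourhood of `p`. -/
def X.nbhd (p : X k n q) : Opens (X k n q) :=
  ⟨{p' | p.Generizes p'}, by
    have : {p' | p.Generizes p'} = ⋂ c ∈ {c | p.Inv c}, (U k n q c : Set (X k n q)) := by
      ext p'
      simp only [Set.mem_iInter]
      rfl
    rw [this]
    exact (Set.toFinite _).isOpen_biInter fun c _ => (U k n q c).isOpen⟩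

end RepRing

/-! ### Localisations of `T` and the structure sheaf -/

section Loc

variable {k : Type u} [Field k] {n : ℕ} {q : kˣ}

/-- `T[t_c⁻¹ | c ∈ I(p)]`, where `I(p) = {c | t_c ∉ p}`, as a subring of the quantum torus: it is
generated by `T` and the inverses of the `t_c`, `c ∈ I(p)`. -/
def tLoc (p : X k n q) : Subalgebra k (Torus k n q) :=
  Algebra.adjoin k ((fun r : T k n q => phi k n q r) '' Set.univ ∪
    {y | ∃ c, p.Inv c ∧ phi k n q (tElt k n q c) * y = 1 ∧ y * phi k n q (tElt k n q c) = 1})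

theorem phi_mem_tLoc (p : X k n q) {r : RepRing k n q} (hr : r ∈ T k n q) :
    phi k n q r ∈ tLoc p :=
  Algebra.subset_adjoin (Or.inl ⟨⟨r, hr⟩, trivial, rfl⟩)

theorem tLoc_mono {p p' : X k n q} (h : p.Generizes p') : tLoc p ≤ tLoc p' :=
  Algebra.adjoin_mono (Set.union_subset_union_right _ fun _ ⟨c, hc, hy⟩ => ⟨c, h c hc, hy⟩)

/-- The component of projective degree `d` of `T[t_c⁻¹ | c ∈ I(p)]`. -/
def loc (p : X k n q) (d : ℤ) : Submodule k (Torus k n q) :=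
  Subalgebra.toSubmodule (tLoc p) ⊓ Torus.deg k n q d

theorem loc_mono {p p' : X k n q} (h : p.Generizes p') (d : ℤ) : loc p d ≤ loc p' d :=
  inf_le_inf_right _ (tLoc_mono h)

theorem mul_mem_loc {p : X k n q} {d e : ℤ} {x y : Torus k n q} (hx : x ∈ loc p d)
    (hy : y ∈ loc p e) : x * y ∈ loc p (d + e) :=
  ⟨(tLoc p).mul_mem hx.1 hy.1, Torus.mul_mem_deg hx.2 hy.2⟩

theorem phi_mem_loc (p : X k n q) {d : ℕ} {r : RepRing k n q} (hr : r ∈ TPiece k n q d) :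
    phi k n q r ∈ loc p d :=
  ⟨phi_mem_tLoc p (TPiece_le hr), phi_mem_deg hr⟩

/-- The ring `T[t_c⁻¹ | c ∈ I(p)]_0`, that is, the coordinate ring of the principal open set
`U_{I(p)}`. -/
def oLoc (p : X k n q) : Subring (Torus k n q) where
  carrier := loc p 0
  zero_mem' := Submodule.zero_mem _
  one_mem' := ⟨(tLoc p).one_mem, Torus.one_mem_deg k n q⟩
  add_mem' := fun ha hb => Submodule.add_mem _ ha hb
  neg_mem' := fun ha => Submodule.neg_mem _ ha
  mul_mem' := fun {a b} ha hb => by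
    have := mul_mem_loc ha hb
    rwa [add_zero] at this

theorem loc_mul_oLoc {p : X k n q} {d : ℤ} {x c : Torus k n q} (hx : x ∈ loc p d)
    (hc : c ∈ oLoc p) : x * c ∈ loc p d := by
  have := mul_mem_loc hx (show c ∈ loc p 0 from hc)
  rwa [add_zero] at this

theorem oLoc_mul_loc {p : X k n q} {d : ℤ} {x c : Torus k n q} (hc : c ∈ oLoc p)
    (hx : x ∈ loc p d) : c * x ∈ loc p d := by
  have := mul_mem_loc (show c ∈ loc p 0 from hc) hx
  rwa [zero_add] at this

theorem coe_subringIncl {A : Type*} [Ring A] {S S' : Subring A} (h : S ≤ S') (c : S) :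
    (Subring.inclusion h c : A) = c := rfl

theorem coe_submoduleIncl {A M : Type*} [Ring A] [AddCommGroup M] [Module A M]
    {S S' : Submodule A M} (h : S ≤ S') (c : S) :
    ((Submodule.inclusion h).toAddMonoidHom c : M) = c := rfl

theorem oLoc_mono {p p' : X k n q} (h : p.Generizes p') : oLoc p ≤ oLoc p' :=
  fun _ hx => loc_mono h 0 hx

/-- The inclusion `O(U_{I(p)}) ⊆ O(U_{I(p')})`. -/
def oLocIncl {p p' : X k n q} (h : p.Generizes p') : oLoc p →+* oLoc p' :=
  Subring.inclusion (oLoc_mono h)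

/-- The inclusion of the components of degree `d`. -/
def locIncl {p p' : X k n q} (h : p.Generizes p') (d : ℤ) : loc p d →+ loc p' d :=
  (Submodule.inclusion (loc_mono h d)).toAddMonoidHom

theorem coe_oLocIncl {p p' : X k n q} (h : p.Generizes p') (c : oLoc p) :
    (oLocIncl h c : Torus k n q) = c :=
  coe_subringIncl _ _

theorem coe_locIncl {p p' : X k n q} (h : p.Generizes p') (d : ℤ) (x : loc p d) :
    (locIncl h d x : Torus k n q) = x :=
  coe_submoduleIncl _ _

/-- `T[t_c⁻¹ | c ∈ I(p)]_d` is a right module over `T[t_c⁻¹ | c ∈ I(p)]_0`. -/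
instance (p : X k n q) (d : ℤ) : Module (oLoc p)ᵐᵒᵖ (loc p d) where
  smul c x := ⟨x * (unop c : oLoc p), loc_mul_oLoc x.2 (unop c).2⟩
  one_smul _ := Subtype.ext (mul_one _)
  mul_smul _ _ _ := Subtype.ext (mul_assoc _ _ _).symm
  smul_zero _ := Subtype.ext (zero_mul _)
  smul_add _ _ _ := Subtype.ext (add_mul _ _ _)
  add_smul _ _ _ := Subtype.ext (mul_add _ _ _)
  zero_smul _ := Subtype.ext (mul_zero _)

theorem coe_op_smul_loc (p : X k n q) (d : ℤ) (c : (oLoc p)ᵐᵒᵖ) (x : loc p d) :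
    ((c • x : loc p d) : Torus k n q) = x * (unop c : oLoc p) := rfl

theorem locIncl_smul {p p' : X k n q} (h : p.Generizes p') (d : ℤ) (c : (oLoc p)ᵐᵒᵖ)
    (x : loc p d) : locIncl h d (c • x) =
      (op (oLocIncl h (unop c)) : (oLoc p')ᵐᵒᵖ) • locIncl h d x := by
  refine Subtype.ext ?_
  rw [coe_op_smul_loc, coe_locIncl, coe_locIncl, coe_op_smul_loc, unop_op, coe_oLocIncl]

/-- Left multiplication on `T[t_c⁻¹ | c ∈ I(p)]_d` by an element of `T[t_c⁻¹ | c ∈ I(p)]_0`. -/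
def locLeft (p : X k n q) (d : ℤ) (c : oLoc p) : loc p d →ₗ[(oLoc p)ᵐᵒᵖ] loc p d where
  toFun x := ⟨c * x, oLoc_mul_loc c.2 x.2⟩
  map_add' _ _ := Subtype.ext (mul_add _ _ _)
  map_smul' _ _ := Subtype.ext (mul_assoc _ _ _).symm

theorem coe_locLeft (p : X k n q) (d : ℤ) (c : oLoc p) (x : loc p d) :
    (locLeft p d c x : Torus k n q) = c * x := rfl

/-- The ring `O(V)`: the intersection of the rings `O(U_{I(p)}) = T[t_c⁻¹ | c ∈ I(p)]_0` for
`p ∈ V`, realised as the ring of compatible families `(s_p)_{p ∈ V}` with `s_p ∈ O(U_{I(p)})`, so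
that `O(∅) = 0`. The principal open sets `U_{I(p)}`, `p ∈ V`, cover `V`. -/
def O (V : Opens (X k n q)) : Subring (V → Torus k n q) where
  carrier := {s | (∀ p : V, s p ∈ oLoc p.1) ∧ ∀ p p' : V, p.1.Generizes p'.1 → s p = s p'}
  zero_mem' := ⟨fun _ => Subring.zero_mem _, fun _ _ _ => rfl⟩
  one_mem' := ⟨fun _ => Subring.one_mem _, fun _ _ _ => rfl⟩
  add_mem' := fun ha hb => ⟨fun p => Subring.add_mem _ (ha.1 p) (hb.1 p),
    fun p p' h => congrArg₂ (· + ·) (ha.2 p p' h) (hb.2 p p' h)⟩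
  mul_mem' := fun ha hb => ⟨fun p => Subring.mul_mem _ (ha.1 p) (hb.1 p),
    fun p p' h => congrArg₂ (· * ·) (ha.2 p p' h) (hb.2 p p' h)⟩
  neg_mem' := fun ha => ⟨fun p => Subring.neg_mem _ (ha.1 p),
    fun p p' h => congrArg (- ·) (ha.2 p p' h)⟩

/-- The value in `O(U_{I(p)})` of a section over `V`, for `p ∈ V`. -/
def O.eval {V : Opens (X k n q)} (p : V) : O V →+* oLoc p.1 where
  toFun s := ⟨s.1 p, s.2.1 p⟩
  map_one' := rfl
  map_mul' _ _ := rfl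
  map_zero' := rfl
  map_add' _ _ := rfl

theorem O.coe_eval {V : Opens (X k n q)} (p : V) (s : O V) :
    (O.eval p s : Torus k n q) = s.1 p := rfl

/-- Restriction of sections of the structure sheaf. -/
def O.res {V V' : Opens (X k n q)} (h : V' ≤ V) : O V →+* O V' where
  toFun s := ⟨fun p => s.1 ⟨p.1, h p.2⟩, fun p => s.2.1 ⟨p.1, h p.2⟩,
    fun p p' hp => s.2.2 ⟨p.1, h p.2⟩ ⟨p'.1, h p'.2⟩ hp⟩
  map_one' := rfl
  map_mul' _ _ := rfl
  map_zero' := rfl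
  map_add' _ _ := rfl

variable (k n q) in
/-- The presheaf of rings `V ↦ O(V)ᵒᵖ`; its left modules are the right `O`-modules. -/
def oPresheaf : (Opens (X k n q))ᵒᵖ ⥤ RingCat.{u} where
  obj V := RingCat.of (O V.unop)ᵐᵒᵖ
  map f := RingCat.ofHom (RingHom.op (O.res f.unop.le))
  map_id _ := rfl
  map_comp _ _ := rfl

theorem O.glue {ι : Type*} (W : ι → Opens (X k n q)) (sf : ∀ i, O (W i))
    (hsf : ∀ i j, O.res (inf_le_left : W i ⊓ W j ≤ W i) (sf i) =
      O.res (inf_le_right : W i ⊓ W j ≤ W j) (sf j)) :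
    ∃! s : O (iSup W), ∀ i, O.res (le_iSup W i) s = sf i := by
  have hc : ∀ (i j : ι) (p : X k n q) (hi : p ∈ W i) (hj : p ∈ W j),
      (sf i).1 ⟨p, hi⟩ = (sf j).1 ⟨p, hj⟩ := fun i j p hi hj =>
    congrArg (fun s : O (W i ⊓ W j) => s.1 ⟨p, hi, hj⟩) (hsf i j)
  have hm : ∀ p : (iSup W : Opens (X k n q)), ∃ i, p.1 ∈ W i := fun p => Opens.mem_iSup.1 p.2
  choose i hi using hm
  refine ⟨⟨fun p => (sf (i p)).1 ⟨p.1, hi p⟩, fun p => (sf (i p)).2.1 ⟨p.1, hi p⟩,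
    fun p p' h => ?_⟩, fun j => Subtype.ext (funext fun p => hc _ j p.1 (hi _) p.2),
    fun s hs => Subtype.ext (funext fun p =>
      congrArg (fun s : O (W (i p)) => s.1 ⟨p.1, hi p⟩) (hs (i p)))⟩
  have hp' : p'.1 ∈ W (i p) := X.Generizes.mem k n q h (hi p)
  exact ((sf (i p)).2.2 ⟨p.1, hi p⟩ ⟨p'.1, hp'⟩ h).trans (hc (i p) (i p') p'.1 hp' (hi p'))

theorem oPresheaf_isSheaf :
    Presheaf.IsSheaf (Opens.grothendieckTopology (X k n q)) (oPresheaf k n q) := by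
  change TopCat.Presheaf.IsSheaf (X := TopCat.of (X k n q)) (oPresheaf k n q)
  rw [TopCat.Presheaf.isSheaf_iff_isSheafUniqueGluing]
  intro ι W sf hsf
  obtain ⟨s, hs, hs'⟩ := O.glue W (fun i => unop (show (O (W i))ᵐᵒᵖ from sf i))
    (fun i j => congrArg (fun t : (O (W i ⊓ W j))ᵐᵒᵖ => unop t) (hsf i j))
  exact ⟨op s, fun i => congrArg op (hs i), fun t ht => congrArg op
    (hs' (unop (show (O (iSup W))ᵐᵒᵖ from t)) fun i =>
      congrArg (fun t : (O (W i))ᵐᵒᵖ => unop t) (ht i))⟩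

variable (k n q) in
/-- The structure sheaf of `𝔛`, with the opposite ring structure. -/
def oSheaf : Sheaf (Opens.grothendieckTopology (X k n q)) RingCat.{u} :=
  ⟨oPresheaf k n q, oPresheaf_isSheaf⟩

variable (k n q) in
/-- The category of right `O_𝔛`-modules. -/
abbrev OMod : Type (u + 1) := SheafOfModules.{u} (oSheaf k n q)

/-- The sections `F(V)` of a right `O_𝔛`-module. -/
abbrev OMod.sec (F : OMod k n q) (V : Opens (X k n q)) : Type u := F.val.obj (Opposite.op V)

instance (F : OMod k n q) (V : Opens (X k n q)) : Module (O V)ᵐᵒᵖ (F.sec V) :=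
  (F.val.obj (Opposite.op V)).isModule

/-- The restriction maps of a right `O_𝔛`-module. -/
def OMod.res (F : OMod k n q) {V V' : Opens (X k n q)} (h : V' ≤ V) : F.sec V →+ F.sec V' :=
  AddMonoidHom.mk' (fun s => F.val.map (homOfLE h).op s) fun _ _ =>
    map_add (F.val.map (homOfLE h).op).hom _ _

theorem OMod.res_smul (F : OMod k n q) {V V' : Opens (X k n q)} (h : V' ≤ V) (f : O V)
    (s : F.sec V) : F.res h (op f • s) = op (O.res h f) • F.res h s :=
  F.val.map_smul (homOfLE h).op (op f) s

theorem OMod.res_res (F : OMod k n q) {V V' V'' : Opens (X k n q)} (h : V' ≤ V) (h' : V'' ≤ V')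
    (s : F.sec V) : F.res h' (F.res h s) = F.res (h'.trans h) s :=
  (F.val.map_comp_apply (homOfLE h).op (homOfLE h').op s).symm

/-- The maps on sections of a morphism of right `O_𝔛`-modules. -/
def OMod.app {F G : OMod k n q} (f : F ⟶ G) (V : Opens (X k n q)) : F.sec V →+ G.sec V :=
  (f.val.app (Opposite.op V)).hom.toAddMonoidHom

theorem OMod.app_smul {F G : OMod k n q} (f : F ⟶ G) (V : Opens (X k n q)) (r : O V)
    (s : F.sec V) : OMod.app f V (op r • s) = op r • OMod.app f V s :=
  (f.val.app (Opposite.op V)).hom.map_smul (op r) s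

theorem OMod.app_res {F G : OMod k n q} (f : F ⟶ G) {V V' : Opens (X k n q)} (h : V' ≤ V)
    (s : F.sec V) : OMod.app f V' (F.res h s) = G.res h (OMod.app f V s) :=
  PresheafOfModules.naturality_apply f.val (homOfLE h).op s

/-! ### Sheaves glued from the principal open sets -/

variable (k n q) in
/-- A compatible system of right `O(U_{I(p)})`-modules, for the points `p` of an open set `W`, with
restriction maps. The sets `U_{I(p)}`, `p ∈ W`, are a basis of the topology of `W`. -/
structure Diag (W : Opens (X k n q)) where
  obj : ∀ p : X k n q, p ∈ W → Type u
  [grp : ∀ p hp, AddCommGroup (obj p hp)]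
  [mod : ∀ p hp, Module (oLoc p)ᵐᵒᵖ (obj p hp)]
  res : ∀ {p p' : X k n q} (hp : p ∈ W) (hp' : p' ∈ W), p.Generizes p' → obj p hp →+ obj p' hp'
  res_smul : ∀ {p p' : X k n q} (hp : p ∈ W) (hp' : p' ∈ W) (h : p.Generizes p') (c : oLoc p)
    (m : obj p hp), res hp hp' h (op c • m) = op (oLocIncl h c) • res hp hp' h m

attribute [instance] Diag.grp Diag.mod

/-- The sections over `V ⊆ W` of the sheaf on `W` with value `D.obj p` on `U_{I(p)}`: compatible
families of elements of the `D.obj p`, `p ∈ V`. -/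
def Diag.sec {W : Opens (X k n q)} (D : Diag k n q W) (V : Opens (X k n q)) (hV : V ≤ W) :
    AddSubgroup (∀ p : V, D.obj p.1 (hV p.2)) where
  carrier := {s | ∀ (p p' : V) (h : p.1.Generizes p'.1), D.res (hV p.2) (hV p'.2) h (s p) = s p'}
  zero_mem' := fun _ _ _ => map_zero _
  add_mem' := fun ha hb p p' h => by
    rw [Pi.add_apply, map_add, ha p p' h, hb p p' h]; rfl
  neg_mem' := fun ha p p' h => by
    rw [Pi.neg_apply, map_neg, ha p p' h]; rfl

/-- The right action of `O(V)` on the sections over `V`. -/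
instance {W : Opens (X k n q)} (D : Diag k n q W) (V : Opens (X k n q)) (hV : V ≤ W) :
    Module (O V)ᵐᵒᵖ (D.sec V hV) where
  smul f s := ⟨fun p => (op (O.eval p (unop f)) : (oLoc p.1)ᵐᵒᵖ) • s.1 p, fun p p' h => by
    rw [D.res_smul _ _ h, s.2 p p' h]
    congr 2
    exact Subtype.ext ((unop f : O V).2.2 p p' h)⟩
  one_smul s := Subtype.ext (funext fun p => one_smul _ (s.1 p))
  mul_smul f g s := Subtype.ext (funext fun p =>
    mul_smul (op (O.eval p (unop f))) (op (O.eval p (unop g))) (s.1 p))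
  smul_zero f := Subtype.ext (funext fun p => smul_zero (op (O.eval p (unop f))))
  smul_add f s s' := Subtype.ext (funext fun p =>
    smul_add (op (O.eval p (unop f))) (s.1 p) (s'.1 p))
  add_smul f g s := Subtype.ext (funext fun p =>
    add_smul (op (O.eval p (unop f))) (op (O.eval p (unop g))) (s.1 p))
  zero_smul s := Subtype.ext (funext fun p => zero_smul _ (s.1 p))

/-- Restriction of sections. -/
def Diag.secRes {W : Opens (X k n q)} (D : Diag k n q W) {V V' : Opens (X k n q)} (hV : V ≤ W)
    (h : V' ≤ V) : D.sec V hV →+ D.sec V' (h.trans hV) where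
  toFun s := ⟨fun p => s.1 ⟨p.1, h p.2⟩, fun p p' hp => s.2 ⟨p.1, h p.2⟩ ⟨p'.1, h p'.2⟩ hp⟩
  map_zero' := rfl
  map_add' _ _ := rfl

theorem Diag.glue {ι : Type*} (D : Diag k n q ⊤) (W : ι → Opens (X k n q))
    (sf : ∀ i, D.sec (W i) le_top)
    (hsf : ∀ i j, D.secRes le_top (inf_le_left : W i ⊓ W j ≤ W i) (sf i) =
      D.secRes le_top (inf_le_right : W i ⊓ W j ≤ W j) (sf j)) :
    ∃! s : D.sec (iSup W) le_top, ∀ i, D.secRes le_top (le_iSup W i) s = sf i := by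
  have hc : ∀ (i j : ι) (p : X k n q) (hi : p ∈ W i) (hj : p ∈ W j),
      (sf i).1 ⟨p, hi⟩ = (sf j).1 ⟨p, hj⟩ := fun i j p hi hj =>
    congrArg (fun s : D.sec (W i ⊓ W j) le_top => s.1 ⟨p, hi, hj⟩) (hsf i j)
  have hm : ∀ p : (iSup W : Opens (X k n q)), ∃ i, p.1 ∈ W i := fun p => Opens.mem_iSup.1 p.2
  choose i hi using hm
  refine ⟨⟨fun p => (sf (i p)).1 ⟨p.1, hi p⟩, fun p p' h => ?_⟩,
    fun j => Subtype.ext (funext fun p => hc _ j p.1 (hi _) p.2),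
    fun s hs => Subtype.ext (funext fun p =>
      congrArg (fun s : D.sec (W (i p)) le_top => s.1 ⟨p.1, hi p⟩) (hs (i p)))⟩
  have hp' : p'.1 ∈ W (i p) := X.Generizes.mem k n q h (hi p)
  exact ((sf (i p)).2 ⟨p.1, hi p⟩ ⟨p'.1, hp'⟩ h).trans (hc (i p) (i p') p'.1 hp' (hi p'))

/-- The presheaf of abelian groups of sections. -/
def Diag.presheaf (D : Diag k n q ⊤) : (Opens (X k n q))ᵒᵖ ⥤ Ab.{u} where
  obj V := AddCommGrpCat.of (D.sec V.unop le_top)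
  map f := AddCommGrpCat.ofHom (D.secRes le_top f.unop.le)
  map_id _ := rfl
  map_comp _ _ := rfl

instance (D : Diag k n q ⊤) (V : (Opens (X k n q))ᵒᵖ) :
    Module ((oSheaf k n q).obj.obj V) (D.presheaf.obj V) :=
  inferInstanceAs (Module (O V.unop)ᵐᵒᵖ (D.sec V.unop le_top))

theorem Diag.presheaf_isSheaf (D : Diag k n q ⊤) :
    Presheaf.IsSheaf (Opens.grothendieckTopology (X k n q)) D.presheaf := by
  change TopCat.Presheaf.IsSheaf (X := TopCat.of (X k n q)) D.presheaf
  rw [TopCat.Presheaf.isSheaf_iff_isSheafUniqueGluing]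
  intro ι W sf hsf
  exact D.glue W sf hsf

/-- The right `O_𝔛`-module glued from a system of modules on the principal open sets. -/
def Diag.sheaf (D : Diag k n q ⊤) : OMod k n q where
  val := PresheafOfModules.ofPresheaf D.presheaf fun _ _ _ _ _ => rfl
  isSheaf := D.presheaf_isSheaf

/-- Morphisms of systems. -/
structure Diag.Hom {W : Opens (X k n q)} (D D' : Diag k n q W) where
  app : ∀ p hp, D.obj p hp →ₗ[(oLoc p)ᵐᵒᵖ] D'.obj p hp
  app_res : ∀ {p p' : X k n q} (hp : p ∈ W) (hp' : p' ∈ W) (h : p.Generizes p') (m : D.obj p hp),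
    app p' hp' (D.res hp hp' h m) = D'.res hp hp' h (app p hp m)

/-- The action on sections of a morphism of systems. -/
def Diag.Hom.sec {W : Opens (X k n q)} {D D' : Diag k n q W} (f : D.Hom D')
    (V : Opens (X k n q)) (hV : V ≤ W) : D.sec V hV →+ D'.sec V hV where
  toFun s := ⟨fun p => f.app _ _ (s.1 p), fun p p' h => by
    rw [← f.app_res _ _ h, s.2 p p' h]⟩
  map_zero' := Subtype.ext (funext fun _ => map_zero _)
  map_add' _ _ := Subtype.ext (funext fun _ => map_add _ _ _)

/-- The morphism of sheaves induced by a morphism of systems. -/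
def Diag.Hom.sheaf {D D' : Diag k n q ⊤} (f : D.Hom D') : D.sheaf ⟶ D'.sheaf where
  val := PresheafOfModules.homMk
    (M₁ := D.sheaf.val) (M₂ := D'.sheaf.val)
    ({ app := fun V => AddCommGrpCat.ofHom (f.sec V.unop le_top)
       naturality := fun _ _ _ => rfl } : D.presheaf ⟶ D'.presheaf)
    (fun _ _ _ => Subtype.ext (funext fun p => (f.app p.1 (Opens.mem_top p.1)).map_smul _ _))

end Loc

/-! ### Tensor products over noncommutative rings -/

section Tensor

/-- The additive map between quotients by submodules induced by a semilinear map. -/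
def quotMap {A B R R' : Type*} [AddCommGroup A] [AddCommGroup B] [Ring R] [Ring R'] [Module R A]
    [Module R' B] (S : Set A) (N : Submodule R' B) (f : A →+ B) (σ : R → R')
    (hf : ∀ c a, f (c • a) = σ c • f a) (hS : ∀ a ∈ S, f a ∈ N) :
    (A ⧸ Submodule.span R S) →+ (B ⧸ N) :=
  QuotientAddGroup.map (Submodule.span R S).toAddSubgroup N.toAddSubgroup f fun a ha => by
    change f a ∈ N
    refine Submodule.span_induction (p := fun a _ => f a ∈ N) hS ?_ ?_ ?_ ha
    · rw [map_zero]; exact N.zero_mem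
    · intro x y _ _ hx hy; rw [map_add]; exact N.add_mem hx hy
    · intro c x _ hx; rw [hf]; exact N.smul_mem _ hx

variable (A S : Type u) [Ring A] [Ring S]
  (M : Type u) [AddCommGroup M] [Module Sᵐᵒᵖ M] (L : Type u) [AddCommGroup L] [Module Aᵐᵒᵖ L]
  (act : S → L →ₗ[Aᵐᵒᵖ] L)

/-- The relations `m s ⊗ l = m ⊗ s l`; the factors are written in the opposite order. -/
def balRel : Set (L ⊗[ℤ] M) :=
  {x | ∃ (l : L) (s : S) (m : M), x = l ⊗ₜ[ℤ] ((op s : Sᵐᵒᵖ) • m) - (act s l) ⊗ₜ[ℤ] m}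

/-- The right `A`-module `M ⊗_S L`, for a right `S`-module `M` and an `S`-`A`-bimodule `L` whose left
action is `act`: the quotient of the tensor product over `ℤ` by the relations
`m s ⊗ l = m ⊗ s l`. -/
abbrev BalTensor : Type u := (L ⊗[ℤ] M) ⧸ Submodule.span Aᵐᵒᵖ (balRel A S M L act)

/-- The tensor product of additive maps. -/
def tmap {L L' M M' : Type*} [AddCommGroup L] [AddCommGroup L'] [AddCommGroup M] [AddCommGroup M']
    (g : L →+ L') (f : M →+ M') : L ⊗[ℤ] M →+ L' ⊗[ℤ] M' :=
  (TensorProduct.map g.toIntLinearMap f.toIntLinearMap).toAddMonoidHom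

theorem tmap_tmul {L L' M M' : Type*} [AddCommGroup L] [AddCommGroup L'] [AddCommGroup M]
    [AddCommGroup M'] (g : L →+ L') (f : M →+ M') (l : L) (m : M) :
    tmap g f (l ⊗ₜ[ℤ] m) = g l ⊗ₜ[ℤ] f m := rfl

theorem tmap_smul {R R' L L' M M' : Type*} [Ring R] [Ring R'] [AddCommGroup L] [AddCommGroup L']
    [AddCommGroup M] [AddCommGroup M'] [Module R L] [Module R' L'] (g : L →+ L') (f : M →+ M')
    (σ : R → R') (hg : ∀ c l, g (c • l) = σ c • g l) (c : R) (x : L ⊗[ℤ] M) :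
    tmap g f (c • x) = σ c • tmap g f x := by
  induction x using TensorProduct.induction_on with
  | zero => rw [smul_zero, map_zero, smul_zero]
  | add x y hx hy => rw [smul_add, map_add, hx, hy, map_add, smul_add]
  | tmul l m =>
    rw [TensorProduct.smul_tmul', tmap_tmul, hg, tmap_tmul, TensorProduct.smul_tmul']

variable {A S M L act} in
theorem smul_mem_balRel (c : Aᵐᵒᵖ) {x : L ⊗[ℤ] M} (hx : x ∈ balRel A S M L act) :
    c • x ∈ balRel A S M L act := by
  obtain ⟨l, s, m, rfl⟩ := hx
  refine ⟨c • l, s, m, ?_⟩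
  rw [smul_sub, TensorProduct.smul_tmul', TensorProduct.smul_tmul', LinearMap.map_smul]

variable {A S M L act} in
/-- The map `M ⊗_S L → M' ⊗_{S'} L'` induced by maps `M → M'` and `L → L'` that are semilinear with
respect to `S → S'`. -/
def BalTensor.map {A' S' M' L' : Type u} [Ring A'] [Ring S'] [AddCommGroup M'] [Module S'ᵐᵒᵖ M']
    [AddCommGroup L'] [Module A'ᵐᵒᵖ L'] {act' : S' → L' →ₗ[A'ᵐᵒᵖ] L'}
    (f : M →+ M') (g : L →+ L') (τ : S → S')
    (hf : ∀ s m, f ((op s : Sᵐᵒᵖ) • m) = (op (τ s) : S'ᵐᵒᵖ) • f m)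
    (hact : ∀ s l, g (act s l) = act' (τ s) (g l)) :
    BalTensor A S M L act →+ BalTensor A' S' M' L' act' :=
  QuotientAddGroup.map (Submodule.span Aᵐᵒᵖ (balRel A S M L act)).toAddSubgroup
    (Submodule.span A'ᵐᵒᵖ (balRel A' S' M' L' act')).toAddSubgroup (tmap g f) fun a ha => by
    change tmap g f a ∈ Submodule.span A'ᵐᵒᵖ (balRel A' S' M' L' act')
    refine Submodule.closure_induction
      (p := fun a _ => tmap g f a ∈ Submodule.span A'ᵐᵒᵖ (balRel A' S' M' L' act')) ?_ ?_ ?_ ha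
    · rw [map_zero]; exact Submodule.zero_mem _
    · intro x y _ _ hx hy; rw [map_add]; exact Submodule.add_mem _ hx hy
    · intro c x hx
      obtain ⟨l, s, m, hx⟩ := smul_mem_balRel c hx
      refine Submodule.subset_span ⟨g l, τ s, f m, ?_⟩
      rw [hx, map_sub, tmap_tmul, tmap_tmul, hf, hact]

variable {A S M L act} in
/-- The class of `m ⊗ l`. -/
def BalTensor.mk (m : M) (l : L) : BalTensor A S M L act := Submodule.Quotient.mk (l ⊗ₜ[ℤ] m)

variable {A S M L act} in
theorem BalTensor.smul_mk (c : Aᵐᵒᵖ) (m : M) (l : L) :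
    c • (BalTensor.mk m l : BalTensor A S M L act) = BalTensor.mk m (c • l) := rfl

variable {A S M L act} in
theorem BalTensor.map_mk {A' S' M' L' : Type u} [Ring A'] [Ring S'] [AddCommGroup M']
    [Module S'ᵐᵒᵖ M'] [AddCommGroup L'] [Module A'ᵐᵒᵖ L'] {act' : S' → L' →ₗ[A'ᵐᵒᵖ] L'}
    (f : M →+ M') (g : L →+ L') (τ : S → S')
    (hf : ∀ s m, f ((op s : Sᵐᵒᵖ) • m) = (op (τ s) : S'ᵐᵒᵖ) • f m)
    (hact : ∀ s l, g (act s l) = act' (τ s) (g l)) (m : M) (l : L) :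
    BalTensor.map (act := act) (act' := act') f g τ hf hact (BalTensor.mk m l) =
      BalTensor.mk (f m) (g l) := rfl

variable {A S M L act} in
theorem BalTensor.induction {P : BalTensor A S M L act → Prop} (x : BalTensor A S M L act)
    (zero : P 0) (add : ∀ x y, P x → P y → P (x + y))
    (mk : ∀ m l, P (BalTensor.mk m l)) : P x := by
  obtain ⟨x, rfl⟩ := Submodule.Quotient.mk_surjective _ x
  induction x using TensorProduct.induction_on with
  | zero => exact zero
  | tmul l m => exact mk m l
  | add x y hx hy => exact add _ _ hx hy

variable {A S M L act} in
theorem BalTensor.map_smul {A' S' M' L' : Type u} [Ring A'] [Ring S'] [AddCommGroup M']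
    [Module S'ᵐᵒᵖ M'] [AddCommGroup L'] [Module A'ᵐᵒᵖ L'] {act' : S' → L' →ₗ[A'ᵐᵒᵖ] L'}
    (f : M →+ M') (g : L →+ L') (τ : S → S') (σ : Aᵐᵒᵖ → A'ᵐᵒᵖ)
    (hf : ∀ s m, f ((op s : Sᵐᵒᵖ) • m) = (op (τ s) : S'ᵐᵒᵖ) • f m)
    (hact : ∀ s l, g (act s l) = act' (τ s) (g l)) (hg : ∀ c l, g (c • l) = σ c • g l)
    (c : Aᵐᵒᵖ) (x : BalTensor A S M L act) :
    BalTensor.map (act' := act') f g τ hf hact (c • x) =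
      σ c • BalTensor.map f g τ hf hact x := by
  induction x using BalTensor.induction with
  | zero => rw [smul_zero, map_zero, smul_zero]
  | add x y hx hy => rw [smul_add, map_add, hx, hy, map_add, smul_add]
  | mk m l => rw [BalTensor.smul_mk, BalTensor.map_mk, hg, BalTensor.map_mk, BalTensor.smul_mk]

end Tensor

/-! ### Quasicoherent and coherent modules -/

section Coherent

variable {k : Type u} [Field k] {n : ℕ} {q : kˣ}

/-- The left action of `O(V)` on `T[t_c⁻¹ | c ∈ I(p)]_d`, for `p ∈ V`. -/
def oAct {V : Opens (X k n q)} (p : V) (d : ℤ) (f : O V) : loc p.1 d →ₗ[(oLoc p.1)ᵐᵒᵖ] loc p.1 d :=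
  locLeft p.1 d (O.eval p f)

theorem oAct_locIncl {V : Opens (X k n q)} {p p' : X k n q} (h : p.Generizes p') (hp : p ∈ V)
    (hp' : p' ∈ V) (d : ℤ) (f : O V) (l : loc p d) :
    locIncl h d (oAct ⟨p, hp⟩ d f l) = oAct ⟨p', hp'⟩ d f (locIncl h d l) := by
  refine Subtype.ext ?_
  unfold oAct
  rw [coe_locIncl, coe_locLeft, coe_locLeft, coe_locIncl, O.coe_eval, O.coe_eval,
    f.2.2 ⟨p, hp⟩ ⟨p', hp'⟩ h]

/-- For a right `O(W)`-module `N`, the system `p ↦ N ⊗_{O(W)} O(U_{I(p)})` on `W`; the associated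
sheaf on `W` is the sheaf `Ñ`. -/
def tilde (W : Opens (X k n q)) (N : Type u) [AddCommGroup N] [Module (O W)ᵐᵒᵖ N] :
    Diag k n q W where
  obj p hp := BalTensor (oLoc p) (O W) N (loc p 0) (oAct ⟨p, hp⟩ 0)
  res hp hp' h := BalTensor.map (AddMonoidHom.id N) (locIncl h 0) id (fun _ _ => rfl)
    (oAct_locIncl h hp hp' 0)
  res_smul _ _ h c m := BalTensor.map_smul _ _ _ (fun c => op (oLocIncl h (unop c))) _ _
    (locIncl_smul h 0) (op c) m

/-- An isomorphism of right `O_W`-modules between `F|_W` and `Ñ`. -/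
structure TildeIso (F : OMod k n q) (W : Opens (X k n q)) (N : Type u) [AddCommGroup N]
    [Module (O W)ᵐᵒᵖ N] where
  equiv : ∀ (V : Opens (X k n q)) (hV : V ≤ W), F.sec V ≃+ (tilde W N).sec V hV
  equiv_smul : ∀ (V : Opens (X k n q)) (hV : V ≤ W) (f : O V) (s : F.sec V),
    equiv V hV ((op f : (O V)ᵐᵒᵖ) • s) = (op f : (O V)ᵐᵒᵖ) • equiv V hV s
  equiv_res : ∀ (V V' : Opens (X k n q)) (hV : V ≤ W) (h : V' ≤ V) (s : F.sec V),
    equiv V' (h.trans hV) (F.res h s) = (tilde W N).secRes hV h (equiv V hV s)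

variable (k n q) in
/-- A right `O_𝔛`-module `F` is quasicoherent if for every `0 ≤ i ≤ n` there is a right
`O(U_i)`-module `N` with `F|_{U_i} ≅ Ñ`. -/
def quasicoherent : ObjectProperty (OMod k n q) := fun F =>
  ∀ i : Fin (n + 1), ∃ (N : Type u) (_ : AddCommGroup N) (_ : Module (O (U k n q (.t i)))ᵐᵒᵖ N),
    Nonempty (TildeIso F (U k n q (.t i)) N)

variable (k n q) in
/-- A right `O_𝔛`-module `F` is coherent if for every `0 ≤ i ≤ n` there is a finitely generated right
`O(U_i)`-module `N` with `F|_{U_i} ≅ Ñ`. -/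
def coherent : ObjectProperty (OMod k n q) := fun F =>
  ∀ i : Fin (n + 1), ∃ (N : Type u) (_ : AddCommGroup N) (_ : Module (O (U k n q (.t i)))ᵐᵒᵖ N),
    Module.Finite (O (U k n q (.t i)))ᵐᵒᵖ N ∧ Nonempty (TildeIso F (U k n q (.t i)) N)

theorem coherent_le : coherent k n q ≤ quasicoherent k n q := fun _ h i =>
  let ⟨N, a, b, _, e⟩ := h i
  ⟨N, a, b, e⟩

variable (k n q) in
/-- The category `Mod O_𝔛` of quasicoherent right `O_𝔛`-modules. -/
abbrev QCoh : Type (u + 1) := (quasicoherent k n q).FullSubcategory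

variable (k n q) in
/-- The category `mod O_𝔛` of coherent right `O_𝔛`-modules. -/
abbrev Coh : Type (u + 1) := (coherent k n q).FullSubcategory

end Coherent

/-! ### Graded modules and the quotient category -/

section Graded

/-- A `ℤ`-graded right `T`-module `M = ⨁_d M_d` (for the projective grading of `T`), given by its
components `M_d` and the multiplication maps `M_d × T_e → M_{d+e}`. -/
structure GrMod (k : Type u) [Field k] (n : ℕ) (q : kˣ) where
  comp : ℤ → Type u
  [grp : ∀ d, AddCommGroup (comp d)]
  act : ∀ {d f : ℤ} (e : ℕ), d + e = f → comp d →+ TPiece k n q e →+ comp f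
  act_one : ∀ {d : ℤ} (h : d + (0 : ℕ) = d) (m : comp d),
    act 0 h m ⟨1, one_mem_TPiece k n q⟩ = m
  act_act : ∀ {d f g : ℤ} (e e' : ℕ) (h : d + e = f) (h' : f + e' = g)
    (h'' : d + (e + e' : ℕ) = g) (m : comp d) (r : TPiece k n q e) (r' : TPiece k n q e'),
    act e' h' (act e h m r) r' = act (e + e') h'' m ⟨r * r', mul_mem_TPiece r.2 r'.2⟩

attribute [instance] GrMod.grp

variable {k : Type u} [Field k] {n : ℕ} {q : kˣ}

/-- Degree-preserving homomorphisms of graded right `T`-modules. -/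
@[ext]
structure GrMod.Hom (M N : GrMod k n q) where
  app : ∀ d, M.comp d →+ N.comp d
  app_act : ∀ {d f : ℤ} (e : ℕ) (h : d + e = f) (m : M.comp d) (r : TPiece k n q e),
    app f (M.act e h m r) = N.act e h (app d m) r

/-- The category `Gr T`. -/
instance : Category (GrMod k n q) where
  Hom := GrMod.Hom
  id M := ⟨fun _ => AddMonoidHom.id _, fun _ _ _ _ => rfl⟩
  comp f g := ⟨fun d => (g.app d).comp (f.app d), fun e h m r => by
    simp [f.app_act, g.app_act]⟩

/-- A homogeneous element `m` is torsion modulo the graded subgroup `P` if `m (T_+)^s ⊆ P` for some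
`s`. -/
def GrMod.TorsionMod (M : GrMod k n q) (P : ∀ d, AddSubgroup (M.comp d)) {d : ℤ} (m : M.comp d) :
    Prop :=
  ∃ s : ℕ, ∀ {f : ℤ} (e : ℕ) (h : d + e = f) (r : TPiece k n q e),
    (r : RepRing k n q) ∈ (TPlus k n q) ^ s → M.act e h m r ∈ P f

variable (k n q) in
/-- The morphisms of `Gr T` whose kernel and cokernel are `T_+`-torsion. -/
def isoModTors : MorphismProperty (GrMod k n q) := fun M N f =>
  (∀ (d : ℤ) (m : M.comp d), f.app d m = 0 → M.TorsionMod (fun _ => ⊥) m) ∧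
  ∀ (d : ℤ) (m : N.comp d), N.TorsionMod (fun e => (f.app e).range) m

variable (k n q) in
/-- The quotient category `QGr T = Gr T / Tors T`: the localisation of `Gr T` at the morphisms with
torsion kernel and cokernel. -/
abbrev QGr : Type (u + 1) := (isoModTors k n q).Localization

variable (k n q) in
/-- The category `qgr T` of noetherian objects of `QGr T`. -/
abbrev Qgr : Type (u + 1) := (isNoetherianObject (C := QGr k n q)).FullSubcategory

end Graded

/-! ### The functor `𝛑` -/

section Pi

variable {k : Type u} [Field k] {n : ℕ} {q : kˣ}

/-- `t l` for `t ∈ T_e` and `l ∈ T[t_c⁻¹ | c ∈ I(p)]_{-f}`, where `d + e = f`. -/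
def tMulLoc (p : X k n q) {d f : ℤ} (e : ℕ) (h : d + e = f) (t : TPiece k n q e) (l : loc p (-f)) :
    loc p (-d) :=
  ⟨phi k n q t * l, by
    have := mul_mem_loc (phi_mem_loc p t.2) l.2
    rwa [show (e : ℤ) + -f = -d by omega] at this⟩

theorem coe_tMulLoc (p : X k n q) {d f : ℤ} (e : ℕ) (h : d + e = f) (t : TPiece k n q e)
    (l : loc p (-f)) : (tMulLoc p e h t l : Torus k n q) = phi k n q t * l := rfl

theorem locIncl_tMulLoc {p p' : X k n q} (h : p.Generizes p') {d f : ℤ} (e : ℕ) (hd : d + e = f)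
    (t : TPiece k n q e) (l : loc p (-f)) :
    locIncl h (-d) (tMulLoc p e hd t l) = tMulLoc p' e hd t (locIncl h (-f) l) := by
  refine Subtype.ext ?_
  rw [coe_locIncl, coe_tMulLoc, coe_tMulLoc, coe_locIncl]

theorem locIncl_locIncl {p p' p'' : X k n q} (h : p.Generizes p') (h' : p'.Generizes p'')
    (h'' : p.Generizes p'') (d : ℤ) (l : loc p d) :
    locIncl h' d (locIncl h d l) = locIncl h'' d l := by
  refine Subtype.ext ?_
  rw [coe_locIncl, coe_locIncl, coe_locIncl]

theorem locIncl_refl {p : X k n q} (h : p.Generizes p) (d : ℤ) (l : loc p d) :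
    locIncl h d l = l :=
  Subtype.ext (coe_locIncl h d l)

/-- `M_d ⊗_ℤ T[t_c⁻¹ | c ∈ I(p)]_{-d}`, with the factors in the opposite order. -/
def LocTensor (M : GrMod k n q) (p : X k n q) (d : ℤ) : Type u := loc p (-d) ⊗[ℤ] M.comp d

instance (M : GrMod k n q) (p : X k n q) (d : ℤ) : AddCommGroup (LocTensor M p d) :=
  inferInstanceAs (AddCommGroup (loc p (-d) ⊗[ℤ] M.comp d))

instance (M : GrMod k n q) (p : X k n q) (d : ℤ) : Module (oLoc p)ᵐᵒᵖ (LocTensor M p d) :=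
  inferInstanceAs (Module (oLoc p)ᵐᵒᵖ (loc p (-d) ⊗[ℤ] M.comp d))

/-- The element `m ⊗ l`. -/
def LocTensor.mk {M : GrMod k n q} {p : X k n q} {d : ℤ} (m : M.comp d) (l : loc p (-d)) :
    LocTensor M p d := l ⊗ₜ[ℤ] m

/-- The map induced by a homomorphism `f : M → N` and the inclusion `I(p) ⊆ I(p')`. -/
def LocTensor.map {M N : GrMod k n q} (f : M ⟶ N) {p p' : X k n q} (h : p.Generizes p') (d : ℤ) :
    LocTensor M p d →+ LocTensor N p' d :=
  tmap (locIncl h (-d)) (f.app d)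

theorem LocTensor.map_smul {M N : GrMod k n q} (f : M ⟶ N) {p p' : X k n q} (h : p.Generizes p')
    (d : ℤ) (c : (oLoc p)ᵐᵒᵖ) (x : LocTensor M p d) :
    LocTensor.map f h d (c • x) =
      (op (oLocIncl h (unop c)) : (oLoc p')ᵐᵒᵖ) • LocTensor.map f h d x :=
  tmap_smul (locIncl h (-d)) (f.app d) (fun c => op (oLocIncl h (unop c)))
    (locIncl_smul h (-d)) c x

/-- The relations `m t ⊗ l = m ⊗ t l` for homogeneous `m`, `t`, `l` of total degree `0`; the factors
are written in the opposite order. -/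
def locRel (M : GrMod k n q) (p : X k n q) : Set (⨁ d : ℤ, LocTensor M p d) :=
  {x | ∃ (d f : ℤ) (e : ℕ) (h : d + e = f) (m : M.comp d) (t : TPiece k n q e) (l : loc p (-f)),
    x = DirectSum.of (LocTensor M p) f (.mk (M.act e h m t) l) -
      DirectSum.of (LocTensor M p) d (.mk m (tMulLoc p e h t l))}

/-- The right `T[t_c⁻¹ | c ∈ I(p)]_0`-module `M[t_c⁻¹ | c ∈ I(p)]_0`, the component of degree `0` of
`M ⊗_T T[t_c⁻¹ | c ∈ I(p)]`. -/
abbrev modLoc (M : GrMod k n q) (p : X k n q) : Type u :=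
  (⨁ d : ℤ, LocTensor M p d) ⧸ Submodule.span (oLoc p)ᵐᵒᵖ (locRel M p)

/-- The class of `m ⊗ l`. -/
def modLoc.mk {M : GrMod k n q} {p : X k n q} {d : ℤ} (m : M.comp d) (l : loc p (-d)) :
    modLoc M p :=
  Submodule.Quotient.mk (DirectSum.of (LocTensor M p) d (.mk m l))

theorem modLoc.induction {M : GrMod k n q} {p : X k n q} {P : modLoc M p → Prop} (x : modLoc M p)
    (zero : P 0) (add : ∀ x y, P x → P y → P (x + y))
    (mk : ∀ {d : ℤ} (m : M.comp d) (l : loc p (-d)), P (modLoc.mk m l)) : P x := by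
  obtain ⟨x, rfl⟩ := Submodule.Quotient.mk_surjective _ x
  induction x using DirectSum.induction_on with
  | zero => exact zero
  | add x y hx hy => exact add _ _ hx hy
  | of d x =>
    refine TensorProduct.induction_on
      (motive := fun x => P (Submodule.Quotient.mk (DirectSum.of (LocTensor M p) d x))) x
      ?_ (fun l m => mk m l) (fun x y hx hy => ?_)
    · have : DirectSum.of (LocTensor M p) d (0 : LocTensor M p d) = 0 := map_zero _
      exact this ▸ zero
    · have : DirectSum.of (LocTensor M p) d ((x : LocTensor M p d) + y) =
          DirectSum.of (LocTensor M p) d x + DirectSum.of (LocTensor M p) d y := map_add _ _ _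
      exact this ▸ add _ _ hx hy

/-- The map `M[t_c⁻¹ | c ∈ I(p)]_0 → N[t_c⁻¹ | c ∈ I(p')]_0` induced by `f : M → N` and the
inclusion `I(p) ⊆ I(p')`. -/
def modLocMap {M N : GrMod k n q} (f : M ⟶ N) {p p' : X k n q} (h : p.Generizes p') :
    modLoc M p →+ modLoc N p' :=
  quotMap (locRel M p) (Submodule.span (oLoc p')ᵐᵒᵖ (locRel N p'))
    (DirectSum.map (LocTensor.map f h)) (fun c => op (oLocIncl h (unop c)))
    (fun c x => by
      induction x using DirectSum.induction_on with
      | zero => rw [smul_zero, map_zero, smul_zero]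
      | add x y hx hy => rw [smul_add, map_add, hx, hy, map_add, smul_add]
      | of d x => rw [← DirectSum.of_smul, DirectSum.map_of, DirectSum.map_of,
          LocTensor.map_smul, DirectSum.of_smul])
    (by
      rintro _ ⟨d, f', e, hd, m, t, l, rfl⟩
      refine Submodule.subset_span ⟨d, f', e, hd, f.app d m, t, locIncl h _ l, ?_⟩
      rw [map_sub, DirectSum.map_of, DirectSum.map_of, ← f.app_act, ← locIncl_tMulLoc]
      rfl)

theorem modLocMap_mk {M N : GrMod k n q} (f : M ⟶ N) {p p' : X k n q} (h : p.Generizes p') {d : ℤ}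
    (m : M.comp d) (l : loc p (-d)) :
    modLocMap f h (modLoc.mk m l) = modLoc.mk (f.app d m) (locIncl h _ l) := by
  change Submodule.Quotient.mk (DirectSum.map (LocTensor.map f h)
    (DirectSum.of (LocTensor M p) d (.mk m l))) = _
  rw [DirectSum.map_of]
  rfl

theorem modLoc.smul_mk {M : GrMod k n q} {p : X k n q} (c : (oLoc p)ᵐᵒᵖ) {d : ℤ} (m : M.comp d)
    (l : loc p (-d)) : c • (modLoc.mk m l : modLoc M p) = modLoc.mk m (c • l) := by
  change Submodule.Quotient.mk (c • DirectSum.of (LocTensor M p) d (.mk m l)) = _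
  rw [← DirectSum.of_smul]
  rfl

theorem modLocMap_smul {M N : GrMod k n q} (f : M ⟶ N) {p p' : X k n q} (h : p.Generizes p')
    (c : (oLoc p)ᵐᵒᵖ) (x : modLoc M p) :
    modLocMap f h (c • x) = (op (oLocIncl h (unop c)) : (oLoc p')ᵐᵒᵖ) • modLocMap f h x := by
  induction x using modLoc.induction with
  | zero => rw [smul_zero, map_zero, smul_zero]
  | add x y hx hy => rw [smul_add, map_add, hx, hy, map_add, smul_add]
  | mk m l => rw [modLoc.smul_mk, modLocMap_mk, modLocMap_mk, modLoc.smul_mk, locIncl_smul]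

theorem X.Generizes.refl (p : X k n q) : p.Generizes p := fun _ h => h

/-- The system `p ↦ M[t_c⁻¹ | c ∈ I(p)]_0`. -/
def piDiag (M : GrMod k n q) : Diag k n q ⊤ where
  obj p _ := modLoc M p
  res _ _ h := modLocMap (𝟙 M) h
  res_smul _ _ h c m := modLocMap_smul (𝟙 M) h (op c) m

/-- The morphism of systems induced by a homomorphism of graded modules. -/
def piDiagMap {M N : GrMod k n q} (f : M ⟶ N) : (piDiag M).Hom (piDiag N) where
  app p _ :=
    { toFun := modLocMap f (.refl p)
      map_add' := map_add _
      map_smul' := fun c x => modLocMap_smul f (.refl p) c x }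
  app_res {p p'} _ _ h x := by
    change modLocMap f _ (modLocMap (𝟙 M) h x) = modLocMap (𝟙 N) h (modLocMap f _ x)
    induction x using modLoc.induction with
    | zero => simp only [map_zero]
    | add x y hx hy => simp only [map_add, hx, hy]
    | mk m l =>
      rw [modLocMap_mk, modLocMap_mk, modLocMap_mk, modLocMap_mk,
        locIncl_locIncl h (.refl p') h, locIncl_locIncl (.refl p) h h]
      rfl

variable (k n q) in
/-- The functor `𝛑 : Gr T → MOD O_𝔛` with `(𝛑 M)(U_{I(p)}) = M[t_c⁻¹ | c ∈ I(p)]_0`. -/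
def bpi : GrMod k n q ⥤ OMod k n q where
  obj M := (piDiag M).sheaf
  map f := (piDiagMap f).sheaf
  map_id M := by
    ext V s
    refine Subtype.ext (funext fun p => ?_)
    change modLocMap (𝟙 M) _ (s.1 p) = s.1 p
    generalize s.1 p = x
    induction x using modLoc.induction with
    | zero => simp only [map_zero]
    | add x y hx hy => simp only [map_add, hx, hy]
    | mk m l => rw [modLocMap_mk, locIncl_refl]; rfl
  map_comp f g := by
    ext V s
    refine Subtype.ext (funext fun p => ?_)
    change modLocMap (f ≫ g) _ (s.1 p) = modLocMap g _ (modLocMap f _ (s.1 p))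
    generalize s.1 p = x
    induction x using modLoc.induction with
    | zero => simp only [map_zero]
    | add x y hx hy => simp only [map_add, hx, hy]
    | mk m l => rw [modLocMap_mk, modLocMap_mk, modLocMap_mk,
        locIncl_locIncl _ _ (.refl p.1)]; rfl

end Pi

/-! ### The functor `Γ_*` -/

section Gamma

variable {k : Type u} [Field k] {n : ℕ} {q : kˣ}

theorem X.mem_nbhd (p : X k n q) : p ∈ X.nbhd k n q p := X.Generizes.refl p

theorem X.nbhd_mono {p p' : X k n q} (h : p.Generizes p') : X.nbhd k n q p' ≤ X.nbhd k n q p :=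
  fun _ hc c hp => hc c (h c hp)

/-- The right `O(U_{I(p)})`-module `F(U_{I(p)}) ⊗_{O(U_{I(p)})} T[t_c⁻¹ | c ∈ I(p)]_d`; here
`T[t_c⁻¹ | c ∈ I(p)]_d = O(d)(U_{I(p)})`. -/
abbrev Twist (F : OMod k n q) (d : ℤ) (p : X k n q) : Type u :=
  BalTensor (oLoc p) (O (X.nbhd k n q p)) (F.sec (X.nbhd k n q p)) (loc p d) (oAct ⟨p, p.mem_nbhd⟩ d)

theorem oAct_res {p p' : X k n q} (h : p.Generizes p') (d : ℤ) (f : O (X.nbhd k n q p))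
    (l : loc p d) :
    locIncl h d (oAct ⟨p, p.mem_nbhd⟩ d f l) =
      oAct ⟨p', p'.mem_nbhd⟩ d (O.res (X.nbhd_mono h) f) (locIncl h d l) :=
  oAct_locIncl h p.mem_nbhd (X.nbhd_mono h p'.mem_nbhd) d f l

/-- The restriction maps of `p ↦ F(U_{I(p)}) ⊗ O(d)(U_{I(p)})`. -/
def Twist.res (F : OMod k n q) (d : ℤ) {p p' : X k n q} (h : p.Generizes p') :
    Twist F d p →+ Twist F d p' :=
  BalTensor.map (F.res (X.nbhd_mono h)) (locIncl h d) (O.res (X.nbhd_mono h))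
    (fun f s => F.res_smul (X.nbhd_mono h) f s) (oAct_res h d)

/-- The system `p ↦ F(U_{I(p)}) ⊗ O(d)(U_{I(p)})`; the associated sheaf `(twistDiag F d).sheaf` is the
twist `F(d) = F ⊗ O(d)`, and `(twistDiag F d).sec ⊤ _` is the group of its global sections. -/
def twistDiag (F : OMod k n q) (d : ℤ) : Diag k n q ⊤ where
  obj p _ := Twist F d p
  res _ _ h := Twist.res F d h
  res_smul _ _ h c m := BalTensor.map_smul _ _ _ (fun c => op (oLocIncl h (unop c))) _ _
    (locIncl_smul h d) (op c) m

/-- Right multiplication by `t ∈ T_e` from `T[t_c⁻¹ | c ∈ I(p)]_d` to `T[t_c⁻¹ | c ∈ I(p)]_f`, where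
`d + e = f`. -/
def locMulT (p : X k n q) {d f : ℤ} (e : ℕ) (h : d + e = f) (t : TPiece k n q e) :
    loc p d →+ loc p f where
  toFun l := ⟨l * phi k n q t, by
    have := mul_mem_loc l.2 (phi_mem_loc p t.2)
    rwa [h] at this⟩
  map_zero' := Subtype.ext (zero_mul _)
  map_add' _ _ := Subtype.ext (add_mul _ _ _)

theorem coe_locMulT (p : X k n q) {d f : ℤ} (e : ℕ) (h : d + e = f) (t : TPiece k n q e)
    (l : loc p d) : (locMulT p e h t l : Torus k n q) = l * phi k n q t := rfl

theorem locMulT_oAct {V : Opens (X k n q)} (p : V) {d f : ℤ} (e : ℕ) (h : d + e = f)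
    (t : TPiece k n q e) (s : O V) (l : loc p.1 d) :
    locMulT p.1 e h t (oAct p d s l) = oAct p f s (locMulT p.1 e h t l) := by
  refine Subtype.ext ?_
  unfold oAct
  rw [coe_locMulT, coe_locLeft, coe_locLeft, coe_locMulT, mul_assoc]

theorem locIncl_locMulT {p p' : X k n q} (h : p.Generizes p') {d f : ℤ} (e : ℕ) (hd : d + e = f)
    (t : TPiece k n q e) (l : loc p d) :
    locIncl h f (locMulT p e hd t l) = locMulT p' e hd t (locIncl h d l) := by
  refine Subtype.ext ?_
  rw [coe_locIncl, coe_locMulT, coe_locMulT, coe_locIncl]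

theorem locMulT_one (p : X k n q) {d : ℤ} (h : d + (0 : ℕ) = d) (l : loc p d) :
    locMulT p 0 h ⟨1, one_mem_TPiece k n q⟩ l = l := by
  refine Subtype.ext ?_
  rw [coe_locMulT, map_one, mul_one]

theorem locMulT_add (p : X k n q) {d f : ℤ} (e : ℕ) (h : d + e = f) (t t' : TPiece k n q e)
    (l : loc p d) : locMulT p e h (t + t') l = locMulT p e h t l + locMulT p e h t' l := by
  refine Subtype.ext ?_
  rw [Submodule.coe_add, coe_locMulT, coe_locMulT, coe_locMulT, Submodule.coe_add, map_add, mul_add]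

theorem locMulT_locMulT (p : X k n q) {d f g : ℤ} (e e' : ℕ) (h : d + e = f) (h' : f + e' = g)
    (h'' : d + (e + e' : ℕ) = g) (t : TPiece k n q e) (t' : TPiece k n q e') (l : loc p d) :
    locMulT p e' h' t' (locMulT p e h t l) =
      locMulT p (e + e') h'' ⟨t * t', mul_mem_TPiece t.2 t'.2⟩ l := by
  refine Subtype.ext ?_
  rw [coe_locMulT, coe_locMulT, coe_locMulT, map_mul, mul_assoc]

/-- The map `m ⊗ l ↦ m ⊗ l t`. -/
def Twist.mulT (F : OMod k n q) (p : X k n q) {d f : ℤ} (e : ℕ) (h : d + e = f)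
    (t : TPiece k n q e) : Twist F d p →+ Twist F f p :=
  BalTensor.map (AddMonoidHom.id _) (locMulT p e h t) id (fun _ _ => rfl)
    (locMulT_oAct ⟨p, p.mem_nbhd⟩ e h t)

theorem Twist.mulT_mk (F : OMod k n q) (p : X k n q) {d f : ℤ} (e : ℕ) (h : d + e = f)
    (t : TPiece k n q e) (m : F.sec (X.nbhd k n q p)) (l : loc p d) :
    Twist.mulT F p e h t (BalTensor.mk m l) = BalTensor.mk m (locMulT p e h t l) := rfl

theorem Twist.res_mk (F : OMod k n q) (d : ℤ) {p p' : X k n q} (h : p.Generizes p')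
    (m : F.sec (X.nbhd k n q p)) (l : loc p d) :
    Twist.res F d h (BalTensor.mk m l) =
      BalTensor.mk (F.res (X.nbhd_mono h) m) (locIncl h d l) := rfl

theorem Twist.res_mulT (F : OMod k n q) {p p' : X k n q} (h : p.Generizes p') {d f : ℤ} (e : ℕ)
    (hd : d + e = f) (t : TPiece k n q e) (x : Twist F d p) :
    Twist.res F f h (Twist.mulT F p e hd t x) = Twist.mulT F p' e hd t (Twist.res F d h x) := by
  induction x using BalTensor.induction with
  | zero => simp only [map_zero]
  | add x y hx hy => simp only [map_add, hx, hy]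
  | mk m l => rw [Twist.mulT_mk, Twist.res_mk, Twist.res_mk, Twist.mulT_mk, locIncl_locMulT]

/-- The map `Γ(𝔛, F(d)) → Γ(𝔛, F(f))` of multiplication by `t ∈ T_e`, where `d + e = f`. -/
def secMulT (F : OMod k n q) {d f : ℤ} (e : ℕ) (h : d + e = f) (t : TPiece k n q e) :
    (twistDiag F d).sec ⊤ le_top →+ (twistDiag F f).sec ⊤ le_top where
  toFun s := ⟨fun p => Twist.mulT F p.1 e h t (s.1 p), fun p p' hp =>
    (Twist.res_mulT F hp e h t (s.1 p)).trans (congrArg (Twist.mulT F p'.1 e h t) (s.2 p p' hp))⟩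
  map_zero' := Subtype.ext (funext fun _ => map_zero _)
  map_add' _ _ := Subtype.ext (funext fun _ => map_add _ _ _)

/-- The graded right `T`-module `Γ_*(F) = ⨁_d Γ(𝔛, F(d))`, on which `T` acts by right multiplication
on the factor `O(d)`. -/
def gammaObj (F : OMod k n q) : GrMod k n q where
  comp d := (twistDiag F d).sec ⊤ le_top
  act e h := AddMonoidHom.flip (AddMonoidHom.mk' (secMulT F e h) fun t t' => by
    refine AddMonoidHom.ext fun s => Subtype.ext (funext fun p => ?_)
    change Twist.mulT F p.1 e h (t + t') (s.1 p) =
      Twist.mulT F p.1 e h t (s.1 p) + Twist.mulT F p.1 e h t' (s.1 p)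
    generalize (s.1 p : Twist F _ p.1) = x
    induction x using BalTensor.induction with
    | zero => simp only [map_zero, add_zero]
    | add x y hx hy => simp only [map_add, hx, hy]; abel
    | mk m l =>
      rw [Twist.mulT_mk, Twist.mulT_mk, Twist.mulT_mk, locMulT_add]
      exact congrArg Submodule.Quotient.mk (TensorProduct.add_tmul _ _ _))
  act_one {d} h s := by
    refine Subtype.ext (funext fun p => ?_)
    change Twist.mulT F p.1 0 h _ (s.1 p) = s.1 p
    generalize (s.1 p : Twist F _ p.1) = x
    induction x using BalTensor.induction with
    | zero => simp only [map_zero]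
    | add x y hx hy => simp only [map_add, hx, hy]
    | mk m l => rw [Twist.mulT_mk, locMulT_one]
  act_act e e' h h' h'' s t t' := by
    refine Subtype.ext (funext fun p => ?_)
    change Twist.mulT F p.1 e' h' t' (Twist.mulT F p.1 e h t (s.1 p)) =
      Twist.mulT F p.1 (e + e') h'' _ (s.1 p)
    generalize (s.1 p : Twist F _ p.1) = x
    induction x using BalTensor.induction with
    | zero => simp only [map_zero]
    | add x y hx hy => simp only [map_add, hx, hy]
    | mk m l =>
      rw [Twist.mulT_mk, Twist.mulT_mk, Twist.mulT_mk, locMulT_locMulT]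

/-- The map `m ⊗ l ↦ f(m) ⊗ l` induced by `f : F → G`. -/
def Twist.map {F G : OMod k n q} (f : F ⟶ G) (d : ℤ) (p : X k n q) : Twist F d p →+ Twist G d p :=
  BalTensor.map (OMod.app f _) (AddMonoidHom.id _) id (fun s m => OMod.app_smul f _ s m)
    (fun _ _ => rfl)

theorem Twist.map_mk {F G : OMod k n q} (f : F ⟶ G) (d : ℤ) (p : X k n q)
    (m : F.sec (X.nbhd k n q p)) (l : loc p d) :
    Twist.map f d p (BalTensor.mk m l) = BalTensor.mk (OMod.app f _ m) l := rfl

theorem Twist.res_map {F G : OMod k n q} (f : F ⟶ G) (d : ℤ) {p p' : X k n q} (h : p.Generizes p')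
    (x : Twist F d p) :
    Twist.res G d h (Twist.map f d p x) = Twist.map f d p' (Twist.res F d h x) := by
  induction x using BalTensor.induction with
  | zero => simp only [map_zero]
  | add x y hx hy => simp only [map_add, hx, hy]
  | mk m l => rw [Twist.map_mk, Twist.res_mk, Twist.res_mk, Twist.map_mk, OMod.app_res]

/-- The map `Γ_*(F) → Γ_*(G)` induced by `f : F → G`. -/
def gammaMap {F G : OMod k n q} (f : F ⟶ G) : gammaObj F ⟶ gammaObj G where
  app d :=
    { toFun := fun s => ⟨fun p => Twist.map f d p.1 (s.1 p), fun p p' hp =>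
        (Twist.res_map f d hp (s.1 p)).trans (congrArg (Twist.map f d p'.1) (s.2 p p' hp))⟩
      map_zero' := Subtype.ext (funext fun _ => map_zero _)
      map_add' := fun _ _ => Subtype.ext (funext fun _ => map_add _ _ _) }
  app_act {d f'} e h s t := by
    refine Subtype.ext (funext fun p => ?_)
    change Twist.map f f' p.1 (Twist.mulT F p.1 e h t (s.1 p)) =
      Twist.mulT G p.1 e h t (Twist.map f d p.1 (s.1 p))
    generalize (s.1 p : Twist F _ p.1) = x
    induction x using BalTensor.induction with
    | zero => simp only [map_zero]
    | add x y hx hy => simp only [map_add, hx, hy]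
    | mk m l => rw [Twist.mulT_mk, Twist.map_mk, Twist.map_mk, Twist.mulT_mk]

variable (k n q) in
/-- The functor `Γ_*` from right `O_𝔛`-modules to graded right `T`-modules. -/
def gamma : OMod k n q ⥤ GrMod k n q where
  obj F := gammaObj F
  map f := gammaMap f
  map_id F := by
    refine GrMod.Hom.ext (funext fun d => AddMonoidHom.ext fun s =>
      Subtype.ext (funext fun p => ?_))
    change Twist.map (𝟙 F) d p.1 (s.1 p) = s.1 p
    generalize (s.1 p : Twist F _ p.1) = x
    induction x using BalTensor.induction with
    | zero => simp only [map_zero]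
    | add x y hx hy => simp only [map_add, hx, hy]
    | mk m l => rw [Twist.map_mk]; rfl
  map_comp {F G H} f g := by
    refine GrMod.Hom.ext (funext fun d => AddMonoidHom.ext fun s =>
      Subtype.ext (funext fun p => ?_))
    change Twist.map (f ≫ g) d p.1 (s.1 p) = Twist.map g d p.1 (Twist.map f d p.1 (s.1 p))
    generalize (s.1 p : Twist F _ p.1) = x
    induction x using BalTensor.induction with
    | zero => simp only [map_zero]
    | add x y hx hy => simp only [map_add, hx, hy]
    | mk m l => rw [Twist.map_mk, Twist.map_mk, Twist.map_mk]; rfl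

end Gamma

end QKleinian

end

/-! The ring `T` is toric up to scalars. Under `phi` the generators of `R` become monomials of the
quantum torus. Words with the same exponent are proportional (`word_proportional_of_ev_eq`), so
`phi` is injective and maps `T_e` onto the span of an explicit set of monomials (`phi_injective`,
`phi_TPiece`). Questions on primes, denominators and divisibility in `T` thereby become questions on
a semigroup of exponents.

The monomials outside a face of this semigroup span a graded prime. The face generated by `t_i` and
the `t_j`, `j ∈ J`, gives a point `pt i J` whose smallest neighbourhood is the intersection of the
`U_c` with `c ∈ i :: J` (`pt_generizes`). So each `U_i` with `0 ≤ i ≤ n`, each overlap `U_i ∩ U_j`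
and each triple overlap is the smallest neighbourhood of a point, and the `U_i` cover the space.
They play the part of the standard affine charts of a projective scheme.

Three facts on the `t_i` then make Serre's argument work. The ideal `T_+` is generated by the normal
elements `t_0, …, t_n`, so torsion can be tested with powers of each `t_i` separately
(`exists_eq_sum_tElt_mul`, `GrMod.torsionMod_of_forall`). Powers of `t_i` clear the denominators
that inverting `t_i` introduces (`eventually_mul_tU_pow_mem_loc`). Finally `T[t_i⁻¹]_0` has a basis
of monomials whose exponents form a free commutative monoid of rank two, so it is right noetherian
by Dickson's lemma (`isNoetherianRing_oLoc_pt`).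

Quasicoherence amounts to `IsChart` at the points `pt i []`: sections over smaller neighbourhoods
are obtained from those over `U_i` by base change (`quasicoherent_iff`). For such an `F` the
morphism `eps` from `𝛑 Γ_* F` to `F` is an isomorphism: a section that vanishes on `U_i` is killed
by a power of `t_i`, and a section over `U_i` extends to all charts after multiplication by a power
of `t_i` (`epsAt_injective`, `epsAt_surjective`). The unit `eta` from `M` to `Γ_* 𝛑 M` satisfies a
triangle identity with `eps`, so `𝛑` makes it invertible; and `𝛑` inverts only homomorphisms with
torsion kernel and cokernel (`isoModTors_of_isIso`). This gives the first equivalence.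

For the second one, coherent modules are shown to be the noetherian objects among the quasicoherent
ones, a property that equivalences preserve. Subobjects are detected by their sections over the
finitely many noetherian charts (`chartSub_strictMono`); conversely every submodule of the sections
over one chart comes from a subobject (`chartLiftHom_strictMono`). -/

open CategoryTheory TopologicalSpace MulOpposite
open scoped TensorProduct DirectSum

noncomputable section

namespace QKleinian

/-! ### Monomials and supports in the quantum torus. -/

variable {k : Type u} [Field k] {n : ℕ} {q : kˣ}

/-- The coefficient of the monomial `mono g`. -/
def Torus.coeff (g : Exps n) : Torus k n q →ₗ[k] k :=
  (Finsupp.lapply g : (Exps n →₀ k) →ₗ[k] k)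

theorem Torus.coeff_mono [DecidableEq (Exps n)] (g h : Exps n) :
    Torus.coeff g (Torus.mono k n q h) = if h = g then 1 else 0 :=
  Finsupp.single_apply

theorem Torus.ext_coeff {x y : Torus k n q} (h : ∀ g, Torus.coeff g x = Torus.coeff g y) : x = y :=
  Finsupp.ext h

/-- The exponents of the monomials that occur in `x`. -/
def Torus.supp (x : Torus k n q) : Finset (Exps n) := Finsupp.support x

theorem Torus.mem_supp {x : Torus k n q} {g : Exps n} : g ∈ x.supp ↔ Torus.coeff g x ≠ 0 :=
  Finsupp.mem_support_iff

theorem Torus.sum_supp (x : Torus k n q) :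
    ∑ g ∈ x.supp, Torus.coeff g x • Torus.mono k n q g = x := by
  refine Eq.trans ?_ (Finsupp.sum_single (x : Exps n →₀ k))
  refine Finset.sum_congr rfl fun g _ => ?_
  refine (Finsupp.smul_single (coeff g x) g (1 : k)).trans ?_
  rw [smul_eq_mul, mul_one]; rfl

/-- The elements of the torus that are supported on `A`. -/
def Torus.sp (A : Set (Exps n)) : Submodule k (Torus k n q) where
  carrier := {x | ∀ g, Torus.coeff g x ≠ 0 → g ∈ A}
  zero_mem' := fun g h => absurd (map_zero _) h
  add_mem' := fun {x y} hx hy g h => by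
    by_contra hg
    refine h ?_
    rw [map_add, not_not.1 (mt (hx g) hg), not_not.1 (mt (hy g) hg), add_zero]
  smul_mem' := fun c x hx g h => hx g fun h0 => h (by rw [map_smul, h0, smul_zero])

theorem Torus.mem_sp {A : Set (Exps n)} {x : Torus k n q} :
    x ∈ Torus.sp A ↔ ∀ g, Torus.coeff g x ≠ 0 → g ∈ A := Iff.rfl

theorem Torus.mono_mem_sp {A : Set (Exps n)} {g : Exps n} :
    Torus.mono k n q g ∈ Torus.sp A ↔ g ∈ A := by
  classical
  rw [Torus.mem_sp]
  constructor
  · intro h; exact h g (by rw [Torus.coeff_mono, if_pos rfl]; exact one_ne_zero)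
  · intro h g' hg'
    rw [Torus.coeff_mono] at hg'
    split_ifs at hg' with h'
    · exact h' ▸ h
    · exact absurd rfl hg'

theorem Torus.sp_mono {A B : Set (Exps n)} (h : A ⊆ B) :
    (Torus.sp A : Submodule k (Torus k n q)) ≤ Torus.sp B := fun _ hx g hg => h (hx g hg)

theorem Torus.sp_eq_span (A : Set (Exps n)) :
    (Torus.sp A : Submodule k (Torus k n q)) =
      Submodule.span k {x | ∃ g ∈ A, Torus.mono k n q g = x} := by
  refine le_antisymm (fun x hx => ?_) (Submodule.span_le.2 ?_)
  · rw [← Torus.sum_supp x]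
    exact Submodule.sum_mem _ fun g hg => Submodule.smul_mem _ _
      (Submodule.subset_span ⟨g, hx g (Torus.mem_supp.1 hg), rfl⟩)
  · rintro _ ⟨g, hg, rfl⟩
    exact Torus.mono_mem_sp.2 hg

theorem Torus.sp_induction {A : Set (Exps n)} {P : Torus k n q → Prop} {x : Torus k n q}
    (hx : x ∈ Torus.sp A) (zero : P 0) (add : ∀ x y, P x → P y → P (x + y))
    (smul_mono : ∀ (c : k), ∀ g ∈ A, P (c • Torus.mono k n q g)) : P x := by
  rw [← Torus.sum_supp x]
  refine Finset.sum_induction _ P add zero fun g hg => smul_mono _ g (hx g (Torus.mem_supp.1 hg))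

theorem Torus.mul_mem_sp {A B C : Set (Exps n)} (h : ∀ a ∈ A, ∀ b ∈ B, a + b ∈ C)
    {x y : Torus k n q} (hx : x ∈ Torus.sp A) (hy : y ∈ Torus.sp B) : x * y ∈ Torus.sp C := by
  refine Torus.sp_induction (P := fun x => x * y ∈ Torus.sp C) hx ?_ ?_ ?_
  · rw [zero_mul]; exact Submodule.zero_mem _
  · intro x x' hx hx'
    rw [add_mul]; exact Submodule.add_mem _ hx hx'
  · intro c a ha
    refine Torus.sp_induction (P := fun y => c • Torus.mono k n q a * y ∈ Torus.sp C) hy ?_ ?_ ?_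
    · rw [mul_zero]; exact Submodule.zero_mem _
    · intro x x' hx hx'
      rw [mul_add]; exact Submodule.add_mem _ hx hx'
    · intro d b hb
      rw [smul_mul_smul_comm, Torus.mono_mul]
      exact Submodule.smul_mem _ _ (Submodule.smul_mem _ _ (Torus.mono_mem_sp.2 (h a ha b hb)))

/-- The elements supported on a submonoid form a subalgebra. -/
def Torus.spAlg (A : AddSubmonoid (Exps n)) : Subalgebra k (Torus k n q) where
  toSubsemiring :=
  { carrier := (Torus.sp (A : Set (Exps n)) : Submodule k (Torus k n q))
    zero_mem' := Submodule.zero_mem _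
    add_mem' := fun h h' => Submodule.add_mem _ h h'
    one_mem' := Torus.mono_mem_sp.2 A.zero_mem
    mul_mem' := Torus.mul_mem_sp fun _ ha _ hb => A.add_mem ha hb }
  algebraMap_mem' := fun c => by
    change _ ∈ Torus.sp (A : Set (Exps n))
    rw [Algebra.algebraMap_eq_smul_one]
    exact Submodule.smul_mem _ _ (Torus.mono_mem_sp.2 A.zero_mem)

theorem Torus.mul_eq_sum (x y : Torus k n q) :
    x * y = ∑ g ∈ x.supp, ∑ h ∈ y.supp, (Torus.coeff g x * Torus.coeff h y *
      ((q ^ (g.2.1 * h.1) : kˣ) : k)) • Torus.mono k n q (g + h) := by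
  conv_lhs => rw [← Torus.sum_supp x, ← Torus.sum_supp y, Finset.sum_mul_sum]
  refine Finset.sum_congr rfl fun g _ => Finset.sum_congr rfl fun h _ => ?_
  rw [smul_mul_smul_comm, Torus.mono_mul, smul_smul]

/-- If `g + h` is attained only once, then its coefficient in the product does not vanish. -/
theorem Torus.coeff_mul_of_unique (x y : Torus k n q) (g h : Exps n)
    (hu : ∀ g' h', Torus.coeff g' x ≠ 0 → Torus.coeff h' y ≠ 0 → g' + h' = g + h → g' = g ∧ h' = h) :
    Torus.coeff (g + h) (x * y) =
      Torus.coeff g x * Torus.coeff h y * ((q ^ (g.2.1 * h.1) : kˣ) : k) := by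
  classical
  rw [Torus.mul_eq_sum, map_sum, Finset.sum_eq_single g, map_sum, Finset.sum_eq_single h]
  · rw [map_smul, Torus.coeff_mono, if_pos rfl, smul_eq_mul, mul_one]
  · intro h' hh' hne
    rw [map_smul, Torus.coeff_mono, if_neg (fun e => hne (add_left_cancel e)), smul_zero]
  · intro hh
    rw [Torus.mem_supp, not_not] at hh
    rw [hh]; simp
  · intro g' hg' hne
    rw [map_sum]
    refine Finset.sum_eq_zero fun h' hh' => ?_
    rw [map_smul, Torus.coeff_mono, if_neg, smul_zero]
    exact fun e => hne (hu g' h' (Torus.mem_supp.1 hg') (Torus.mem_supp.1 hh') e).1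
  · intro hh
    rw [Torus.mem_supp, not_not] at hh
    rw [hh]; simp

/-- The monomial `mono g` as a unit. -/
def Torus.monoU (g : Exps n) : (Torus k n q)ˣ where
  val := Torus.mono k n q g
  -- In either order the monomials at `g` and `-g` multiply to `q ^ (-(g.2.1 * g.1))`, which this
  -- scalar cancels.
  inv := ((q ^ (g.2.1 * g.1) : kˣ) : k) • Torus.mono k n q (-g)
  val_inv := by
    rw [mul_smul_comm, Torus.mono_mul, smul_smul, add_neg_cancel, ← Units.val_mul, ← zpow_add]
    simp [Torus.one_def]
  inv_val := by
    rw [smul_mul_assoc, Torus.mono_mul, smul_smul, neg_add_cancel, ← Units.val_mul, ← zpow_add]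
    simp [Torus.one_def]

theorem Torus.deg_eq_sp (d : ℤ) :
    Torus.deg k n q d = Torus.sp {g | g.2.2 = d • chi n} := (Torus.sp_eq_span _).symm

/-- Multiplication by a monomial on the right shifts supports. -/
theorem Torus.mul_mono_mem_sp {A : Set (Exps n)} (g : Exps n) {x : Torus k n q} :
    x * Torus.mono k n q g ∈ Torus.sp A ↔ x ∈ Torus.sp {h | h + g ∈ A} := by
  constructor
  · intro h
    -- The monomial is a unit with inverse supported at `-g`, so the shift can be undone.
    have := Torus.mul_mem_sp (A := A) (B := {-g}) (C := {h | h + g ∈ A})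
      (fun a ha b hb => by rw [Set.mem_singleton_iff.1 hb]; simpa using ha) h
      (y := ((Torus.monoU g)⁻¹ : (Torus k n q)ˣ))
      (Submodule.smul_mem _ _ (Torus.mono_mem_sp.2 (Set.mem_singleton _)))
    rwa [show x * Torus.mono k n q g = x * (Torus.monoU g : (Torus k n q)ˣ) from rfl,
      Units.mul_inv_cancel_right] at this
  · intro h
    exact Torus.mul_mem_sp (B := {g}) (fun a ha b hb => by rw [Set.mem_singleton_iff.1 hb]; exact ha)
      h (Torus.mono_mem_sp.2 (Set.mem_singleton _))

/-! ### Words -/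

instance : DecidableEq (Gen n) := Classical.decEq _

/-- The exponent of a word. -/
def ev (l : List (Gen n)) : Exps n := (l.map (genExp n)).sum

theorem ev_cons (g : Gen n) (l : List (Gen n)) : ev (g :: l) = genExp n g + ev l := by simp [ev]

theorem ev_append (l l' : List (Gen n)) : ev (l ++ l') = ev l + ev l' := by simp [ev]

theorem ev_perm {l l' : List (Gen n)} (h : l.Perm l') : ev l = ev l' := (h.map _).sum_eq

theorem ev_weight (l : List (Gen n)) : (ev l).2.2 = (l.map (wt n)).sum := by
  induction l with
  | nil => rfl
  | cons g l ih => rw [ev_cons]; cases g <;> simp [genExp, ih]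

theorem word_cons (g : Gen n) (l : List (Gen n)) :
    RepRing.word k n q (g :: l) = RepRing.gen k n q g * RepRing.word k n q l := by
  simp [RepRing.word]

theorem word_append (l l' : List (Gen n)) :
    RepRing.word k n q (l ++ l') = RepRing.word k n q l * RepRing.word k n q l' := by
  simp [RepRing.word]

/-- Products of monomials are monomials up to powers of `q`. The scalar is kept as a unit so that
words and monomials can be traded for each other. -/
theorem phi_word (l : List (Gen n)) :
    ∃ c : kˣ, phi k n q (RepRing.word k n q l) = (c : k) • Torus.mono k n q (ev l) := by
  induction l with
  | nil => exact ⟨1, by simp [RepRing.word, Torus.one_def, ev]⟩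
  | cons g l ih =>
    obtain ⟨c, h⟩ := ih
    refine ⟨c * q ^ ((genExp n g).2.1 * (ev l).1), ?_⟩
    rw [word_cons, map_mul, h, phi_gen, mul_smul_comm, Torus.mono_mul, smul_smul, ev_cons,
      Units.val_mul]

/-- Two elements are proportional if they differ by a nonzero scalar. -/
def Proportional {A : Type*} [Ring A] [Algebra k A] (r s : A) : Prop := ∃ c : kˣ, r = (c : k) • s

namespace Proportional

variable {A : Type*} [Ring A] [Algebra k A] {r s t r' s' : A}

theorem refl (r : A) : Proportional (k := k) r r := ⟨1, by simp⟩

theorem symm (h : Proportional (k := k) r s) : Proportional (k := k) s r := by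
  obtain ⟨c, rfl⟩ := h
  exact ⟨c⁻¹, by simp [smul_smul]⟩

theorem trans (h : Proportional (k := k) r s) (h' : Proportional (k := k) s t) :
    Proportional (k := k) r t := by
  obtain ⟨c, rfl⟩ := h
  obtain ⟨d, rfl⟩ := h'
  exact ⟨c * d, by rw [smul_smul, Units.val_mul]⟩

theorem mul (h : Proportional (k := k) r s) (h' : Proportional (k := k) r' s') :
    Proportional (k := k) (r * r') (s * s') := by
  obtain ⟨c, rfl⟩ := h
  obtain ⟨d, rfl⟩ := h'
  exact ⟨c * d, by rw [smul_mul_smul_comm, Units.val_mul]⟩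

end Proportional

theorem gen_rel {x y : FreeAlgebra k (Gen n)} (h : Rel k n q x y) :
    RingQuot.mkAlgHom k (Rel k n q) x = RingQuot.mkAlgHom k (Rel k n q) y :=
  RingQuot.mkAlgHom_rel k h

theorem gen_mul_a_b (i : Fin (n + 1)) : RepRing.gen k n q (.a i) * RepRing.gen k n q (.b i) =
    RepRing.gen k n q (.a 0) * RepRing.gen k n q (.b 0) := by
  have := gen_rel (Rel.ab (k := k) (q := q) i)
  rw [map_mul, map_mul] at this
  exact this.symm

theorem gen_mul_comm (g h : Gen n) : Proportional (k := k)
    (RepRing.gen k n q g * RepRing.gen k n q h) (RepRing.gen k n q h * RepRing.gen k n q g) := by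
  have hba : ∀ i j, Proportional (k := k) (RepRing.gen k n q (.b j) * RepRing.gen k n q (.a i))
      (RepRing.gen k n q (.a i) * RepRing.gen k n q (.b j)) := fun i j => by
    have := gen_rel (Rel.ba (k := k) (q := q) i j)
    rw [map_smul, map_mul, map_mul] at this
    exact ⟨q, this⟩
  cases g with
  | a i =>
    cases h with
    | a j =>
      have := gen_rel (Rel.aa (k := k) (q := q) j i)
      rw [map_mul, map_mul] at this
      exact ⟨1, by rw [Units.val_one, one_smul]; exact this⟩
    | b j => exact (hba i j).symm
  | b i =>
    cases h with
    | a j => exact hba j i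
    | b j =>
      have := gen_rel (Rel.bb (k := k) (q := q) j i)
      rw [map_mul, map_mul] at this
      exact ⟨1, by rw [Units.val_one, one_smul]; exact this⟩

theorem word_perm {l l' : List (Gen n)} (h : l.Perm l') :
    Proportional (k := k) (RepRing.word k n q l) (RepRing.word k n q l') := by
  induction h with
  | nil => exact .refl _
  | cons x _ ih => rw [word_cons, word_cons]; exact (Proportional.refl _).mul ih
  | swap x y l =>
    rw [word_cons, word_cons, word_cons, word_cons, ← mul_assoc, ← mul_assoc]
    exact (gen_mul_comm _ _).mul (.refl _)
  | trans _ _ ih ih' => exact ih.trans ih'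

/-- The exponent of the monomials with `α i` factors `a_i` and `β i` factors `ā_i`. -/
def abExp (α β : Fin (n + 1) → ℕ) : Exps n :=
  (∑ j, (α j : ℤ), ∑ j, (β j : ℤ),
    ∑ j, ((α j : ℤ) - β j) • (Pi.single (j + 1) (1 : ℤ) - Pi.single j 1 : Fin (n + 1) → ℤ))

theorem abExp_add (α β α' β' : Fin (n + 1) → ℕ) :
    abExp (α + α') (β + β') = abExp α β + abExp α' β' := by
  refine Prod.ext ?_ (Prod.ext ?_ ?_)
  · simp [abExp, Finset.sum_add_distrib]
  · simp [abExp, Finset.sum_add_distrib]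
  · simp only [abExp, Prod.snd_add, ← Finset.sum_add_distrib, ← add_smul]
    refine Finset.sum_congr rfl fun j _ => ?_
    congr 1
    simp only [Pi.add_apply, Nat.cast_add]
    ring

theorem abExp_single_left (i : Fin (n + 1)) : abExp (Pi.single i 1) 0 = genExp n (.a i) := by
  refine Prod.ext ?_ (Prod.ext ?_ ?_)
  · simp [abExp, genExp, Pi.single_apply]
  · simp [abExp, genExp]
  · simp [abExp, genExp, wt, Pi.single_apply (i := i)]

theorem abExp_single_right (i : Fin (n + 1)) : abExp 0 (Pi.single i 1) = genExp n (.b i) := by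
  refine Prod.ext ?_ (Prod.ext ?_ ?_)
  · simp [abExp, genExp]
  · simp [abExp, genExp, Pi.single_apply]
  · simp [abExp, genExp, wt, Pi.single_apply (i := i)]

theorem abExp_zero : abExp (0 : Fin (n + 1) → ℕ) 0 = 0 := by simp [abExp]

theorem ev_eq_abExp (l : List (Gen n)) :
    ev l = abExp (fun j => l.count (.a j)) (fun j => l.count (.b j)) := by
  induction l with
  | nil => exact abExp_zero.symm
  | cons g l ih =>
    rw [ev_cons, ih]
    cases g with
    | a i =>
      rw [← abExp_single_left, ← abExp_add]
      exact congrArg₂ abExp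
        (funext fun j => by simp [List.count_cons, Pi.single_apply, eq_comm (a := j)]; ring)
        (funext fun j => by simp)
    | b i =>
      rw [← abExp_single_right, ← abExp_add]
      exact congrArg₂ abExp (funext fun j => by simp)
        (funext fun j => by simp [List.count_cons, Pi.single_apply, eq_comm (a := j)]; ring)

theorem exists_ev_eq_abExp (α β : Fin (n + 1) → ℕ) : ∃ l : List (Gen n), ev l = abExp α β := by
  have key : ∀ (c : ℕ) (g : Gen n), ev (List.replicate c g) = c • genExp n g := fun c g => by
    simp [ev]
  refine ⟨(List.ofFn fun j => List.replicate (α j) (Gen.a j)).flatten ++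
    (List.ofFn fun j => List.replicate (β j) (Gen.b j)).flatten, ?_⟩
  rw [ev_append]
  have h : ∀ f : Fin (n + 1) → List (Gen n), ev (List.ofFn f).flatten = ∑ j, ev (f j) := fun f => by
    simp only [ev, List.map_flatten, List.sum_flatten, List.map_ofFn, List.sum_ofFn, Function.comp_def]
  rw [h, h]
  simp only [key]
  refine Prod.ext ?_ (Prod.ext ?_ ?_)
  · simp [abExp, genExp, Prod.fst_sum]
  · simp [abExp, genExp, Prod.fst_sum, Prod.snd_sum]
  · simp only [abExp, genExp, wt, Prod.snd_sum, Prod.snd_add, Prod.smul_snd, sub_smul,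
      Finset.sum_sub_distrib, natCast_zsmul, smul_sub]
    abel

theorem abExp_weight (α β : Fin (n + 1) → ℕ) (l : Fin (n + 1)) : (abExp α β).2.2 l =
    ((α (l - 1) : ℤ) - β (l - 1)) - ((α l : ℤ) - β l) :=
  sum_shift n (fun j => (α j : ℤ) - β j) l

/-- The weight records the cyclic differences of `α - β`, hence determines `α - β` up to a constant.
The exponents of `u` and `v` fix the sum of `α - β`, and with it the constant. -/
theorem sub_eq_sub_of_abExp_eq {α β α' β' : Fin (n + 1) → ℕ} (h : abExp α β = abExp α' β')
    (j : Fin (n + 1)) : (α j : ℤ) - β j = α' j - β' j := by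
  set δ : Fin (n + 1) → ℤ := fun j => ((α j : ℤ) - β j) - (α' j - β' j) with hδ
  have h1 : ∀ l, δ (l - 1) = δ l := fun l => by
    have := congrArg (fun g : Exps n => g.2.2 l) h
    simp only [abExp_weight] at this
    simp only [hδ]; linarith
  have h2 : ∀ m : ℕ, ∀ hm : m < n + 1, δ ⟨m, hm⟩ = δ 0 := by
    intro m
    induction m with
    | zero => intro _; rfl
    | succ m ih =>
      intro hm
      rw [← ih (by omega), ← h1 ⟨m + 1, hm⟩]
      congr 1
      refine Fin.ext ?_
      rw [Fin.val_sub_one_of_ne_zero (by simp [Fin.ext_iff])]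
      simp
  have h3 : ∑ j, δ j = 0 := by
    have e1 := congrArg (fun g : Exps n => g.1) h
    have e2 := congrArg (fun g : Exps n => g.2.1) h
    simp only [abExp] at e1 e2
    simp only [hδ, Finset.sum_sub_distrib]
    linarith
  -- All values of `δ` equal `δ 0`, so their vanishing sum is `(n + 1) * δ 0`.
  have h4 : δ 0 = 0 := by
    have : ∑ j, δ j = ∑ _j : Fin (n + 1), δ 0 := Finset.sum_congr rfl fun j _ => h2 j j.2
    rw [h3, Finset.sum_const, Finset.card_univ, Fintype.card_fin, nsmul_eq_mul] at this
    rcases mul_eq_zero.1 this.symm with h | h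
    · exact absurd h (by exact_mod_cast Nat.succ_ne_zero n)
    · exact h
  have h5 : δ j = 0 := (h2 j j.2).trans h4
  simp only [hδ] at h5
  linarith

/-- A pair with disjoint supports is the pointwise smallest one with a given difference, so `α' ≤
α`. The totals agree, which forces equality everywhere. -/
theorem eq_of_abExp_eq {α β α' β' : Fin (n + 1) → ℕ} (h : abExp α β = abExp α' β')
    (h0 : ∀ j, α' j = 0 ∨ β' j = 0) : α = α' ∧ β = β' := by
  have hs := sub_eq_sub_of_abExp_eq h
  have hle : ∀ j ∈ Finset.univ, α' j ≤ α j := fun j _ => by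
    have := hs j
    rcases h0 j with h0 | h0 <;> omega
  have e1 : ∑ j, α' j = ∑ j, α j := by
    have := congrArg (fun g : Exps n => g.1) h
    simp only [abExp] at this
    exact_mod_cast this.symm
  have e2 := (Finset.sum_eq_sum_iff_of_le hle).1 e1
  refine ⟨funext fun j => (e2 j (Finset.mem_univ j)).symm, funext fun j => ?_⟩
  have := hs j
  have := e2 j (Finset.mem_univ j)
  omega

theorem perm_of_count_eq {l l' : List (Gen n)} (ha : ∀ j, l.count (.a j) = l'.count (.a j))
    (hb : ∀ j, l.count (.b j) = l'.count (.b j)) : l.Perm l' := by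
  rw [List.perm_iff_count]
  rintro (j | j)
  exacts [ha j, hb j]

theorem exists_perm_pair {l : List (Gen n)} {j : Fin (n + 1)}
    (h : ¬ (l.count (.a j) = 0 ∨ l.count (.b j) = 0)) :
    ∃ l₁, l.Perm (.a j :: .b j :: l₁) := by
  push Not at h
  have ha : Gen.a j ∈ l := List.count_pos_iff.1 (Nat.pos_of_ne_zero h.1)
  have hb : Gen.b j ∈ l.erase (.a j) := by
    rw [List.mem_erase_of_ne (by simp)]
    exact List.count_pos_iff.1 (Nat.pos_of_ne_zero h.2)
  exact ⟨(l.erase (.a j)).erase (.b j), (List.perm_cons_erase ha).trans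
    ((List.perm_cons_erase hb).cons _)⟩

theorem ev_pair (j : Fin (n + 1)) (l : List (Gen n)) :
    ev (.a j :: .b j :: l) = (1, 1, 0) + ev l := by
  rw [ev_cons, ev_cons, ← add_assoc]
  congr 1
  simp [genExp, wt]

/-- Words with the same exponent are proportional. -/
theorem word_proportional_of_ev_eq {l l' : List (Gen n)} (h : ev l = ev l') :
    Proportional (k := k) (RepRing.word k n q l) (RepRing.word k n q l') := by
  induction hm : l.length using Nat.strong_induction_on generalizing l l' with
  | _ m ih =>
    have h' := h
    rw [ev_eq_abExp, ev_eq_abExp] at h'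
    -- If one of the words contains no pair `a_j`, `ā_j` with equal index, its letters are
    -- determined by the exponent. Otherwise both words contain such a pair; all pairs represent the
    -- same element `a_0 ā_0` of `R`, so they cancel and induction on the length applies.
    by_cases h1 : ∀ j, l'.count (.a j) = 0 ∨ l'.count (.b j) = 0
    · obtain ⟨ea, eb⟩ := eq_of_abExp_eq h' h1
      exact word_perm (perm_of_count_eq (congrFun ea) (congrFun eb))
    by_cases h2 : ∀ j, l.count (.a j) = 0 ∨ l.count (.b j) = 0
    · obtain ⟨ea, eb⟩ := eq_of_abExp_eq h'.symm h2
      exact (word_perm (perm_of_count_eq (congrFun ea) (congrFun eb))).symm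
    rw [not_forall] at h1 h2
    obtain ⟨i, hi⟩ := h1
    obtain ⟨j, hj⟩ := h2
    obtain ⟨l₁, hl₁⟩ := exists_perm_pair hj
    obtain ⟨l₂, hl₂⟩ := exists_perm_pair hi
    have hev : ev l₁ = ev l₂ := by
      rw [ev_perm hl₁, ev_perm hl₂, ev_pair, ev_pair] at h
      exact add_left_cancel h
    have hlen : l₁.length < m := by
      rw [← hm, hl₁.length_eq]; simp
    have e : ∀ (i : Fin (n + 1)) (l : List (Gen n)), RepRing.word k n q (.a i :: .b i :: l) =
        RepRing.gen k n q (.a 0) * RepRing.gen k n q (.b 0) * RepRing.word k n q l := fun i l => by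
      rw [word_cons, word_cons, ← mul_assoc, gen_mul_a_b]
    refine (word_perm hl₁).trans (Proportional.trans ?_ (word_perm hl₂).symm)
    rw [e, e]
    exact (Proportional.refl _).mul (ih _ hlen hev rfl)

theorem span_word : Submodule.span k (Set.range (RepRing.word k n q)) = ⊤ := by
  rw [eq_top_iff]
  rintro r -
  obtain ⟨r, rfl⟩ := RingQuot.mkAlgHom_surjective k (Rel k n q) r
  induction r using FreeAlgebra.induction with
  | grade0 c =>
    rw [AlgHom.commutes, Algebra.algebraMap_eq_smul_one]
    exact Submodule.smul_mem _ _ (Submodule.subset_span ⟨[], by simp [RepRing.word]; rfl⟩)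
  | grade1 g => exact Submodule.subset_span ⟨[g], by simp [RepRing.word]; rfl⟩
  | mul a b ha hb =>
    rw [map_mul]
    have := Submodule.mul_mem_mul ha hb
    erw [Submodule.span_mul_span] at this
    refine Submodule.span_mono ?_ this
    rintro _ ⟨_, ⟨l, rfl⟩, _, ⟨l', rfl⟩, rfl⟩
    exact ⟨l ++ l', word_append l l'⟩
  | add a b ha hb => rw [map_add]; exact Submodule.add_mem _ ha hb

/-- The words span `R` and are determined up to a scalar by their exponents. Hence sending a
monomial back to a chosen word with this exponent, suitably rescaled, is a linear left inverse. -/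
theorem phi_injective : Function.Injective (phi k n q) := by
  classical
  choose c hc using phi_word (k := k) (n := n) (q := q)
  -- The default `[]` is for exponents that belong to no word; these never occur in the image of
  -- `phi`.
  let L : Exps n → List (Gen n) := fun g => if h : ∃ l, ev l = g then h.choose else []
  have hL : ∀ l, ev (L (ev l)) = ev l := fun l => by
    have h : ∃ l', ev l' = ev l := ⟨l, rfl⟩
    simp only [L, dif_pos h]
    exact h.choose_spec
  let ψ : Torus k n q →ₗ[k] RepRing k n q :=
    Torus.lift fun g => (((c (L g))⁻¹ : kˣ) : k) • RepRing.word k n q (L g)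
  have hψ : ψ ∘ₗ (phi k n q).toLinearMap = LinearMap.id := by
    refine LinearMap.ext_on_range span_word fun l => ?_
    obtain ⟨d, hd⟩ := word_proportional_of_ev_eq (k := k) (q := q) (hL l)
    have hd' := congrArg (phi k n q) hd
    rw [map_smul, hc, hc, hL, smul_smul] at hd'
    -- The coefficient of the common monomial shows that replacing `l` by the chosen word changes
    -- the scalar by exactly `d`.
    have hd'' := congrArg (Torus.coeff (ev l)) hd'
    rw [map_smul, map_smul, Torus.coeff_mono, if_pos rfl, smul_eq_mul, smul_eq_mul, mul_one,
      mul_one] at hd''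
    rw [LinearMap.comp_apply, AlgHom.toLinearMap_apply, hc, map_smul, Torus.lift_mono, hd,
      smul_smul, smul_smul, mul_right_comm, mul_comm (c l : k), ← hd'', Units.mul_inv, one_smul,
      LinearMap.id_apply]
  exact Function.LeftInverse.injective (g := ψ) fun r => LinearMap.congr_fun hψ r

/-! ### The semigroup of `T` -/

variable (n) in
/-- The exponents of the words in `T_e`. -/
def semiDeg (e : ℤ) : Set (Exps n) := {g | (∃ l, ev l = g) ∧ g.2.2 = e • chi n}

variable (n) in
/-- The exponents of the words in `T`. -/
def semi : AddSubmonoid (Exps n) where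
  carrier := {g | ∃ e : ℕ, g ∈ semiDeg n e}
  zero_mem' := ⟨0, ⟨[], rfl⟩, by simp⟩
  add_mem' := by
    rintro _ _ ⟨e, ⟨l, rfl⟩, h⟩ ⟨e', ⟨l', rfl⟩, h'⟩
    exact ⟨e + e', ⟨l ++ l', ev_append l l'⟩, by
      rw [Prod.snd_add, Prod.snd_add, h, h', Nat.cast_add, add_smul]⟩

theorem word_mem_TPiece {e : ℕ} {l : List (Gen n)} (h : ev l ∈ semiDeg n e) :
    RepRing.word k n q l ∈ TPiece k n q e :=
  Submodule.subset_span ⟨l, by rw [← ev_weight, h.2, natCast_zsmul], rfl⟩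

theorem exists_phi_eq_smul_mono {e : ℕ} {g : Exps n} (h : g ∈ semiDeg n e) (c : k) :
    ∃ l, ev l = g ∧ ∃ d : k, phi k n q (d • RepRing.word k n q l) = c • Torus.mono k n q g := by
  obtain ⟨⟨l, rfl⟩, h⟩ := h
  obtain ⟨d, hd⟩ := phi_word (k := k) (q := q) l
  exact ⟨l, rfl, c * (d⁻¹ : kˣ), by rw [map_smul, hd, smul_smul, mul_assoc, Units.inv_mul, mul_one]⟩

/-- This is the dictionary between homogeneous elements of `T` and sets of exponents. A monomial
with exponent in `semiDeg n e` is hit because the scalar attached to a word is invertible. -/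
theorem phi_TPiece {e : ℕ} {x : Torus k n q} :
    (∃ r ∈ TPiece k n q e, phi k n q r = x) ↔ x ∈ Torus.sp (semiDeg n e) := by
  constructor
  · rintro ⟨r, hr, rfl⟩
    unfold TPiece RepRing.piece at hr
    induction hr using Submodule.span_induction with
    | mem r hr =>
      obtain ⟨l, hl, rfl⟩ := hr
      obtain ⟨c, hc⟩ := phi_word (k := k) (q := q) l
      rw [hc]
      exact Submodule.smul_mem _ _ (Torus.mono_mem_sp.2
        ⟨⟨l, rfl⟩, by rw [ev_weight, hl, natCast_zsmul]⟩)
    | zero => rw [map_zero]; exact Submodule.zero_mem _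
    | add r s _ _ hr hs => rw [map_add]; exact Submodule.add_mem _ hr hs
    | smul c r _ hr => rw [map_smul]; exact Submodule.smul_mem _ _ hr
  · intro hx
    refine Torus.sp_induction (P := fun x => ∃ r ∈ TPiece k n q e, phi k n q r = x) hx
      ⟨0, Submodule.zero_mem _, map_zero _⟩ ?_ ?_
    · rintro _ _ ⟨r, hr, rfl⟩ ⟨s, hs, rfl⟩
      exact ⟨r + s, Submodule.add_mem _ hr hs, map_add _ _ _⟩
    · intro c g hg
      obtain ⟨l, rfl, d, h⟩ := exists_phi_eq_smul_mono (q := q) hg c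
      exact ⟨_, Submodule.smul_mem _ d (word_mem_TPiece hg), h⟩

theorem phi_mem_sp_semi {r : RepRing k n q} (hr : r ∈ T k n q) :
    phi k n q r ∈ Torus.sp (semi n : Set (Exps n)) := by
  change r ∈ (⨆ d, TPiece k n q d) at hr
  induction hr using Submodule.iSup_induction' with
  | mem e r hr => 
    exact Torus.sp_mono (B := (semi n : Set (Exps n))) (fun g hg => ⟨e, hg⟩)
      (phi_TPiece.1 ⟨r, hr, rfl⟩)
  | zero => rw [map_zero]; exact Submodule.zero_mem _
  | add r s _ _ hr hs => rw [map_add]; exact Submodule.add_mem _ hr hs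

theorem isUnit_phi_word (l : List (Gen n)) : IsUnit (phi k n q (RepRing.word k n q l)) := by
  obtain ⟨c, hc⟩ := phi_word (k := k) (q := q) l
  have h : IsUnit (algebraMap k (Torus k n q) c) := c.isUnit.map _
  rw [hc, Algebra.smul_def]
  exact h.mul (Torus.monoU (ev l)).isUnit

/-- The exponent of `t_i`. -/
def tE (i : Fin (n + 1)) : Exps n := ev (tWord n i)

theorem tE_mem_semiDeg (i : Fin (n + 1)) : tE i ∈ semiDeg n 1 :=
  ⟨⟨_, rfl⟩, by rw [tE, ev_weight, wt_tWord, one_smul]⟩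

theorem tE_mem_semi (i : Fin (n + 1)) : tE i ∈ semi n := ⟨1, tE_mem_semiDeg i⟩

variable (k n q) in
/-- The element `t_i` as a unit of the quantum torus. -/
def tU (i : Fin (n + 1)) : (Torus k n q)ˣ := (isUnit_phi_word (tWord n i)).unit

theorem coe_tU (i : Fin (n + 1)) :
    (tU k n q i : Torus k n q) = phi k n q (tElt k n q (.t i)) := rfl

theorem tU_pow (i : Fin (n + 1)) (s : ℕ) :
    ∃ c : kˣ, ((tU k n q i ^ s : (Torus k n q)ˣ) : Torus k n q) =
      (c : k) • Torus.mono k n q (s • tE i) := by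
  obtain ⟨c, hc⟩ := phi_word (k := k) (q := q) (tWord n i)
  induction s with
  | zero => exact ⟨1, by simp [Torus.one_def]⟩
  | succ s ih =>
    obtain ⟨d, hd⟩ := ih
    refine ⟨d * c * q ^ ((s • tE i).2.1 * (tE i).1), ?_⟩
    rw [pow_succ, Units.val_mul, hd]
    change _ * phi k n q (RepRing.word k n q (tWord n i)) = _
    rw [hc, smul_mul_smul_comm, Torus.mono_mul, smul_smul, ← tE, ← succ_nsmul]
    push_cast
    rfl

theorem mul_tU_pow_mem_sp {A : Set (Exps n)} (i : Fin (n + 1)) (s : ℕ) {x : Torus k n q} :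
    x * ((tU k n q i ^ s : (Torus k n q)ˣ) : Torus k n q) ∈ Torus.sp A ↔
      x ∈ Torus.sp {h | h + s • tE i ∈ A} := by
  obtain ⟨c, hc⟩ := tU_pow (k := k) (q := q) i s
  rw [hc, mul_smul_comm, ← Torus.mul_mono_mem_sp]
  exact Submodule.smul_mem_iff _ c.ne_zero

theorem tU_zpow_mem_deg (i : Fin (n + 1)) (d : ℤ) :
    ((tU k n q i ^ d : (Torus k n q)ˣ) : Torus k n q) ∈ Torus.deg k n q d := by
  have h1 : (tE i).2.2 = chi n := by rw [(tE_mem_semiDeg i).2, one_smul]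
  rw [Torus.deg_eq_sp]
  obtain ⟨s, rfl | rfl⟩ := d.eq_nat_or_neg
  · obtain ⟨c, hc⟩ := tU_pow (k := k) (q := q) i s
    rw [zpow_natCast, hc]
    exact Submodule.smul_mem _ _ (Torus.mono_mem_sp.2 (by simp [h1]))
  -- A negative power is located by multiplying it back with `t_i ^ s`, which gives `1`, supported
  -- at the exponent `0`.
  · have : (((tU k n q i ^ (-(s : ℤ)) : (Torus k n q)ˣ) : Torus k n q) *
        ((tU k n q i ^ s : (Torus k n q)ˣ) : Torus k n q)) ∈ Torus.sp ({0} : Set (Exps n)) := by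
      rw [← Units.val_mul, ← zpow_natCast, ← zpow_add, neg_add_cancel, zpow_zero]
      exact Torus.mono_mem_sp.2 rfl
    rw [mul_tU_pow_mem_sp] at this
    refine Torus.sp_mono (fun g hg => ?_) this
    have hg' := congrArg (fun g : Exps n => g.2.2) (show g + s • tE i = 0 from hg)
    simp only [Prod.snd_add, Prod.smul_snd, h1, Prod.snd_zero] at hg'
    rw [Set.mem_ofPred_eq, neg_smul, natCast_zsmul]
    exact eq_neg_of_add_eq_zero_left hg'

theorem tU_zpow_mem_loc {p : X k n q} {i : Fin (n + 1)} (hp : p.Inv (.t i)) (d : ℤ) :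
    ((tU k n q i ^ d : (Torus k n q)ˣ) : Torus k n q) ∈ loc p d := by
  refine ⟨?_, tU_zpow_mem_deg i d⟩
  change _ ∈ tLoc p
  have h1 : ((tU k n q i : (Torus k n q)ˣ) : Torus k n q) ∈ tLoc p :=
    phi_mem_tLoc p (tElt k n q (.t i)).2
  have h2 : (((tU k n q i)⁻¹ : (Torus k n q)ˣ) : Torus k n q) ∈ tLoc p :=
    Algebra.subset_adjoin (Or.inr ⟨.t i, hp, by rw [← coe_tU]; exact Units.mul_inv _,
      by rw [← coe_tU]; exact Units.inv_mul _⟩)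
  obtain ⟨s, rfl | rfl⟩ := d.eq_nat_or_neg
  · rw [zpow_natCast, Units.val_pow_eq_pow_val]
    exact pow_mem h1 s
  · rw [zpow_neg, zpow_natCast, ← inv_pow, Units.val_pow_eq_pow_val]
    exact pow_mem h2 s

/-! ### Normality of words -/

/-- Two words commute up to a scalar. The scalar depends on the word, so in general `r'` is not a
multiple of `r`, but it keeps the degree. -/
theorem exists_mul_word_eq (l : List (Gen n)) {e : ℕ} {r : RepRing k n q}
    (hr : r ∈ TPiece k n q e) :
    ∃ r' ∈ TPiece k n q e, r * RepRing.word k n q l = RepRing.word k n q l * r' := by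
  unfold TPiece RepRing.piece at hr
  induction hr using Submodule.span_induction with
  | mem r hr =>
    obtain ⟨l', hl, rfl⟩ := hr
    obtain ⟨c, hc⟩ := word_perm (k := k) (q := q) (List.perm_append_comm (l₁ := l') (l₂ := l))
    refine ⟨(c : k) • RepRing.word k n q l', Submodule.smul_mem _ _
      (Submodule.subset_span ⟨l', hl, rfl⟩), ?_⟩
    rw [← word_append, hc, word_append, mul_smul_comm]
  | zero => exact ⟨0, Submodule.zero_mem _, by rw [zero_mul, mul_zero]⟩
  | add r s _ _ hr hs =>
    obtain ⟨r', hr', h⟩ := hr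
    obtain ⟨s', hs', h'⟩ := hs
    exact ⟨r' + s', Submodule.add_mem _ hr' hs', by rw [add_mul, mul_add, h, h']⟩
  | smul c r _ hr =>
    obtain ⟨r', hr', h⟩ := hr
    exact ⟨c • r', Submodule.smul_mem _ _ hr', by rw [smul_mul_assoc, mul_smul_comm, h]⟩

theorem exists_word_mul_eq (l : List (Gen n)) {r : RepRing k n q}
    (hr : r ∈ T k n q) :
    ∃ r' ∈ T k n q, RepRing.word k n q l * r = r' * RepRing.word k n q l := by
  change r ∈ (⨆ d, TPiece k n q d) at hr
  induction hr using Submodule.iSup_induction' with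
  | mem e r hr =>
    unfold TPiece RepRing.piece at hr
    induction hr using Submodule.span_induction with
    | mem r hr =>
      obtain ⟨l', hl, rfl⟩ := hr
      obtain ⟨c, hc⟩ := word_perm (k := k) (q := q) (List.perm_append_comm (l₁ := l) (l₂ := l'))
      refine ⟨(c : k) • RepRing.word k n q l', Subalgebra.smul_mem _
        (TPiece_le (Submodule.subset_span ⟨l', hl, rfl⟩)) _, ?_⟩
      rw [← word_append, hc, word_append, smul_mul_assoc]
    | zero => exact ⟨0, Subalgebra.zero_mem _, by rw [zero_mul, mul_zero]⟩
    | add r s _ _ hr hs =>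
      obtain ⟨r', hr', h⟩ := hr
      obtain ⟨s', hs', h'⟩ := hs
      exact ⟨r' + s', Subalgebra.add_mem _ hr' hs', by rw [add_mul, mul_add, h, h']⟩
    | smul c r _ hr =>
      obtain ⟨r', hr', h⟩ := hr
      exact ⟨c • r', Subalgebra.smul_mem _ hr' _, by rw [smul_mul_assoc, mul_smul_comm, h]⟩
  | zero => exact ⟨0, Subalgebra.zero_mem _, by rw [zero_mul, mul_zero]⟩
  | add r s _ _ hr hs =>
    obtain ⟨r', hr', h⟩ := hr
    obtain ⟨s', hs', h'⟩ := hs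
    exact ⟨r' + s', Subalgebra.add_mem _ hr' hs', by rw [add_mul, mul_add, h, h']⟩

theorem word_mem_T {l : List (Gen n)} (h : ev l ∈ semi n) : RepRing.word k n q l ∈ T k n q := by
  obtain ⟨e, he⟩ := h
  exact TPiece_le (word_mem_TPiece he)

/-! ### Primes from faces -/

/-- The elements of the semigroup that divide a multiple of `g₀`. -/
def face (g₀ : Exps n) : Set (Exps n) := {g | g ∈ semi n ∧ ∃ h ∈ semi n, ∃ a : ℕ, g + h = a • g₀}

/-- A divisor of a divisor of `a • g₀` divides `a • g₀`. This face property makes the span of the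
remaining monomials an ideal and is half of its primeness. -/
theorem mem_face_of_add_mem {g₀ g h : Exps n} (hg : g ∈ semi n) (hh : h ∈ semi n)
    (hgh : g + h ∈ face g₀) : g ∈ face g₀ ∧ h ∈ face g₀ := by
  obtain ⟨-, f, hf, a, ha⟩ := hgh
  exact ⟨⟨hg, h + f, (semi n).add_mem hh hf, a, by rw [← add_assoc, ha]⟩,
    ⟨hh, g + f, (semi n).add_mem hg hf, a, by rw [← ha]; abel⟩⟩

theorem add_mem_face {g₀ g h : Exps n} (hg : g ∈ face g₀) (hh : h ∈ face g₀) :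
    g + h ∈ face g₀ := by
  obtain ⟨hg, g', hg', a, ha⟩ := hg
  obtain ⟨hh, h', hh', b, hb⟩ := hh
  exact ⟨(semi n).add_mem hg hh, g' + h', (semi n).add_mem hg' hh', a + b, by
    rw [add_smul, ← ha, ← hb]; abel⟩

variable (k q) in
/-- The ideal spanned by the monomials outside of a face. -/
def faceIdeal (g₀ : Exps n) : TwoSidedIdeal (T k n q) :=
  .mk' {r | phi k n q r ∈ Torus.sp ((semi n : Set (Exps n)) \ face g₀)}
    (by
      change phi k n q 0 ∈ Torus.sp ((semi n : Set (Exps n)) \ face g₀)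
      rw [map_zero]; exact Submodule.zero_mem _)
    (fun {x y} hx hy => by
      change phi k n q (x + y : RepRing k n q) ∈ Torus.sp ((semi n : Set (Exps n)) \ face g₀)
      rw [map_add]; exact Submodule.add_mem _ hx hy)
    (fun {x} hx => by
      change phi k n q (-x : RepRing k n q) ∈ Torus.sp ((semi n : Set (Exps n)) \ face g₀)
      rw [map_neg]; exact Submodule.neg_mem _ hx)
    (fun {x y} hy => by
      change phi k n q (x * y : RepRing k n q) ∈ Torus.sp ((semi n : Set (Exps n)) \ face g₀)
      rw [map_mul]
      exact Torus.mul_mem_sp (A := (semi n : Set (Exps n))) (B := (semi n : Set (Exps n)) \ face g₀)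
        (C := (semi n : Set (Exps n)) \ face g₀) (fun a ha b hb => ⟨(semi n).add_mem ha hb.1,
        fun h => hb.2 (mem_face_of_add_mem ha hb.1 h).2⟩) (phi_mem_sp_semi x.2) hy)
    (fun {x y} hx => by
      change phi k n q (x * y : RepRing k n q) ∈ Torus.sp ((semi n : Set (Exps n)) \ face g₀)
      rw [map_mul]
      exact Torus.mul_mem_sp (A := (semi n : Set (Exps n)) \ face g₀) (B := (semi n : Set (Exps n)))
        (C := (semi n : Set (Exps n)) \ face g₀) (fun a ha b hb => ⟨(semi n).add_mem ha.1 hb,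
        fun h => ha.2 (mem_face_of_add_mem ha.1 hb h).1⟩) hx (phi_mem_sp_semi y.2))

theorem mem_faceIdeal {g₀ : Exps n} {r : T k n q} : r ∈ faceIdeal k q g₀ ↔
    phi k n q r ∈ Torus.sp ((semi n : Set (Exps n)) \ face g₀) :=
  TwoSidedIdeal.mem_mk' _ _ _ _ _ _ _

theorem word_mem_faceIdeal {g₀ : Exps n} {l : List (Gen n)} (h : ev l ∈ semi n) :
    (⟨RepRing.word k n q l, word_mem_T h⟩ : T k n q) ∈ faceIdeal k q g₀ ↔ ev l ∉ face g₀ := by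
  rw [mem_faceIdeal]
  obtain ⟨c, hc⟩ := phi_word (k := k) (q := q) l
  rw [hc, Submodule.smul_mem_iff _ c.ne_zero, Torus.mono_mem_sp]
  exact ⟨fun h => h.2, fun h' => ⟨h, h'⟩⟩

/-- The group of exponents has unique sums. If `a` and `b` lie outside the ideal, the parts of their
supports in the face are nonempty, and a uniquely attained sum of these exponents survives in `a *
b`. -/
theorem isPrimeIdeal_faceIdeal (g₀ : Exps n) : IsPrimeIdeal (faceIdeal k q g₀) := by
  classical
  refine ⟨fun h => ?_, fun a b hab => ?_⟩
  · have h1 : (⟨RepRing.word k n q [], word_mem_T (semi n).zero_mem⟩ : T k n q) ∈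
        faceIdeal k q g₀ := by rw [h]; trivial
    rw [word_mem_faceIdeal (semi n).zero_mem] at h1
    exact h1 ⟨(semi n).zero_mem, 0, (semi n).zero_mem, 0, by simp [ev]⟩
  · by_contra! hne
    have key : ∀ r : T k n q, r ∉ faceIdeal k q g₀ →
        ((phi k n q r).supp.filter (· ∈ face g₀)).Nonempty := fun r hr => by
      by_contra! h0
      refine hr (mem_faceIdeal.2 fun g hg => ⟨phi_mem_sp_semi r.2 g hg, fun hf => ?_⟩)
      have : g ∈ (phi k n q r).supp.filter (· ∈ face g₀) :=
        Finset.mem_filter.2 ⟨Torus.mem_supp.2 hg, hf⟩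
      rw [h0] at this
      exact absurd this (Finset.notMem_empty _)
    obtain ⟨g, hg, h, hh, hu⟩ := UniqueSums.uniqueAdd_of_nonempty (key a hne.1) (key b hne.2)
    rw [Finset.mem_filter, Torus.mem_supp] at hg hh
    -- Exponents outside the face cannot interfere: a decomposition of an element of the face has
    -- both summands in the face.
    have hc := Torus.coeff_mul_of_unique (phi k n q a) (phi k n q b) g h fun g' h' hg' hh' e => by
      obtain ⟨f1, f2⟩ := mem_face_of_add_mem (g₀ := g₀) (phi_mem_sp_semi a.2 g' hg')
        (phi_mem_sp_semi b.2 h' hh') (e ▸ add_mem_face hg.2 hh.2)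
      exact hu (Finset.mem_filter.2 ⟨Torus.mem_supp.2 hg', f1⟩)
        (Finset.mem_filter.2 ⟨Torus.mem_supp.2 hh', f2⟩) e
    -- The case `r = 1` already leads to a contradiction, so the ideal is even completely prime.
    have h1 := mem_faceIdeal.1 (hab 1)
    rw [mul_one] at h1
    change phi k n q (a * b : RepRing k n q) ∈ _ at h1
    rw [map_mul] at h1
    refine (h1 (g + h) ?_).2 (add_mem_face hg.2 hh.2)
    rw [hc]
    exact mul_ne_zero (mul_ne_zero hg.1 hh.1) (Units.ne_zero _)

/-- The ideal is spanned by words, and a word is homogeneous for every grading prescribed on the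
generators. -/
theorem isToricGraded_faceIdeal (g₀ : Exps n) : IsToricGraded k n q (faceIdeal k q g₀) := by
  intro r hr
  have key : ∀ x ∈ Torus.sp ((semi n : Set (Exps n)) \ face g₀),
      ∃ s ∈ AddSubgroup.closure {b : T k n q | b ∈ faceIdeal k q g₀ ∧
        ∃ d, (b : RepRing k n q) ∈ RepRing.piece k n q (toricDeg n) d}, phi k n q s = x := by
    intro x hx
    refine Torus.sp_induction (P := fun x => ∃ s ∈ AddSubgroup.closure {b : T k n q |
      b ∈ faceIdeal k q g₀ ∧ ∃ d, (b : RepRing k n q) ∈ RepRing.piece k n q (toricDeg n) d},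
        phi k n q s = x) hx ⟨0, AddSubgroup.zero_mem _, map_zero _⟩ ?_ ?_
    · rintro _ _ ⟨r, hr, rfl⟩ ⟨s, hs, rfl⟩
      exact ⟨r + s, AddSubgroup.add_mem _ hr hs, map_add _ _ _⟩
    · rintro c g ⟨⟨e, hg⟩, hf⟩
      obtain ⟨l, rfl, d, h⟩ := exists_phi_eq_smul_mono (q := q) hg c
      refine ⟨⟨d • RepRing.word k n q l, Subalgebra.smul_mem _ (word_mem_T ⟨e, hg⟩) _⟩,
        AddSubgroup.subset_closure ⟨mem_faceIdeal.2 ?_, (l.map (toricDeg n)).sum,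
          Submodule.smul_mem _ _ (Submodule.subset_span ⟨l, rfl, rfl⟩)⟩, h⟩
      change phi k n q (d • RepRing.word k n q l) ∈ _
      rw [h]
      exact Submodule.smul_mem _ _ (Torus.mono_mem_sp.2 ⟨⟨e, hg⟩, hf⟩)
  obtain ⟨s, hs, h⟩ := key _ (mem_faceIdeal.1 hr)
  rwa [← Subtype.ext (phi_injective h)]

/-- The sum of the exponents of `t_j`, for `j` in the list `i :: J`. -/
def listExp (i : Fin (n + 1)) (J : List (Fin (n + 1))) : Exps n := tE i + (J.map tE).sum

theorem listExp_eq (i : Fin (n + 1)) (J : List (Fin (n + 1))) :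
    listExp i J = ev ((i :: J).flatMap (tWord n)) := by
  rw [listExp, List.flatMap_cons, ev_append]
  congr 1
  induction J with
  | nil => rfl
  | cons j J ih => rw [List.map_cons, List.sum_cons, ih, List.flatMap_cons, ev_append]; rfl

theorem sum_map_tE_mem_semi (J : List (Fin (n + 1))) : (J.map tE).sum ∈ semi n :=
  AddSubmonoid.list_sum_mem _ fun g hg => by
    obtain ⟨j, -, rfl⟩ := List.mem_map.1 hg
    exact tE_mem_semi j

theorem tE_mem_face {i : Fin (n + 1)} {J : List (Fin (n + 1))} {c : Fin (n + 1)}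
    (hc : c ∈ i :: J) : tE c ∈ face (listExp i J) := by
  refine ⟨tE_mem_semi c, (((i :: J).erase c).map tE).sum, sum_map_tE_mem_semi _, 1, ?_⟩
  have h := ((List.perm_cons_erase hc).map tE).sum_eq
  rw [List.map_cons, List.sum_cons, List.map_cons, List.sum_cons] at h
  rw [one_smul, ← h, listExp]

variable (k q) in
/-- The generic point of the closed set where no `t_c` with `c ∈ i :: J` vanishes: the graded prime
spanned by the monomials that divide no power of the product of these `t_c`. -/
def pt (i : Fin (n + 1)) (J : List (Fin (n + 1))) : X k n q :=
  ⟨faceIdeal k q (listExp i J), isPrimeIdeal_faceIdeal _, isToricGraded_faceIdeal _, fun h =>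
    (word_mem_faceIdeal (tE_mem_semi i)).1 (h i) (tE_mem_face List.mem_cons_self)⟩

theorem ev_idx_mem_semi (c : Idx n) : ev (c.word n) ∈ semi n := by
  cases c with
  | x => exact ⟨0, ⟨_, rfl⟩, by rw [ev_weight]; simpa [Idx.word] using wt_xWord n⟩
  | t i => exact tE_mem_semi i
  | y => exact ⟨0, ⟨_, rfl⟩, by rw [ev_weight]; simpa [Idx.word] using wt_yWord n⟩

theorem pt_inv_iff {i : Fin (n + 1)} {J : List (Fin (n + 1))} {c : Idx n} :
    (pt k q i J).Inv c ↔ ev (c.word n) ∈ face (listExp i J) :=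
  (not_congr (word_mem_faceIdeal (ev_idx_mem_semi c))).trans not_not

theorem pt_inv {i : Fin (n + 1)} {J : List (Fin (n + 1))} {c : Fin (n + 1)} (hc : c ∈ i :: J) :
    (pt k q i J).Inv (.t c) :=
  pt_inv_iff.2 (tE_mem_face hc)

/-- Primeness concerns all products with an arbitrary element in the middle. Words are normal in
`T`, so this element can be moved to the left, and membership of the concatenated word is enough to
apply primeness. -/
theorem word_append_notMem (p : X k n q) {l l' : List (Gen n)} (h : ev l ∈ semi n)
    (h' : ev l' ∈ semi n) (hll : ev (l ++ l') ∈ semi n)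
    (hl : (⟨RepRing.word k n q l, word_mem_T h⟩ : T k n q) ∉ p.1)
    (hl' : (⟨RepRing.word k n q l', word_mem_T h'⟩ : T k n q) ∉ p.1) :
    (⟨RepRing.word k n q (l ++ l'), word_mem_T hll⟩ : T k n q) ∉ p.1 := by
  intro hmem
  refine (p.2.1.2 ⟨RepRing.word k n q l, word_mem_T h⟩ ⟨RepRing.word k n q l', word_mem_T h'⟩
    fun r => ?_).elim hl hl'
  obtain ⟨r', hr', e⟩ := exists_word_mul_eq l r.2
  have := p.1.mul_mem_left ⟨r', hr'⟩ _ hmem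
  convert this using 1
  refine Subtype.ext ?_
  change RepRing.word k n q l * r * RepRing.word k n q l' = r' * RepRing.word k n q (l ++ l')
  rw [e, word_append, mul_assoc]

theorem ev_flatten_mem_semi {L : List (List (Gen n))} (hL : ∀ l ∈ L, ev l ∈ semi n) :
    ev L.flatten ∈ semi n := by
  induction L with
  | nil => exact (semi n).zero_mem
  | cons l L ih =>
    rw [List.flatten_cons, ev_append]
    exact (semi n).add_mem (hL l List.mem_cons_self) (ih fun l hl => hL l (List.mem_cons_of_mem _ hl))

theorem word_flatten_notMem (p : X k n q) {L : List (List (Gen n))}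
    (hL : ∀ l ∈ L, ev l ∈ semi n)
    (hL' : ∀ l (hl : l ∈ L), (⟨RepRing.word k n q l, word_mem_T (hL l hl)⟩ : T k n q) ∉ p.1) :
    (⟨RepRing.word k n q L.flatten, word_mem_T (ev_flatten_mem_semi hL)⟩ : T k n q) ∉ p.1 := by
  induction L with
  | nil =>
    intro h
    refine p.2.1.1 (eq_top_iff.2 fun r _ => ?_)
    have := p.1.mul_mem_left r _ h
    convert this using 1
    refine Subtype.ext ?_
    change (r : RepRing k n q) = r * RepRing.word k n q []
    simp [RepRing.word]
  | cons l L ih =>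
    have hL₁ : ∀ l ∈ L, ev l ∈ semi n := fun l hl => hL l (List.mem_cons_of_mem _ hl)
    exact word_append_notMem p (hL l List.mem_cons_self) (ev_flatten_mem_semi hL₁)
      (ev_flatten_mem_semi hL) (hL' l List.mem_cons_self)
      (ih hL₁ fun l hl => hL' l (List.mem_cons_of_mem _ hl))

/-- `pt i J` is the smallest point where no `t_c` with `c ∈ i :: J` vanishes. -/
theorem pt_generizes {i : Fin (n + 1)} {J : List (Fin (n + 1))} {p : X k n q}
    (hp : ∀ c ∈ i :: J, p.Inv (.t c)) : (pt k q i J).Generizes p := by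
  intro c hc hmem
  obtain ⟨hcs, h, hh, a, ha⟩ := pt_inv_iff.1 hc
  obtain ⟨e, ⟨l, rfl⟩, he⟩ := id hh
  -- This list multiplies to the `a`-th power of the product of the `t_c`, `c ∈ i :: J`. It has the
  -- same exponent as the given `t_c` followed by `l`, so it would lie in `p` if `t_c` did, although
  -- none of its factors does.
  let L : List (List (Gen n)) := (List.replicate a ((i :: J).map (tWord n))).flatten
  have hLmem : ∀ l ∈ L, ∃ c ∈ i :: J, tWord n c = l := fun l hl => by
    simp only [L, List.mem_flatten, List.mem_replicate] at hl
    obtain ⟨_, ⟨-, rfl⟩, hl⟩ := hl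
    exact List.mem_map.1 hl
  have hL : ∀ l ∈ L, ev l ∈ semi n := fun l hl => by
    obtain ⟨c, -, rfl⟩ := hLmem l hl
    exact tE_mem_semi c
  have hev : ev L.flatten = ev (c.word n ++ l) := by
    rw [ev_append, ha]
    have : ∀ a : ℕ, ev (List.replicate a ((i :: J).map (tWord n))).flatten.flatten =
        a • listExp i J := fun a => by
      induction a with
      | zero => rw [zero_smul]; rfl
      | succ a ih =>
        rw [List.replicate_succ, List.flatten_cons, List.flatten_append, ev_append, ih, succ_nsmul',
          listExp_eq]
        rfl
    exact this a
  obtain ⟨u, hu⟩ := word_proportional_of_ev_eq (k := k) (q := q) hev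
  refine word_flatten_notMem p hL (fun l hl => ?_) ?_
  · obtain ⟨c, hc, rfl⟩ := hLmem l hl
    exact hp c hc
  · have := p.1.mul_mem_right _ ((u : k) • ⟨RepRing.word k n q l, word_mem_T hh⟩ : T k n q) hmem
    convert this using 1
    refine Subtype.ext ?_
    change RepRing.word k n q L.flatten = RepRing.word k n q (c.word n) * ((u : k) • RepRing.word k n q l)
    rw [hu, word_append, mul_smul_comm]

/-! ### Localisations at the points `pt i J` -/

/-- If `t_c` is inverted at `pt i J`, then `t_c` divides a power of the product of the `t_j`, `j ∈ i
:: J`, and that power clears the inverse of `t_c`. Together with `mem_tLoc_pt` this describes the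
localisation by its exponents. -/
theorem tLoc_pt_le (i : Fin (n + 1)) (J : List (Fin (n + 1))) {x : Torus k n q}
    (hx : x ∈ tLoc (pt k q i J)) :
    x ∈ Torus.sp {g : Exps n | ∃ s : ℕ, g + s • listExp i J ∈ semi n} := by
  let S : AddSubmonoid (Exps n) :=
    { carrier := {g : Exps n | ∃ s : ℕ, g + s • listExp i J ∈ semi n}
      zero_mem' := ⟨0, by rw [zero_smul, add_zero]; exact (semi n).zero_mem⟩
      add_mem' := by
        rintro g h ⟨s, hs⟩ ⟨s', hs'⟩
        refine ⟨s + s', ?_⟩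
        rw [add_smul, add_add_add_comm]
        exact (semi n).add_mem hs hs' }
  suffices h : tLoc (pt k q i J) ≤ Torus.spAlg S from h hx
  refine Algebra.adjoin_le ?_
  rintro _ (⟨r, -, rfl⟩ | ⟨c, hc, h1, h2⟩)
  · exact Torus.sp_mono (A := (semi n : Set (Exps n))) (B := (S : Set (Exps n)))
      (fun g hg => show ∃ s : ℕ, g + s • listExp i J ∈ semi n from
        ⟨0, by rw [zero_smul, add_zero]; exact hg⟩) (phi_mem_sp_semi r.2)
  · rename_i y
    obtain ⟨hcs, h, hh, a, ha⟩ := pt_inv_iff.1 hc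
    obtain ⟨u, hu⟩ := phi_word (k := k) (q := q) (c.word n)
    change y * phi k n q (RepRing.word k n q (c.word n)) = 1 at h2
    rw [hu, mul_smul_comm] at h2
    have h3 : y * Torus.mono k n q (ev (c.word n)) ∈ Torus.sp ({0} : Set (Exps n)) := by
      rw [← Submodule.smul_mem_iff _ u.ne_zero, h2]
      exact Torus.mono_mem_sp.2 rfl
    rw [Torus.mul_mono_mem_sp] at h3
    refine Torus.sp_mono (B := (S : Set (Exps n)))
      (fun g hg => show ∃ s : ℕ, g + s • listExp i J ∈ semi n from ⟨a, ?_⟩) h3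
    have hg' : g + ev (c.word n) = 0 := hg
    rw [← ha, ← add_assoc, hg', zero_add]
    exact hh

theorem mem_tLoc_pt (i : Fin (n + 1)) (J : List (Fin (n + 1))) {x : Torus k n q}
    (hx : x ∈ Torus.sp {g : Exps n | ∃ s : ℕ, g + s • listExp i J ∈ semi n}) :
    x ∈ tLoc (pt k q i J) := by
  let B : AddSubmonoid (Exps n) :=
    { carrier := {g | Torus.mono k n q g ∈ tLoc (pt k q i J)}
      zero_mem' := (tLoc (pt k q i J)).one_mem
      add_mem' := by
        intro g h hg hh
        have := (tLoc (pt k q i J)).mul_mem hg hh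
        rw [Torus.mono_mul] at this
        exact (Submodule.smul_mem_iff (Subalgebra.toSubmodule (tLoc (pt k q i J)))
          (Units.ne_zero _)).1 this }
  have hsemi : semi n ≤ B := by
    rintro g ⟨e, hg⟩
    obtain ⟨r, hr, h⟩ := phi_TPiece.2 (Torus.mono_mem_sp (k := k) (q := q).2 hg)
    change Torus.mono k n q g ∈ tLoc (pt k q i J)
    rw [← h]
    exact phi_mem_tLoc _ (TPiece_le hr)
  have ht : ∀ c ∈ i :: J, -tE c ∈ B := fun c hc => by
    have h1 := (tU_zpow_mem_loc (pt_inv (k := k) (q := q) hc) (-1)).1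
    have h2 : ((tU k n q c ^ (-1 : ℤ) : (Torus k n q)ˣ) : Torus k n q) ∈
        Torus.sp ({-tE c} : Set (Exps n)) := by
      have : ((tU k n q c ^ (-1 : ℤ) : (Torus k n q)ˣ) : Torus k n q) *
          ((tU k n q c ^ 1 : (Torus k n q)ˣ) : Torus k n q) ∈ Torus.sp ({0} : Set (Exps n)) := by
        rw [pow_one, zpow_neg_one, Units.inv_mul]
        exact Torus.mono_mem_sp.2 rfl
      rw [mul_tU_pow_mem_sp, one_smul] at this
      exact Torus.sp_mono (fun g hg => eq_neg_of_add_eq_zero_left (Set.mem_singleton_iff.1 hg)) this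
    set y := ((tU k n q c ^ (-1 : ℤ) : (Torus k n q)ˣ) : Torus k n q) with hy
    -- The inverse of `t_c` is supported at a single exponent, so it is a nonzero multiple of the
    -- monomial that is wanted.
    have hy0 : y = Torus.coeff (-tE c) y • Torus.mono k n q (-tE c) := by
      classical
      refine Torus.ext_coeff fun g => ?_
      rw [map_smul, Torus.coeff_mono]
      by_cases hg : -tE c = g
      · rw [if_pos hg, hg, smul_eq_mul, mul_one]
      · rw [if_neg hg, smul_zero]
        exact not_not.1 fun h => hg (Set.mem_singleton_iff.1 (h2 g h)).symm
    have hc0 : Torus.coeff (-tE c) y ≠ 0 := fun h => by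
      have h0 : y = 0 := by rw [hy0, h, zero_smul]
      have h1 : (1 : Torus k n q) = 0 := by
        rw [← Units.mul_inv (tU k n q c ^ (-1 : ℤ)), ← hy, h0, zero_mul]
      have h2 := congrArg (Torus.coeff 0) h1
      classical
      rw [Torus.one_def, Torus.coeff_mono, if_pos rfl, map_zero] at h2
      exact one_ne_zero h2
    rw [hy0] at h1
    exact (Submodule.smul_mem_iff (Subalgebra.toSubmodule (tLoc (pt k q i J))) hc0).1 h1
  have hl : -listExp i J ∈ B := by
    have h1 : ∀ J' : List (Fin (n + 1)), (∀ c ∈ J', c ∈ i :: J) → -(J'.map tE).sum ∈ B := by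
      intro J' hJ'
      induction J' with
      | nil => rw [List.map_nil, List.sum_nil, neg_zero]; exact B.zero_mem
      | cons j J' ih =>
        rw [List.map_cons, List.sum_cons, neg_add]
        exact B.add_mem (ht j (hJ' j List.mem_cons_self))
          (ih fun c hc => hJ' c (List.mem_cons_of_mem _ hc))
    have := h1 (i :: J) fun _ h => h
    rwa [List.map_cons, List.sum_cons] at this
  refine Torus.sp_induction (P := fun x => x ∈ tLoc (pt k q i J)) hx (Subalgebra.zero_mem _)
    (fun _ _ => Subalgebra.add_mem _) ?_
  rintro c g ⟨s, hs⟩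
  refine Subalgebra.smul_mem _ (show g ∈ B from ?_) c
  have : g = (g + s • listExp i J) + s • -listExp i J := by rw [smul_neg]; abel
  rw [this]
  exact B.add_mem (hsemi hs) (B.nsmul_mem hl s)

theorem mul_tU_pow_mem_deg {i : Fin (n + 1)} {d : ℤ} {x : Torus k n q}
    (hx : x ∈ Torus.deg k n q d) (s : ℕ) :
    x * ((tU k n q i ^ s : (Torus k n q)ˣ) : Torus k n q) ∈ Torus.deg k n q (d + s) := by
  have := Torus.mul_mem_deg hx (tU_zpow_mem_deg (k := k) (q := q) i s)
  rwa [zpow_natCast] at this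

/-- Elements of the localisation at `i :: J` are cleared by powers of `t_i`. -/
theorem eventually_mul_tU_pow_mem_loc {j i : Fin (n + 1)} {J : List (Fin (n + 1))} {d : ℤ}
    {x : Torus k n q} (hx : x ∈ loc (pt k q j (i :: J)) d) :
    ∀ᶠ s : ℕ in Filter.atTop,
      x * ((tU k n q i ^ s : (Torus k n q)ˣ) : Torus k n q) ∈ loc (pt k q j J) (d + s) := by
  have h : ∀ᶠ s : ℕ in Filter.atTop,
      x * ((tU k n q i ^ s : (Torus k n q)ˣ) : Torus k n q) ∈ tLoc (pt k q j J) := by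
    refine Torus.sp_induction (P := fun x => ∀ᶠ s : ℕ in Filter.atTop,
      x * ((tU k n q i ^ s : (Torus k n q)ˣ) : Torus k n q) ∈ tLoc (pt k q j J))
      (tLoc_pt_le _ _ hx.1) ?_ ?_ ?_
    · exact Filter.Eventually.of_forall fun s => by rw [zero_mul]; exact Subalgebra.zero_mem _
    · intro x y hx hy
      filter_upwards [hx, hy] with s hx hy
      rw [add_mul]
      exact Subalgebra.add_mem _ hx hy
    · rintro c g ⟨s₀, hs₀⟩
      filter_upwards [Filter.eventually_ge_atTop s₀] with s hs
      refine mem_tLoc_pt _ _ ((mul_tU_pow_mem_sp _ _).2 (Submodule.smul_mem _ _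
        (Torus.mono_mem_sp.2 ⟨s₀, ?_⟩)))
      obtain ⟨a, rfl⟩ := Nat.exists_eq_add_of_le hs
      -- The power of `t_i` supplies the `s₀` copies of `t_i` by which the denominators for `i :: J`
      -- exceed those for `J`.
      have e : g + (s₀ + a) • tE i + s₀ • listExp j J = (g + s₀ • listExp j (i :: J)) + a • tE i := by
        simp only [listExp, List.map_cons, List.sum_cons, smul_add, add_smul]
        abel
      rw [e]
      exact (semi n).add_mem hs₀ ((semi n).nsmul_mem (tE_mem_semi i) a)
  filter_upwards [h] with s hs
  exact ⟨hs, mul_tU_pow_mem_deg hx.2 s⟩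

/-- When `t_i` is the only denominator, clearing it leads back to `T` itself. The integer `d + s`
can be negative for small `s`; quantifying over `e` restricts the claim to the degrees where `T_e`
makes sense. -/
theorem eventually_mul_tU_pow_mem_phi {i : Fin (n + 1)} {d : ℤ} {x : Torus k n q}
    (hx : x ∈ loc (pt k q i []) d) :
    ∀ᶠ s : ℕ in Filter.atTop, ∀ e : ℕ, (e : ℤ) = d + s → ∃ r ∈ TPiece k n q e,
      phi k n q r = x * ((tU k n q i ^ s : (Torus k n q)ˣ) : Torus k n q) := by
  have h : ∀ᶠ s : ℕ in Filter.atTop,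
      x * ((tU k n q i ^ s : (Torus k n q)ˣ) : Torus k n q) ∈ Torus.sp (semi n : Set (Exps n)) := by
    refine Torus.sp_induction (P := fun x => ∀ᶠ s : ℕ in Filter.atTop,
      x * ((tU k n q i ^ s : (Torus k n q)ˣ) : Torus k n q) ∈ Torus.sp (semi n : Set (Exps n)))
      (tLoc_pt_le _ _ hx.1) ?_ ?_ ?_
    · exact Filter.Eventually.of_forall fun s => by rw [zero_mul]; exact Submodule.zero_mem _
    · intro x y hx hy
      filter_upwards [hx, hy] with s hx hy
      rw [add_mul]
      exact Submodule.add_mem _ hx hy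
    · rintro c g ⟨s₀, hs₀⟩
      filter_upwards [Filter.eventually_ge_atTop s₀] with s hs
      refine (mul_tU_pow_mem_sp _ _).2 (Submodule.smul_mem _ _
        (Torus.mono_mem_sp.2 ?_))
      obtain ⟨a, rfl⟩ := Nat.exists_eq_add_of_le hs
      have e : g + (s₀ + a) • tE i = (g + s₀ • listExp i []) + a • tE i := by
        simp only [listExp, List.map_nil, List.sum_nil, add_zero, add_smul]
        abel
      change g + (s₀ + a) • tE i ∈ semi n
      rw [e]
      exact (semi n).add_mem hs₀ ((semi n).nsmul_mem (tE_mem_semi i) a)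
  filter_upwards [h] with s hs e he
  rw [phi_TPiece]
  intro g hg
  obtain ⟨_, hl, -⟩ := hs g hg
  have hd := mul_tU_pow_mem_deg (i := i) hx.2 s
  rw [Torus.deg_eq_sp] at hd
  exact ⟨hl, by rw [he]; exact hd g hg⟩

/-! ### The ideal `T_+` -/

/-- Away from the index `0` all entries of `χ` are `1`, so weight `e χ` makes `α - β` an arithmetic
progression with step `-e`. -/
theorem sub_eq_of_weight {α β : Fin (n + 1) → ℕ} {e : ℤ} (h : (abExp α β).2.2 = e • chi n)
    (j : Fin (n + 1)) : (α j : ℤ) - β j = (α 0 : ℤ) - β 0 - e * j := by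
  obtain ⟨m, hm⟩ := j
  induction m with
  | zero => simp
  | succ m ih =>
    have h1 := congrFun h ⟨m + 1, hm⟩
    rw [abExp_weight] at h1
    have h2 : (⟨m + 1, hm⟩ - 1 : Fin (n + 1)) = ⟨m, by omega⟩ := by
      refine Fin.ext ?_
      rw [Fin.val_sub_one_of_ne_zero (by simp [Fin.ext_iff])]
      simp
    have h3 := ih (by omega)
    have h4 : (e • chi n) ⟨m + 1, hm⟩ = e := by simp [chi, Fin.ext_iff]
    rw [h2, h4] at h1
    simp only at h3 ⊢
    push_cast
    linarith

theorem tE_eq_abExp (i : Fin (n + 1)) :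
    tE i = abExp (fun j : Fin (n + 1) => n - i - j) (fun j : Fin (n + 1) => i + j - n) := by
  have h : ∀ (f : Fin (n + 1) → ℕ) (g : Fin (n + 1) → Gen n),
      ev (List.ofFn fun j => List.replicate (f j) (g j)).flatten = ∑ j, f j • genExp n (g j) :=
    fun f g => by
      simp only [ev, List.map_flatten, List.sum_flatten, List.map_ofFn, List.sum_ofFn,
        Function.comp_def, List.map_replicate, List.sum_replicate]
  rw [tE, tWord, ev_append, h, h]
  refine Prod.ext ?_ (Prod.ext ?_ ?_)
  · simp [abExp, genExp, Prod.fst_sum]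
  · simp [abExp, genExp, Prod.fst_sum, Prod.snd_sum]
  · simp only [abExp, genExp, wt, Prod.snd_sum, Prod.snd_add, Prod.smul_snd, sub_smul,
      Finset.sum_sub_distrib, natCast_zsmul, smul_sub]
    abel

/-- Every monomial of positive degree is divisible by some `t_i`. -/
theorem exists_tE_add {e : ℕ} {g : Exps n} (hg : g ∈ semiDeg n (e + 1)) :
    ∃ i, ∃ h ∈ semiDeg n e, g = tE i + h := by
  obtain ⟨⟨l, rfl⟩, hw⟩ := hg
  rw [ev_eq_abExp] at hw ⊢
  set α : Fin (n + 1) → ℕ := fun j => l.count (.a j)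
  set β : Fin (n + 1) → ℕ := fun j => l.count (.b j)
  have hγ := sub_eq_of_weight hw
  set c : ℤ := (α 0 : ℤ) - β 0
  -- the slope `m` of the segment that contains the monomial
  obtain ⟨m, hm, hα, hβ⟩ : ∃ m : ℕ, m ≤ n ∧ (∀ j : Fin (n + 1), m - j ≤ α j) ∧
      ∀ j : Fin (n + 1), j - m ≤ β j := by
    -- Here `α j - β j = c - (e + 1) j`, while `t_{n-m}` has `a`-exponents `(m - j)⁺` and
    -- `ā`-exponents `(j - m)⁺`. So `m` has to follow the sign change of the progression: it is `c /
    -- (e + 1)` rounded down and clamped to the interval from `0` to `n`.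
    rcases lt_or_ge c 0 with hc | hc
    · refine ⟨0, by omega, by simp, fun j => ?_⟩
      have := hγ j
      have h0 : (0 : ℤ) ≤ e * j := by positivity
      rw [add_mul, one_mul] at this
      omega
    rcases lt_or_ge ((e + 1 : ℤ) * n) c with hc' | hc'
    · refine ⟨n, le_rfl, fun j => ?_, fun j => by have := j.2; omega⟩
      have := hγ j
      have hj : (j : ℤ) ≤ n := by have := j.2; omega
      have h0 : (0 : ℤ) ≤ e * (n - j) := mul_nonneg (by positivity) (by omega)
      rw [add_mul, one_mul] at this hc'
      rw [mul_sub] at h0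
      omega
    · have hd := Int.mul_ediv_add_emod c (e + 1 : ℤ)
      have hr0 := Int.emod_nonneg c (show (e + 1 : ℤ) ≠ 0 by positivity)
      have hr1 := Int.emod_lt_of_pos c (show (0 : ℤ) < e + 1 by positivity)
      have hq0 : 0 ≤ c / (e + 1 : ℤ) := Int.ediv_nonneg hc (by positivity)
      obtain ⟨m, hm⟩ := Int.eq_ofNat_of_zero_le hq0
      rw [hm] at hd
      set r := c % (e + 1 : ℤ)
      have hmn : m ≤ n := by
        by_contra! h
        have : (e + 1 : ℤ) * (n + 1) ≤ (e + 1) * m :=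
          mul_le_mul_of_nonneg_left (by exact_mod_cast h) (by positivity)
        rw [mul_add] at this
        linarith
      refine ⟨m, hmn, fun j => ?_, fun j => ?_⟩
      · rcases le_or_gt m j with h | h
        · omega
        · have h0 : (0 : ℤ) ≤ e * (m - j) := mul_nonneg (by positivity) (by omega)
          have := hγ j
          rw [← hd] at this
          rw [mul_sub] at h0
          rw [add_mul, add_mul, one_mul, one_mul] at this
          omega
      · rcases le_or_gt (j : ℕ) m with h | h
        · omega
        · have h0 : (e : ℤ) ≤ e * (j - m) := le_mul_of_one_le_right (by positivity) (by omega)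
          have := hγ j
          rw [← hd] at this
          rw [mul_sub] at h0
          rw [add_mul, add_mul, one_mul, one_mul] at this
          omega
  let i : Fin (n + 1) := ⟨n - m, by omega⟩
  have hi : (i : ℕ) = n - m := rfl
  let α' : Fin (n + 1) → ℕ := fun j => α j - (n - i - j)
  let β' : Fin (n + 1) → ℕ := fun j => β j - (i + j - n)
  have hsum : abExp α β = tE i + abExp α' β' := by
    rw [tE_eq_abExp, ← abExp_add]
    congr 1
    · funext j
      have := hα j
      simp only [α', Pi.add_apply]
      omega
    · funext j
      have := hβ j
      simp only [β', Pi.add_apply]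
      omega
  refine ⟨i, abExp α' β', ⟨exists_ev_eq_abExp α' β', ?_⟩, hsum⟩
  rw [hsum, Prod.snd_add, Prod.snd_add, (tE_mem_semiDeg i).2, add_smul,
    add_comm ((e : ℤ) • chi n)] at hw
  exact add_left_cancel hw

/-- By `exists_tE_add` each word of positive degree is proportional to some `t_i` followed by a word
of one degree less. So the `t_i` generate `T_+` as a right ideal and can be split off on the left
one at a time. -/
theorem exists_eq_sum_tElt_mul {e : ℕ} {r : RepRing k n q} (hr : r ∈ TPiece k n q (e + 1)) :
    ∃ f : Fin (n + 1) → TPiece k n q e,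
      r = ∑ i, (tElt k n q (.t i) : RepRing k n q) * (f i : RepRing k n q) := by
  unfold TPiece RepRing.piece at hr
  induction hr using Submodule.span_induction with
  | mem r hr =>
    obtain ⟨l, hl, rfl⟩ := hr
    have hmem : ev l ∈ semiDeg n (e + 1) :=
      ⟨⟨l, rfl⟩, by rw [ev_weight, hl, ← natCast_zsmul, Nat.cast_add, Nat.cast_one]⟩
    obtain ⟨i, h, hh, hadd⟩ := exists_tE_add hmem
    obtain ⟨l', rfl⟩ := hh.1
    rw [tE, ← ev_append] at hadd
    obtain ⟨c, hc⟩ := word_proportional_of_ev_eq (k := k) (q := q) hadd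
    refine ⟨Pi.single i ⟨(c : k) • RepRing.word k n q l', Submodule.smul_mem _ _
      (word_mem_TPiece hh)⟩, ?_⟩
    rw [Finset.sum_eq_single i]
    · rw [Pi.single_eq_same, hc, word_append, ← mul_smul_comm]
      rfl
    · intro j _ hj
      rw [Pi.single_eq_of_ne hj]
      exact mul_zero _
    · intro h; exact absurd (Finset.mem_univ i) h
  | zero => exact ⟨0, by simp⟩
  | add r s _ _ hr hs =>
    obtain ⟨f, rfl⟩ := hr
    obtain ⟨g, rfl⟩ := hs
    exact ⟨f + g, by simp [mul_add, Finset.sum_add_distrib]⟩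
  | smul c r _ hr =>
    obtain ⟨f, rfl⟩ := hr
    exact ⟨c • f, by simp [Finset.smul_sum]⟩

/-! ### Noetherianity of the charts -/

theorem Torus.coeff_mul_mono (x : Torus k n q) (g f : Exps n) :
    Torus.coeff (f + g) (x * Torus.mono k n q g) =
      Torus.coeff f x * ((q ^ (f.2.1 * g.1) : kˣ) : k) := by
  classical
  rw [Torus.coeff_mul_of_unique, Torus.coeff_mono, if_pos rfl, mul_one]
  intro g' h' _ hh' e
  rw [Torus.coeff_mono] at hh'
  split_ifs at hh' with h
  · subst h
    exact ⟨add_right_cancel e, rfl⟩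
  · exact absurd rfl hh'

/-- The exponent `g` is the largest one, for the lexicographic order, that occurs in `x`. -/
def IsLead (ι : ℕ × ℕ → Exps n) (x : Torus k n q) (g : ℕ × ℕ) : Prop :=
  Torus.coeff (ι g) x ≠ 0 ∧ ∀ h, Torus.coeff (ι h) x ≠ 0 → toLex h ≤ toLex g

theorem exists_isLead {ι : ℕ × ℕ → Exps n} (hι : Function.Injective ι) {x : Torus k n q}
    (hx : x ∈ Torus.sp (Set.range ι)) (h0 : x ≠ 0) : ∃ g, IsLead ι x g := by
  have hne : (x.supp.preimage ι hι.injOn).Nonempty := by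
    by_contra! h
    refine h0 (Torus.ext_coeff fun g => ?_)
    rw [map_zero]
    by_contra hg
    obtain ⟨g, rfl⟩ := hx g hg
    have : g ∈ x.supp.preimage ι hι.injOn := Finset.mem_preimage.2 (Torus.mem_supp.2 hg)
    rw [h] at this
    exact absurd this (Finset.notMem_empty _)
  obtain ⟨g, hg, hmax⟩ := Finset.exists_max_image _ toLex hne
  exact ⟨g, Torus.mem_supp.1 (Finset.mem_preimage.1 hg), fun h hh =>
    hmax h (Finset.mem_preimage.2 (Torus.mem_supp.2 hh))⟩

/-- The lexicographic order is compatible with addition, and multiplication by a monomial only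
translates the support and rescales coefficients. -/
theorem IsLead.mul_mono {ι : ℕ × ℕ → Exps n}
    (hadd : ∀ g h, ι (g + h) = ι g + ι h) {x : Torus k n q}
    {g : ℕ × ℕ} (hg : IsLead ι x g) (hx : x ∈ Torus.sp (Set.range ι)) (hι : Function.Injective ι)
    (h : ℕ × ℕ) : IsLead ι (x * Torus.mono k n q (ι h)) (g + h) := by
  refine ⟨?_, fun f hf => ?_⟩
  · rw [hadd, Torus.coeff_mul_mono]
    exact mul_ne_zero hg.1 (Units.ne_zero _)
  · rw [← sub_add_cancel (ι f) (ι h), Torus.coeff_mul_mono] at hf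
    have hf' := left_ne_zero_of_mul hf
    obtain ⟨f', hf''⟩ := hx _ hf'
    rw [← hf''] at hf'
    have : f = f' + h := hι (by rw [hadd, hf'', sub_add_cancel])
    rw [this, toLex_add, toLex_add]
    exact add_le_add_left (hg.2 f' hf') _

/-- A subring of the torus with a basis of monomials that is closed under multiplication and
isomorphic to `ℕ × ℕ` is right noetherian. -/
theorem isNoetherianRing_op_of_sp (A : Subring (Torus k n q)) (ι : ℕ × ℕ → Exps n)
    (hι : Function.Injective ι) (hadd : ∀ g h, ι (g + h) = ι g + ι h)
    (hA : ∀ x, x ∈ A ↔ x ∈ Torus.sp (Set.range ι)) : IsNoetherianRing Aᵐᵒᵖ := by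
  have hι0 : ι 0 = 0 := by
    have := hadd 0 0
    rw [add_zero] at this
    exact left_eq_add.1 this
  have hmono : ∀ g, Torus.mono k n q (ι g) ∈ A := fun g =>
    (hA _).2 (Torus.mono_mem_sp.2 ⟨g, rfl⟩)
  -- The leading exponents of a right ideal form a semigroup ideal of `ℕ × ℕ`. Those ideals satisfy
  -- the ascending chain condition by Dickson's lemma, so it suffices that a strictly larger right
  -- ideal has strictly more leading exponents.
  let LE : Submodule Aᵐᵒᵖ Aᵐᵒᵖ → AddSemigroupIdeal (ℕ × ℕ) := fun I =>
    { carrier := {g | ∃ a : A, op a ∈ I ∧ IsLead ι (a : Torus k n q) g}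
      vadd_mem' := by
        rintro h g ⟨a, ha, hg⟩
        refine ⟨a * ⟨_, hmono h⟩, I.smul_mem (op ⟨_, hmono h⟩) ha, ?_⟩
        rw [vadd_eq_add, add_comm]
        exact hg.mul_mono hadd ((hA _).1 a.2) hι h }
  have hLE : StrictMono LE := by
    intro I I' hlt
    refine lt_of_le_not_ge (fun g ⟨a, ha, hg⟩ => ⟨a, hlt.le ha, hg⟩) fun hle => hlt.not_ge ?_
    -- Division by leading terms, by well-founded induction on the leading exponent: subtracting
    -- from `a` a scalar multiple of an element of `I` with the same leading exponent gives either
    -- zero or an element of `I'` with a smaller one.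
    have key : ∀ (g : ℕ ×ₗ ℕ) (a : A), op a ∈ I' → IsLead ι (a : Torus k n q) (ofLex g) →
        op a ∈ I := by
      intro g
      induction g using WellFoundedLT.induction with
      | ind g ih =>
        intro a ha hg
        obtain ⟨b, hb, hbg⟩ : ofLex g ∈ LE I := hle ⟨a, ha, hg⟩
        set c : k := Torus.coeff (ι (ofLex g)) (a : Torus k n q) *
          (Torus.coeff (ι (ofLex g)) (b : Torus k n q))⁻¹ with hc
        have hcA : c • (1 : Torus k n q) ∈ A := by
          rw [hA]
          exact Submodule.smul_mem _ _ (Torus.mono_mem_sp.2 ⟨0, hι0⟩)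
        have hcb : op (b * ⟨c • 1, hcA⟩ : A) ∈ I := I.smul_mem (op ⟨c • 1, hcA⟩) hb
        obtain ⟨r, hr⟩ : ∃ r : A, r = a - b * ⟨c • 1, hcA⟩ := ⟨_, rfl⟩
        suffices h : op r ∈ I by
          have := I.add_mem h hcb
          rwa [← MulOpposite.op_add, hr, sub_add_cancel] at this
        have hd : (r : Torus k n q) = a - c • (b : Torus k n q) := by
          rw [hr]
          change (a : Torus k n q) - b * (c • 1) = _
          rw [mul_smul_comm, mul_one]
        by_cases h0 : (r : Torus k n q) = 0
        · have : r = 0 := Subtype.ext h0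
          rw [this, MulOpposite.op_zero]
          exact I.zero_mem
        · obtain ⟨h, hh⟩ := exists_isLead hι ((hA _).1 r.2) h0
          refine ih (toLex h) ?_ r (hr ▸ I'.sub_mem ha (hlt.le hcb)) hh
          have hh1 := hh.1
          rw [hd, map_sub, map_smul] at hh1
          have hle' : toLex h ≤ g := by
            by_contra! hgt
            refine hh1 ?_
            rw [not_not.1 (mt (hg.2 h) (not_le.2 hgt)), not_not.1 (mt (hbg.2 h) (not_le.2 hgt)),
              smul_zero, sub_zero]
          refine lt_of_le_of_ne hle' fun e => hh1 ?_
          have e' : h = ofLex g := congrArg ofLex e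
          rw [e', smul_eq_mul, hc, mul_assoc, inv_mul_cancel₀ hbg.1, mul_one, sub_self]
    intro a ha
    by_cases h0 : ((unop a : A) : Torus k n q) = 0
    · have : a = 0 := unop_injective (Subtype.ext h0)
      rw [this]
      exact I.zero_mem
    · obtain ⟨h, hh⟩ := exists_isLead hι ((hA _).1 (unop a : A).2) h0
      exact key (toLex h) (unop a) ha hh
  exact (isNoetherian_iff' (R := Aᵐᵒᵖ) (M := Aᵐᵒᵖ)).2 hLE.wellFoundedGT

/-! ### Monomial coordinates on the charts. -/

/-- The exponents `(c + 1, c - n, 0)` and `(-c, n + 1 - c, 0)` of the generators of a chart. -/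
def chartExp (n c : ℕ) (g : ℕ × ℕ) : Exps n :=
  ((c + 1) * g.1 - c * g.2, -(n - c) * g.1 + (n + 1 - c) * g.2, 0)

theorem chartExp_add (c : ℕ) (g h : ℕ × ℕ) :
    chartExp n c (g + h) = chartExp n c g + chartExp n c h := by
  refine Prod.ext ?_ (Prod.ext ?_ ?_)
  · simp [chartExp]; ring
  · simp [chartExp]; ring
  · simp [chartExp]

/-- The first coordinate is `a + c (a - b)` and its difference from the second one is `(n + 1) (a -
b)`, so both `a` and `b` can be recovered. -/
theorem chartExp_injective (c : ℕ) : Function.Injective (chartExp n c) := by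
  rintro ⟨a, b⟩ ⟨a', b'⟩ h
  have h1 := congrArg (fun g : Exps n => g.1) h
  have h2 := congrArg (fun g : Exps n => g.2.1) h
  simp only [chartExp] at h1 h2
  have h3 : ((n : ℤ) + 1) * (a - b) = (n + 1) * (a' - b') := by linarith
  have h4 := mul_left_cancel₀ (by positivity) h3
  have h5 : (a : ℤ) = a' := by
    have : (a : ℤ) + c * (a - b) = a' + c * (a' - b') := by linarith
    rw [h4] at this
    linarith
  have h6 : (b : ℤ) = b' := by linarith
  exact Prod.ext (by exact_mod_cast h5) (by exact_mod_cast h6)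

theorem sum_ite_lt {m : ℕ} (hm : m ≤ n + 1) (a : ℤ) :
    ∑ j : Fin (n + 1), (if (j : ℕ) < m then a else 0) = m * a := by
  rw [Fin.sum_univ_eq_sum_range (fun j => if j < m then a else 0), ← Finset.sum_filter,
    Finset.sum_const, nsmul_eq_mul]
  congr 2
  have : (Finset.range (n + 1)).filter (· < m) = Finset.range m := by
    ext j; simp only [Finset.mem_filter, Finset.mem_range]; omega
  rw [this, Finset.card_range]

/-- The exponent with `a`-part `(c - j)⁺` and `ā`-part `(c - j)⁻`. -/
def slopeExp (n : ℕ) (c : ℤ) : Exps n :=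
  abExp (fun j : Fin (n + 1) => (c - j).toNat) (fun j : Fin (n + 1) => (j - c).toNat)

/-- The `a`-exponents minus the `ā`-exponents form the progression `c - j`. Values of `c` outside
the range from `0` to `n` are admitted because the neighbours `-1` and `n + 1` occur at the two
extreme charts. -/
theorem slopeExp_mem (c : ℤ) : slopeExp n c ∈ semiDeg n 1 := by
  refine ⟨exists_ev_eq_abExp _ _, ?_⟩
  ext l
  rw [slopeExp, abExp_weight, one_smul]
  unfold chi
  by_cases hl : l = 0
  · subst hl
    have : ((0 - 1 : Fin (n + 1)) : ℕ) = n := by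
      rw [zero_sub, Fin.coe_neg_one]
    rw [if_pos rfl, this]
    simp only [Fin.val_zero]
    omega
  · rw [if_neg hl]
    have h0 : (l : ℕ) ≠ 0 := fun h => hl (Fin.ext h)
    have : ((l - 1 : Fin (n + 1)) : ℕ) = l - 1 := Fin.val_sub_one_of_ne_zero hl
    rw [this]
    omega

theorem tE_eq_slopeExp (i : Fin (n + 1)) : tE i = slopeExp n (n - i : ℕ) := by
  rw [tE_eq_abExp, slopeExp]
  congr 1 <;> · funext j; have := i.2; omega

/-- Raising the slope `c` by one adds a factor `a_j` for `j ≤ c` and removes a factor `ā_j` for `j >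
c`. So the first coordinate of the chart is the quotient of two neighbouring elements `t`, except
for `c = n`, where it is `x`; `slopeExp_pred` treats the second coordinate, which is `y` for `c =
0`. -/
theorem slopeExp_succ {c : ℕ} (hc : c ≤ n) :
    chartExp n c (1, 0) + slopeExp n c = slopeExp n (c + 1) := by
  refine Prod.ext ?_ (Prod.ext ?_ ?_)
  · have := sum_ite_lt (n := n) (show c + 1 ≤ n + 1 by omega) 1
    simp only [chartExp, slopeExp, abExp, Prod.fst_add]
    push_cast at this ⊢
    rw [mul_one] at this
    rw [mul_one, mul_zero, sub_zero, ← this, ← Finset.sum_add_distrib]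
    refine Finset.sum_congr rfl fun j _ => ?_
    split_ifs <;> omega
  · have := sum_ite_lt (n := n) (show c + 1 ≤ n + 1 by omega) 1
    simp only [chartExp, slopeExp, abExp, Prod.fst_add, Prod.snd_add]
    push_cast at this ⊢
    have h1 : -((n : ℤ) - c) = ∑ j : Fin (n + 1), ((if (j : ℕ) < c + 1 then (1 : ℤ) else 0) - 1) := by
      rw [Finset.sum_sub_distrib, this]; simp
    rw [mul_one, mul_zero, add_zero, h1, ← Finset.sum_add_distrib]
    refine Finset.sum_congr rfl fun j _ => ?_
    split_ifs <;> omega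
  · rw [Prod.snd_add, Prod.snd_add, (slopeExp_mem _).2, (slopeExp_mem _).2]
    simp [chartExp]

theorem slopeExp_pred {c : ℕ} (hc : c ≤ n) :
    chartExp n c (0, 1) + slopeExp n c = slopeExp n (c - 1) := by
  refine Prod.ext ?_ (Prod.ext ?_ ?_)
  · have := sum_ite_lt (n := n) (show c ≤ n + 1 by omega) (-1)
    simp only [chartExp, slopeExp, abExp, Prod.fst_add]
    push_cast at this ⊢
    have h1 : ((c : ℤ) + 1) * 0 - c * 1 = c * -1 := by ring
    rw [h1, ← this, ← Finset.sum_add_distrib]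
    refine Finset.sum_congr rfl fun j _ => ?_
    split_ifs <;> omega
  · have := sum_ite_lt (n := n) (show c ≤ n + 1 by omega) (-1)
    simp only [chartExp, slopeExp, abExp, Prod.fst_add, Prod.snd_add]
    push_cast at this ⊢
    have h1 : -((n : ℤ) - c) * 0 + (n + 1 - c) * 1 =
        ∑ j : Fin (n + 1), ((if (j : ℕ) < c then (-1 : ℤ) else 0) + 1) := by
      rw [Finset.sum_add_distrib, this]; simp; ring
    rw [h1, ← Finset.sum_add_distrib]
    refine Finset.sum_congr rfl fun j _ => ?_
    split_ifs <;> omega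
  · rw [Prod.snd_add, Prod.snd_add, (slopeExp_mem _).2, (slopeExp_mem _).2]
    simp [chartExp]

/-- For a word with exponent `g + s • slopeExp n c` the number `Δ = α j - β j - s (c - j)` does not
depend on `j`. The coordinates of `g` are linear in `Δ` and the exponents, and are nonnegative
because they can be written as sums of exponents of the word. -/
theorem mem_range_chartExp {c : ℕ} (hc : c ≤ n) {g : Exps n} (h0 : g.2.2 = 0) {s : ℕ}
    (hs : g + s • slopeExp n c ∈ semi n) : g ∈ Set.range (chartExp n c) := by
  obtain ⟨-, ⟨l, hl⟩, -⟩ := hs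
  have hw : (ev l).2.2 = (s : ℤ) • chi n := by
    rw [hl, Prod.snd_add, Prod.snd_add, h0, zero_add, Prod.smul_snd, Prod.smul_snd,
      (slopeExp_mem _).2, one_smul, natCast_zsmul]
  rw [ev_eq_abExp] at hw hl
  set α : Fin (n + 1) → ℕ := fun j => l.count (.a j)
  set β : Fin (n + 1) → ℕ := fun j => l.count (.b j)
  have hγ := sub_eq_of_weight hw
  set Δ : ℤ := (α 0 : ℤ) - β 0 - s * c with hΔ
  have hγ' : ∀ j : Fin (n + 1), (α j : ℤ) - β j = Δ + s * (c - j) := fun j => by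
    rw [hγ j, hΔ]; ring
  have h1 : ∑ j, (α j : ℤ) = g.1 + s • ∑ j : Fin (n + 1), (((c : ℤ) - j).toNat : ℤ) :=
    congrArg (fun g : Exps n => g.1) hl
  have h2 : ∑ j, (β j : ℤ) = g.2.1 + s • ∑ j : Fin (n + 1), (((j : ℤ) - c).toNat : ℤ) :=
    congrArg (fun g : Exps n => g.2.1) hl
  rw [nsmul_eq_mul] at h1 h2
  set A := ∑ j, (α j : ℤ)
  set B := ∑ j, (β j : ℤ)
  set K := ∑ j : Fin (n + 1), (((c : ℤ) - j).toNat : ℤ) with hK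
  set K' := ∑ j : Fin (n + 1), (((j : ℤ) - c).toNat : ℤ) with hK'
  -- The equations `g.1 = (c + 1) a - c b` and `Δ = a - b` force `a = g.1 - c Δ` and `b = g.1 - (c +
  -- 1) Δ`. Subtracting `Δ + s (c - j)` from `α j` for the first `c`, respectively `c + 1`, indices
  -- turns `α j` into `β j`.
  let a : ℕ := ∑ j : Fin (n + 1), if (j : ℕ) < c then β j else α j
  let b : ℕ := ∑ j : Fin (n + 1), if (j : ℕ) < c + 1 then β j else α j
  have ha : (a : ℤ) = A - c * Δ - s * K := by
    rw [← sum_ite_lt (n := n) (show c ≤ n + 1 by omega) Δ, hK, Finset.mul_sum,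
      ← Finset.sum_sub_distrib, ← Finset.sum_sub_distrib, Nat.cast_sum]
    refine Finset.sum_congr rfl fun j _ => ?_
    have := hγ' j
    split_ifs with h
    · rw [Int.toNat_of_nonneg (by omega)]; linarith
    · rw [show ((c : ℤ) - j).toNat = 0 by omega]; simp
  have hb : (b : ℤ) = A - (c + 1 : ℕ) * Δ - s * K := by
    rw [← sum_ite_lt (n := n) (show c + 1 ≤ n + 1 by omega) Δ, hK, Finset.mul_sum,
      ← Finset.sum_sub_distrib, ← Finset.sum_sub_distrib, Nat.cast_sum]
    refine Finset.sum_congr rfl fun j _ => ?_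
    have := hγ' j
    split_ifs with h
    · rw [Int.toNat_of_nonneg (by omega)]; linarith
    · rw [show ((c : ℤ) - j).toNat = 0 by omega]; simp
  have hAB : A - B = (n + 1) * Δ + s * (K - K') := by
    have : ((n : ℤ) + 1) * Δ = ∑ _j : Fin (n + 1), Δ := by simp
    rw [this, hK, hK', ← Finset.sum_sub_distrib, ← Finset.sum_sub_distrib, Finset.mul_sum,
      ← Finset.sum_add_distrib]
    refine Finset.sum_congr rfl fun j _ => ?_
    rw [hγ' j]
    congr 2
    omega
  refine ⟨(a, b), Prod.ext ?_ (Prod.ext ?_ h0.symm)⟩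
  · simp only [chartExp]
    rw [ha, hb]
    push_cast
    linear_combination h1
  · simp only [chartExp]
    rw [ha, hb]
    push_cast
    linear_combination h2 + hAB

/-- With `c = n - i`, the exponents of degree `0` in the localisation at `t_i` are exactly those of
the form `chartExp n c`, so `isNoetherianRing_op_of_sp` applies. -/
theorem isNoetherianRing_oLoc_pt (i : Fin (n + 1)) : IsNoetherianRing (oLoc (pt k q i []))ᵐᵒᵖ := by
  have hc : n - (i : ℕ) ≤ n := Nat.sub_le _ _
  have hl : listExp i [] = slopeExp n (n - i : ℕ) := by
    rw [listExp, tE_eq_slopeExp]; simp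
  refine isNoetherianRing_op_of_sp _ (chartExp n (n - i)) (chartExp_injective _) (chartExp_add _)
    fun x => ⟨fun hx g hg => ?_, fun hx => ?_⟩
  · have hx' : x ∈ tLoc (pt k q i []) := hx.1
    obtain ⟨s, hs⟩ := tLoc_pt_le i [] hx' g hg
    have h0 := hx.2
    rw [Torus.deg_eq_sp] at h0
    exact mem_range_chartExp hc ((h0 g hg).trans (zero_smul _ _)) (by rw [← hl]; exact hs)
  · refine ⟨mem_tLoc_pt _ _ (Torus.sp_mono ?_ hx), ?_⟩
    · rintro _ ⟨⟨a, b⟩, rfl⟩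
      -- Each of the two generators has denominator `t_i`, so `a + b` factors `t_i` clear a monomial
      -- with coordinates `a` and `b`.
      refine ⟨a + b, ?_⟩
      have e : chartExp n (n - i) (a, b) + (a + b) • slopeExp n (n - i : ℕ) =
          a • slopeExp n ((n - i : ℕ) + 1) + b • slopeExp n ((n - i : ℕ) - 1) := by
        have h1 : chartExp n (n - i) (a, b) =
            a • chartExp n (n - i) (1, 0) + b • chartExp n (n - i) (0, 1) := by
          refine Prod.ext ?_ (Prod.ext ?_ ?_)
          · simp [chartExp]; ring
          · simp [chartExp]; ring
          · simp [chartExp]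
        rw [← slopeExp_succ hc, ← slopeExp_pred hc, h1, smul_add, smul_add, add_smul]
        abel
      rw [hl, e]
      exact (semi n).add_mem ((semi n).nsmul_mem ⟨1, slopeExp_mem _⟩ a)
        ((semi n).nsmul_mem ⟨1, slopeExp_mem _⟩ b)
    · rw [Torus.deg_eq_sp]
      refine Torus.sp_mono ?_ hx
      rintro _ ⟨g, rfl⟩
      exact (zero_smul ℤ (chi n)).symm

/-! ### Torsion and the powers of the `t_i` -/

variable (k q) in
/-- The power `t_i ^ s` as an element of `T_s`. -/
def tP (i : Fin (n + 1)) (s : ℕ) : TPiece k n q s :=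
  ⟨(tElt k n q (.t i) : RepRing k n q) ^ s, by
    induction s with
    | zero => rw [pow_zero]; exact one_mem_TPiece k n q
    | succ s ih => rw [pow_succ]; exact mul_mem_TPiece ih (word_mem_TPiece (tE_mem_semiDeg i))⟩

theorem phi_tP (i : Fin (n + 1)) (s : ℕ) : phi k n q (tP k q i s) =
    ((tU k n q i ^ s : (Torus k n q)ˣ) : Torus k n q) := by
  change phi k n q ((tElt k n q (.t i) : RepRing k n q) ^ s) = _
  rw [map_pow, ← coe_tU, Units.val_pow_eq_pow_val]

theorem tP_mul (i : Fin (n + 1)) (s s' : ℕ) :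
    (tP k q i s : RepRing k n q) * tP k q i s' = tP k q i (s + s') :=
  (pow_add _ _ _).symm

theorem tP_mem_TPlus_pow (i : Fin (n + 1)) (s : ℕ) :
    (tP k q i s : RepRing k n q) ∈ TPlus k n q ^ s := by
  refine Submodule.pow_mem_pow _ ?_ s
  exact Submodule.mem_iSup_of_mem (p := fun d : ℕ => TPiece k n q (d + 1)) 0
    (word_mem_TPiece (tE_mem_semiDeg i))

theorem tP_eq_word (i : Fin (n + 1)) (s : ℕ) :
    (tP k q i s : RepRing k n q) = RepRing.word k n q (List.replicate s (tWord n i)).flatten := by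
  change (tElt k n q (.t i) : RepRing k n q) ^ s = _
  induction s with
  | zero => rw [pow_zero]; rfl
  | succ s ih => rw [List.replicate_succ, List.flatten_cons, word_append, ← ih, pow_succ']; rfl

/-- The powers of `t_i` are normal. -/
theorem exists_mul_tP_eq (i : Fin (n + 1)) (s : ℕ) {e : ℕ} (r : TPiece k n q e) :
    ∃ r' : TPiece k n q e, (r : RepRing k n q) * tP k q i s = tP k q i s * r' := by
  rw [tP_eq_word]
  obtain ⟨r', h, h'⟩ := exists_mul_word_eq (List.replicate s (tWord n i)).flatten r.2
  exact ⟨⟨r', h⟩, h'⟩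

namespace GrMod

variable (M : GrMod k n q)

variable {M} in
-- Degrees of homogeneous elements often agree only propositionally; this permits the comparison of
-- actions by the underlying elements of `R` alone.
theorem act_congr {d f : ℤ} {e e' : ℕ} (h : d + e = f) (h' : d + e' = f) (m : M.comp d)
    (r : TPiece k n q e) (r' : TPiece k n q e') (hr : (r : RepRing k n q) = r') :
    M.act e h m r = M.act e' h' m r' := by
  obtain rfl : e = e' := by omega
  obtain rfl : r = r' := Subtype.ext hr
  rfl

variable {M} in
theorem act_act_eq {d f g : ℤ} {e e' e'' : ℕ} (h : d + e = f) (h' : f + e' = g)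
    (h'' : d + e'' = g) (m : M.comp d) (r : TPiece k n q e) (r' : TPiece k n q e')
    (r'' : TPiece k n q e'') (hr : (r : RepRing k n q) * r' = r'') :
    M.act e' h' (M.act e h m r) r' = M.act e'' h'' m r'' := by
  rw [M.act_act e e' h h' (by omega)]
  exact act_congr _ _ _ _ _ hr

/-- A graded subgroup that is stable under the action of `T`. -/
def Stable (P : ∀ d, AddSubgroup (M.comp d)) : Prop :=
  ∀ {d f : ℤ} (e : ℕ) (h : d + e = f) (m : M.comp d) (r : TPiece k n q e),
    m ∈ P d → M.act e h m r ∈ P f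

variable {M}

/-- A pigeonhole argument, by induction on the sum of the `σ i`. If `r` is written as a sum of terms
`t_j c_j`, then `m t_j` satisfies the hypothesis with `σ j` lowered by one, and `c_j` has one degree
less. -/
theorem act_mem_of_act_tP_mem {P : ∀ d, AddSubgroup (M.comp d)} (hP : M.Stable P) {d : ℤ}
    (σ : Fin (n + 1) → ℕ) (m : M.comp d)
    (hσ : ∀ i, M.act (σ i) rfl m (tP k q i (σ i)) ∈ P _) {f : ℤ} (e : ℕ) (he : ∑ i, σ i ≤ e)
    (h : d + e = f) (r : TPiece k n q e) : M.act e h m r ∈ P f := by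
  induction hs : ∑ i, σ i generalizing d σ f e with
  | zero =>
    have h0 : σ 0 = 0 := by
      have := Finset.single_le_sum (f := σ) (fun i _ => Nat.zero_le _) (Finset.mem_univ 0)
      omega
    -- The exponent is generalised because it also occurs in the type of the degree.
    have h1 : ∀ s : ℕ, s = 0 → M.act s rfl m (tP k q (0 : Fin (n + 1)) s) ∈ P _ → m ∈ P d := by
      rintro _ rfl h
      have : ∀ {f : ℤ} (hf : d + (0 : ℕ) = f), M.act 0 hf m (tP k q (0 : Fin (n + 1)) 0) ∈ P f →
          m ∈ P d := by
        intro f hf h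
        obtain rfl : d = f := by omega
        have e : tP k q (0 : Fin (n + 1)) 0 = ⟨1, one_mem_TPiece k n q⟩ :=
          Subtype.ext (pow_zero _)
        rwa [e, M.act_one] at h
      exact this _ h
    exact hP e h m r (h1 _ h0 (hσ 0))
  | succ S ih =>
    -- If some `σ i` vanishes, then `m` itself lies in `P` and stability suffices. Otherwise every
    -- `σ j` can be lowered.
    by_cases hz : ∃ i, σ i = 0
    · obtain ⟨i, hi⟩ := hz
      have : ∀ {f : ℤ} (s : ℕ) (hf : d + s = f), s = 0 → M.act s hf m (tP k q i s) ∈ P f →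
          m ∈ P d := by
        rintro f _ hf rfl h
        obtain rfl : d = f := by omega
        have e : tP k q i 0 = ⟨1, one_mem_TPiece k n q⟩ := Subtype.ext (pow_zero _)
        rwa [e, M.act_one] at h
      exact hP e h m r (this _ rfl hi (hσ i))
    · push Not at hz
      obtain ⟨e, rfl⟩ : ∃ e', e = e' + 1 := ⟨e - 1, by omega⟩
      obtain ⟨c, hc⟩ := exists_eq_sum_tElt_mul r.2
      have hr : r = ∑ j, (⟨(tP k q j 1 : RepRing k n q) * c j, by
          have := mul_mem_TPiece (tP k q j 1).2 (c j).2
          rwa [add_comm] at this⟩ : TPiece k n q (e + 1)) := by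
        refine Subtype.ext ?_
        rw [hc, AddSubmonoidClass.coe_finsetSum]
        refine Finset.sum_congr rfl fun j _ => ?_
        change _ = (tElt k n q (.t j) : RepRing k n q) ^ 1 * _
        rw [pow_one]
      rw [hr, map_sum]
      refine AddSubgroup.sum_mem _ fun j _ => ?_
      rw [← act_act_eq (f := d + 1) (e := 1) (e' := e) (by norm_num) (by push_cast at h; omega) h m
        (tP k q j 1) (c j) _ rfl]
      refine ih (Function.update σ j (σ j - 1)) _ (fun i => ?_) e ?_ _ _ ?_
      · by_cases hij : i = j
        · subst hij
          have hpos := hz i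
          have : ∀ (s : ℕ) {f f' : ℤ} (hf : d + 1 + s = f) (hf' : d + σ i = f'), s = σ i - 1 →
              M.act (σ i) hf' m (tP k q i (σ i)) ∈ P f' →
              M.act s hf (M.act 1 (by norm_num) m (tP k q i 1)) (tP k q i s) ∈ P f := by
            rintro s f f' hf hf' rfl h
            obtain rfl : f = f' := by omega
            rwa [act_act_eq _ _ hf' m _ _ (tP k q i (σ i)) (by
              rw [tP_mul, Nat.add_sub_cancel' (Nat.pos_of_ne_zero hpos)])]
          exact this _ _ rfl (by simp) (hσ i)
        · have : ∀ (s : ℕ) {f f' : ℤ} (hf : d + 1 + s = f) (hf' : d + σ i = f'), s = σ i →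
              M.act (σ i) hf' m (tP k q i (σ i)) ∈ P f' →
              M.act s hf (M.act 1 (by norm_num) m (tP k q j 1)) (tP k q i s) ∈ P f := by
            rintro s f f' hf hf' rfl h
            -- For `i ≠ j` the exponent `σ i` still works for `m t_j`: normality moves `t_i ^ σ i`
            -- in front, and `P` is stable.
            obtain ⟨r', hr'⟩ := exists_mul_tP_eq i (σ i) (tP k q j 1)
            have h2 := hP 1 (show f' + (1 : ℕ) = f by push_cast; omega) _ r' h
            rw [act_act_eq (e'' := σ i + 1) _ _ (by push_cast; omega) m _ _
              ⟨_, mul_mem_TPiece (tP k q i (σ i)).2 r'.2⟩ rfl] at h2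
            rwa [act_act_eq (e'' := σ i + 1) _ _ (by push_cast; omega) m _ _
              ⟨_, mul_mem_TPiece (tP k q i (σ i)).2 r'.2⟩ hr']
          exact this _ _ rfl (by simp [hij]) (hσ i)
      · have h1 := Finset.sum_update_of_mem (Finset.mem_univ j) σ (σ j - 1)
        have h2 := Finset.add_sum_erase Finset.univ σ (Finset.mem_univ j)
        have := hz j
        rw [Finset.sdiff_singleton_eq_erase] at h1
        omega
      · have h1 := Finset.sum_update_of_mem (Finset.mem_univ j) σ (σ j - 1)
        have h2 := Finset.add_sum_erase Finset.univ σ (Finset.mem_univ j)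
        have := hz j
        rw [Finset.sdiff_singleton_eq_erase] at h1
        omega

end GrMod

theorem phi_TPlus_pow (s : ℕ) {r : RepRing k n q} (hr : r ∈ TPlus k n q ^ s) :
    phi k n q r ∈ Torus.sp {g : Exps n | ∃ e : ℕ, s ≤ e ∧ g ∈ semiDeg n e} := by
  have h1 : ∀ r ∈ TPlus k n q,
      phi k n q r ∈ Torus.sp {g : Exps n | ∃ e : ℕ, 1 ≤ e ∧ g ∈ semiDeg n e} := by
    intro r hr
    unfold TPlus at hr
    induction hr using Submodule.iSup_induction' with
    | mem e r hr =>
      exact Torus.sp_mono (B := {g : Exps n | ∃ e : ℕ, 1 ≤ e ∧ g ∈ semiDeg n e})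
        (fun g hg => ⟨e + 1, by omega, hg⟩) (phi_TPiece.1 ⟨r, hr, rfl⟩)
    | zero => rw [map_zero]; exact Submodule.zero_mem _
    | add r s _ _ hr hs => rw [map_add]; exact Submodule.add_mem _ hr hs
  induction s generalizing r with
  | zero =>
    rw [pow_zero] at hr
    obtain ⟨c, rfl⟩ := Submodule.mem_one.1 hr
    rw [AlgHom.commutes, Algebra.algebraMap_eq_smul_one]
    exact Submodule.smul_mem _ _ (Torus.mono_mem_sp.2 ⟨0, le_rfl, ⟨[], rfl⟩, by simp⟩)
  | succ s ih =>
    rw [pow_succ] at hr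
    induction hr using Submodule.mul_induction_on' with
    | mem_mul_mem a ha b hb =>
      rw [map_mul]
      refine Torus.mul_mem_sp ?_ (ih ha) (h1 b hb)
      rintro _ ⟨e, he, ⟨l, rfl⟩, h⟩ _ ⟨e', he', ⟨l', rfl⟩, h'⟩
      exact ⟨e + e', by omega, ⟨l ++ l', ev_append l l'⟩, by
        rw [Prod.snd_add, Prod.snd_add, h, h', Nat.cast_add, add_smul]⟩
    | add a _ b _ ha hb => rw [map_add]; exact Submodule.add_mem _ ha hb

/-- Elements of the `s`-th power of `T_+` involve only degrees at least `s`. The entry `-n` of `χ`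
is nonzero, so a monomial has only one degree. -/
theorem eq_zero_of_mem_TPlus_pow [NeZero n] {s e : ℕ} (hes : e < s) {r : RepRing k n q}
    (hr : r ∈ TPiece k n q e) (hr' : r ∈ TPlus k n q ^ s) : r = 0 := by
  refine phi_injective ((Torus.ext_coeff fun g => ?_).trans (map_zero _).symm)
  rw [map_zero]
  by_contra hg
  obtain ⟨e', he', -, h'⟩ := phi_TPlus_pow s hr' g hg
  obtain ⟨-, h⟩ := (phi_TPiece.1 ⟨r, hr, rfl⟩) g hg
  rw [h] at h'
  have := congrFun h' 0
  simp only [Pi.smul_apply, chi, if_pos, smul_eq_mul] at this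
  have hn : (n : ℤ) ≠ 0 := by exact_mod_cast NeZero.ne n
  have := mul_right_cancel₀ (neg_ne_zero.2 hn) this
  omega

/-- An element is torsion modulo `P` if it is multiplied into `P` by a power of each `t_i`. -/
theorem GrMod.torsionMod_of_forall [NeZero n] {M : GrMod k n q} {P : ∀ d, AddSubgroup (M.comp d)}
    (hP : M.Stable P) {d : ℤ} (m : M.comp d)
    (h : ∀ i, ∃ s : ℕ, M.act s rfl m (tP k q i s) ∈ P _) : M.TorsionMod P m := by
  choose σ hσ using h
  refine ⟨∑ i, σ i, fun {f} e he r hr => ?_⟩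
  -- An element of `T_e` in the `s`-th power of `T_+` vanishes for `e < s`, so only degrees `e` with
  -- `∑ i, σ i ≤ e` matter.
  rcases lt_or_ge e (∑ i, σ i) with hlt | hge
  · have : r = 0 := Subtype.ext (eq_zero_of_mem_TPlus_pow hlt r.2 hr)
    rw [this, map_zero]
    exact AddSubgroup.zero_mem _
  · exact act_mem_of_act_tP_mem hP σ m hσ e hge he r

/-! ### Maps out of tensor products -/

section BalTensor

variable {A S : Type u} [Ring A] [Ring S]
  {M : Type u} [AddCommGroup M] [Module Sᵐᵒᵖ M] {L : Type u} [AddCommGroup L] [Module Aᵐᵒᵖ L]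
  {act : S → L →ₗ[Aᵐᵒᵖ] L}

theorem BalTensor.mk_add_left (m m' : M) (l : L) :
    (BalTensor.mk (m + m') l : BalTensor A S M L act) = BalTensor.mk m l + BalTensor.mk m' l :=
  congrArg Submodule.Quotient.mk (TensorProduct.tmul_add l m m')

theorem BalTensor.mk_add_right (m : M) (l l' : L) :
    (BalTensor.mk m (l + l') : BalTensor A S M L act) = BalTensor.mk m l + BalTensor.mk m l' :=
  congrArg Submodule.Quotient.mk (TensorProduct.add_tmul l l' m)

theorem BalTensor.mk_smul (m : M) (s : S) (l : L) :
    (BalTensor.mk ((op s : Sᵐᵒᵖ) • m) l : BalTensor A S M L act) = BalTensor.mk m (act s l) :=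
  (Submodule.Quotient.eq _).2 (Submodule.subset_span ⟨l, s, m, rfl⟩)

/-- The additive map out of `M ⊗_S L` given by a balanced biadditive map. -/
def BalTensor.lift {G : Type*} [AddCommGroup G] (f : M →+ L →+ G)
    (hf : ∀ m (s : S) l, f ((op s : Sᵐᵒᵖ) • m) l = f m (act s l)) : BalTensor A S M L act →+ G :=
  QuotientAddGroup.lift (Submodule.span Aᵐᵒᵖ (balRel A S M L act)).toAddSubgroup
    (TensorProduct.liftAddHom f.flip fun r l m => by simp) fun a ha => by
      refine Submodule.closure_induction (p := fun a _ => TensorProduct.liftAddHom f.flip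
        (fun r l m => by simp) a = 0) ?_ ?_ ?_ ha
      · exact map_zero _
      · intro x y _ _ hx hy; rw [map_add, hx, hy, add_zero]
      · intro c x hx
        obtain ⟨l, s, m, hx⟩ := smul_mem_balRel c hx
        rw [hx, map_sub, TensorProduct.liftAddHom_tmul, TensorProduct.liftAddHom_tmul,
          AddMonoidHom.flip_apply, AddMonoidHom.flip_apply, hf, sub_self]

theorem BalTensor.hom_ext {G : Type*} [AddCommGroup G] {f g : BalTensor A S M L act →+ G}
    (h : ∀ m l, f (BalTensor.mk m l) = g (BalTensor.mk m l)) : f = g := by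
  refine AddMonoidHom.ext fun x => ?_
  induction x using BalTensor.induction with
  | zero => rw [map_zero, map_zero]
  | add x y hx hy => rw [map_add, map_add, hx, hy]
  | mk m l => exact h m l

end BalTensor

/-! ### The modules `N ⊗ T[t_c⁻¹ | c ∈ I(p)]_d` -/

/-- Multiplication on the right by an element of degree `e` of `T[t_c⁻¹ | c ∈ I(p)]`. -/
def locMul (p : X k n q) {d e f : ℤ} (h : d + e = f) : loc p d →+ loc p e →+ loc p f :=
  AddMonoidHom.mk' (fun x => AddMonoidHom.mk' (fun y => ⟨x * y, h ▸ mul_mem_loc x.2 y.2⟩)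
    fun _ _ => Subtype.ext (mul_add _ _ _)) fun _ _ =>
      AddMonoidHom.ext fun _ => Subtype.ext (add_mul _ _ _)

theorem coe_locMul (p : X k n q) {d e f : ℤ} (h : d + e = f) (x : loc p d) (y : loc p e) :
    (locMul p h x y : Torus k n q) = x * y := rfl

theorem locMul_add_left (p : X k n q) {d e f : ℤ} (h : d + e = f) (x x' : loc p d) (y : loc p e) :
    locMul p h (x + x') y = locMul p h x y + locMul p h x' y := Subtype.ext (add_mul _ _ _)

theorem locMul_add_right (p : X k n q) {d e f : ℤ} (h : d + e = f) (x : loc p d) (y y' : loc p e) :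
    locMul p h x (y + y') = locMul p h x y + locMul p h x y' := Subtype.ext (mul_add _ _ _)

/-- The unit of `T[t_c⁻¹ | c ∈ I(p)]`. -/
def locOne (p : X k n q) : loc p 0 := ⟨1, (oLoc p).one_mem⟩

/-- The power `t_i ^ d` in `T[t_c⁻¹ | c ∈ I(p)]_d`, if `t_i ∉ p`. -/
def tz {p : X k n q} {i : Fin (n + 1)} (hp : p.Inv (.t i)) (d : ℤ) : loc p d :=
  ⟨(tU k n q i ^ d : (Torus k n q)ˣ), tU_zpow_mem_loc hp d⟩

theorem coe_tz {p : X k n q} {i : Fin (n + 1)} (hp : p.Inv (.t i)) (d : ℤ) :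
    (tz hp d : Torus k n q) = (tU k n q i ^ d : (Torus k n q)ˣ) := rfl

theorem locMul_tz_tz {p : X k n q} {i : Fin (n + 1)} (hp : p.Inv (.t i)) {d e f : ℤ}
    (h : d + e = f) : locMul p h (tz hp d) (tz hp e) = tz hp f := by
  refine Subtype.ext ?_
  rw [coe_locMul, coe_tz, coe_tz, coe_tz, ← Units.val_mul, ← zpow_add, h]

theorem tz_zero {p : X k n q} {i : Fin (n + 1)} (hp : p.Inv (.t i)) : tz hp 0 = locOne p :=
  Subtype.ext (by rw [coe_tz, zpow_zero]; rfl)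

theorem locIncl_locMul {p p' : X k n q} (h : p.Generizes p') {d e f : ℤ} (hd : d + e = f)
    (x : loc p d) (y : loc p e) :
    locIncl h f (locMul p hd x y) = locMul p' hd (locIncl h d x) (locIncl h e y) := by
  refine Subtype.ext ?_
  rw [coe_locIncl, coe_locMul, coe_locMul, coe_locIncl, coe_locIncl]

theorem locMul_oAct {V : Opens (X k n q)} (p : V) {d e f : ℤ} (h : d + e = f) (s : O V)
    (x : loc p.1 d) (y : loc p.1 e) :
    locMul p.1 h (oAct p d s x) y = oAct p f s (locMul p.1 h x y) := by
  refine Subtype.ext ?_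
  unfold oAct
  rw [coe_locMul, coe_locLeft, coe_locLeft, coe_locMul, mul_assoc]

section LocTensor

variable {W : Opens (X k n q)} (N : Type u) [AddCommGroup N] [Module (O W)ᵐᵒᵖ N]

/-- The right `O(U_{I(p)})`-module `N ⊗_{O(W)} T[t_c⁻¹ | c ∈ I(p)]_d`, for `p ∈ W`. -/
abbrev TT (p : W) (d : ℤ) : Type u := BalTensor (oLoc p.1) (O W) N (loc p.1 d) (oAct p d)

variable {N}

/-- The map `N ⊗ T[t_c⁻¹ | c ∈ I(p)]_d → N ⊗ T[t_c⁻¹ | c ∈ I(p')]_d`. -/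
def TT.incl {p p' : W} (h : p.1.Generizes p'.1) (d : ℤ) : TT N p d →+ TT N p' d :=
  BalTensor.map (AddMonoidHom.id N) (locIncl h d) id (fun _ _ => rfl) (oAct_locIncl h p.2 p'.2 d)

theorem TT.incl_mk {p p' : W} (h : p.1.Generizes p'.1) (d : ℤ) (m : N) (l : loc p.1 d) :
    TT.incl h d (BalTensor.mk m l : TT N p d) = BalTensor.mk m (locIncl h d l) := rfl

/-- The map `m ⊗ l ↦ m ⊗ l l'`. -/
def TT.mul {p : W} {d e f : ℤ} (h : d + e = f) : TT N p d →+ loc p.1 e →+ TT N p f :=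
  BalTensor.lift (AddMonoidHom.mk' (fun m => AddMonoidHom.mk' (fun l =>
      AddMonoidHom.mk' (fun l' => BalTensor.mk m (locMul p.1 h l l')) fun x y => by
        rw [locMul_add_right, BalTensor.mk_add_right]) fun x y => by
      ext l'
      change BalTensor.mk m (locMul p.1 h (x + y) l') = _
      rw [locMul_add_left]
      exact BalTensor.mk_add_right _ _ _) fun x y => by
      ext l l'
      exact BalTensor.mk_add_left _ _ _) fun m s l => by
    ext l'
    change BalTensor.mk _ (locMul p.1 h l l') = BalTensor.mk m (locMul p.1 h (oAct p d s l) l')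
    rw [BalTensor.mk_smul, locMul_oAct]

theorem TT.mul_mk {p : W} {d e f : ℤ} (h : d + e = f) (m : N) (l : loc p.1 d) (l' : loc p.1 e) :
    TT.mul h (BalTensor.mk m l : TT N p d) l' = BalTensor.mk m (locMul p.1 h l l') := rfl

theorem TT.mul_mul {p : W} {d e f e' g e'' : ℤ} (h : d + e = f) (h' : f + e' = g)
    (h'' : d + e'' = g) (he : e + e' = e'') (x : TT N p d) (l : loc p.1 e) (l' : loc p.1 e') :
    TT.mul h' (TT.mul h x l) l' = TT.mul h'' x (locMul p.1 he l l') := by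
  induction x using BalTensor.induction with
  | zero => simp only [map_zero, AddMonoidHom.zero_apply]
  | add x y hx hy => simp only [map_add, AddMonoidHom.add_apply, hx, hy]
  | mk m l₀ =>
    rw [TT.mul_mk, TT.mul_mk, TT.mul_mk]
    congr 1
    refine Subtype.ext ?_
    rw [coe_locMul, coe_locMul, coe_locMul, coe_locMul, mul_assoc]

theorem TT.mul_one {p : W} {d : ℤ} (h : d + 0 = d) (x : TT N p d) :
    TT.mul h x (locOne p.1) = x := by
  induction x using BalTensor.induction with
  | zero => simp only [map_zero, AddMonoidHom.zero_apply]
  | add x y hx hy => simp only [map_add, AddMonoidHom.add_apply, hx, hy]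
  | mk m l =>
    rw [TT.mul_mk]
    congr 1
    exact Subtype.ext (_root_.mul_one _)

theorem TT.incl_incl {p p' p'' : W} (h : p.1.Generizes p'.1) (h' : p'.1.Generizes p''.1)
    (h'' : p.1.Generizes p''.1) (d : ℤ) (x : TT N p d) :
    TT.incl h' d (TT.incl h d x) = TT.incl h'' d x := by
  induction x using BalTensor.induction with
  | zero => simp only [map_zero]
  | add x y hx hy => simp only [map_add, hx, hy]
  | mk m l₀ => rw [TT.incl_mk, TT.incl_mk, TT.incl_mk, locIncl_locIncl h h' h'']

theorem TT.incl_refl {p : W} (h : p.1.Generizes p.1) (d : ℤ) (x : TT N p d) :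
    TT.incl h d x = x := by
  induction x using BalTensor.induction with
  | zero => simp only [map_zero]
  | add x y hx hy => simp only [map_add, hx, hy]
  | mk m l₀ => rw [TT.incl_mk, locIncl_refl]

theorem TT.smul_eq_mul {p : W} {d : ℤ} (h : d + 0 = d) (x : TT N p d) (c : oLoc p.1) :
    (op c : (oLoc p.1)ᵐᵒᵖ) • x = TT.mul h x (⟨c, c.2⟩ : loc p.1 0) := by
  induction x using BalTensor.induction with
  | zero => simp only [map_zero, AddMonoidHom.zero_apply, smul_zero]
  | add x y hx hy => simp only [map_add, AddMonoidHom.add_apply, smul_add, hx, hy]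
  | mk m l =>
    rw [TT.mul_mk, BalTensor.smul_mk]
    rfl

/-! ### Families modulo eventual equality -/

/-- The subgroup of sequences that vanish eventually. -/
def evZero (G : ℕ → Type u) [∀ s, AddCommGroup (G s)] : AddSubgroup (∀ s, G s) where
  carrier := {x | ∀ᶠ s in Filter.atTop, x s = 0}
  zero_mem' := Filter.Eventually.of_forall fun _ => rfl
  add_mem' := fun ha hb => by
    filter_upwards [ha, hb] with s h h'
    rw [Pi.add_apply, h, h', add_zero]
  neg_mem' := fun ha => by
    filter_upwards [ha] with s h
    rw [Pi.neg_apply, h, neg_zero]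

/-- Sequences modulo eventual equality. -/
def EvSeq (G : ℕ → Type u) [∀ s, AddCommGroup (G s)] : Type u := (∀ s, G s) ⧸ evZero G

instance (G : ℕ → Type u) [∀ s, AddCommGroup (G s)] : AddCommGroup (EvSeq G) :=
  QuotientAddGroup.Quotient.addCommGroup (evZero G)

/-- The class of a sequence. -/
def EvSeq.mk {G : ℕ → Type u} [∀ s, AddCommGroup (G s)] : (∀ s, G s) →+ EvSeq G :=
  QuotientAddGroup.mk' (evZero G)

theorem EvSeq.mk_eq_zero {G : ℕ → Type u} [∀ s, AddCommGroup (G s)] {x : ∀ s, G s} :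
    EvSeq.mk x = 0 ↔ ∀ᶠ s in Filter.atTop, x s = 0 :=
  QuotientAddGroup.eq_zero_iff x

theorem EvSeq.mk_eq {G : ℕ → Type u} [∀ s, AddCommGroup (G s)] {x y : ∀ s, G s}
    (h : ∀ᶠ s in Filter.atTop, x s = y s) : EvSeq.mk x = EvSeq.mk y := by
  rw [← sub_eq_zero, ← map_sub, EvSeq.mk_eq_zero]
  filter_upwards [h] with s hs
  rw [Pi.sub_apply, hs, sub_self]

theorem EvSeq.mk_eq_add {G : ℕ → Type u} [∀ s, AddCommGroup (G s)] {x y z : ∀ s, G s}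
    (h : ∀ᶠ s in Filter.atTop, x s = y s + z s) : EvSeq.mk x = EvSeq.mk y + EvSeq.mk z := by
  rw [← map_add]
  exact EvSeq.mk_eq h

/-- The power `t_i` clears denominators of `T[t_c⁻¹ | c ∈ I(p')]` into `T[t_c⁻¹ | c ∈ I(p)]`. -/
def Clears (i : Fin (n + 1)) (p p' : X k n q) : Prop :=
  ∀ (d : ℤ) (x : Torus k n q), x ∈ loc p' d → ∀ᶠ s : ℕ in Filter.atTop,
    x * ((tU k n q i ^ s : (Torus k n q)ˣ) : Torus k n q) ∈ loc p (d + s)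

theorem clears_pt (j i : Fin (n + 1)) (J : List (Fin (n + 1))) :
    Clears i (pt k q j J) (pt k q j (i :: J)) :=
  fun _ _ hx => eventually_mul_tU_pow_mem_loc hx

/-- Right multiplication by `t_i ^ s`. -/
def locPow (i : Fin (n + 1)) (p : X k n q) (s : ℕ) : loc p s :=
  ⟨((tU k n q i ^ s : (Torus k n q)ˣ) : Torus k n q), by
    rw [← phi_tP]; exact phi_mem_loc p (tP k q i s).2⟩

theorem coe_locPow (i : Fin (n + 1)) (p : X k n q) (s : ℕ) : (locPow i p s : Torus k n q) =
    ((tU k n q i ^ s : (Torus k n q)ˣ) : Torus k n q) := rfl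

theorem locIncl_locPow {p p' : X k n q} (h : p.Generizes p') (i : Fin (n + 1)) (s : ℕ) :
    locIncl h s (locPow i p s) = locPow i p' s := Subtype.ext (coe_locIncl _ _ _)

open Classical in
/-- The sequence `m ⊗ l t_i ^ s`, if `l t_i ^ s` has no denominators outside `I(p)`. -/
def TT.powSeq (i : Fin (n + 1)) (p p' : W) {d : ℤ} (m : N) (l : loc p'.1 d) (s : ℕ) :
    TT N p (d + s) :=
  if hl : (l : Torus k n q) * ((tU k n q i ^ s : (Torus k n q)ˣ) : Torus k n q) ∈ loc p.1 (d + s)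
    then BalTensor.mk m ⟨_, hl⟩ else 0

theorem TT.eventually_powSeq {i : Fin (n + 1)} {p p' : W} (hc : Clears i p.1 p'.1) {d : ℤ} (m : N)
    (l : loc p'.1 d) : ∀ᶠ s : ℕ in Filter.atTop, ∀ y : loc p.1 (d + s),
      (y : Torus k n q) = l * ((tU k n q i ^ s : (Torus k n q)ˣ)) →
        TT.powSeq i p p' m l s = BalTensor.mk m y := by
  filter_upwards [hc d l l.2] with s hs y hy
  rw [TT.powSeq, dif_pos hs]
  congr 1
  exact Subtype.ext hy.symm

theorem TT.powSeq_add_left {i : Fin (n + 1)} {p p' : W} (hc : Clears i p.1 p'.1) {d : ℤ}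
    (m m' : N) (l : loc p'.1 d) : EvSeq.mk (TT.powSeq i p p' (m + m') l) =
      EvSeq.mk (TT.powSeq i p p' m l) + EvSeq.mk (TT.powSeq i p p' m' l) := by
  refine EvSeq.mk_eq_add ?_
  filter_upwards [TT.eventually_powSeq hc (m + m') l, TT.eventually_powSeq hc m l,
    TT.eventually_powSeq hc m' l, hc d l l.2] with s h1 h2 h3 hs
  rw [h1 ⟨_, hs⟩ rfl, h2 ⟨_, hs⟩ rfl, h3 ⟨_, hs⟩ rfl, BalTensor.mk_add_left]

theorem TT.powSeq_add_right {i : Fin (n + 1)} {p p' : W} (hc : Clears i p.1 p'.1) {d : ℤ}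
    (m : N) (l l' : loc p'.1 d) : EvSeq.mk (TT.powSeq i p p' m (l + l')) =
      EvSeq.mk (TT.powSeq i p p' m l) + EvSeq.mk (TT.powSeq i p p' m l') := by
  refine EvSeq.mk_eq_add ?_
  filter_upwards [TT.eventually_powSeq hc m (l + l'), TT.eventually_powSeq hc m l,
    TT.eventually_powSeq hc m l', hc d l l.2, hc d l' l'.2] with s h1 h2 h3 hs hs'
  have h4 : ((⟨_, hs⟩ + ⟨_, hs'⟩ : loc p.1 (d + s)) : Torus k n q) =
      (l + l' : loc p'.1 d) * ((tU k n q i ^ s : (Torus k n q)ˣ) : Torus k n q) := by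
    rw [Submodule.coe_add, Submodule.coe_add, add_mul]
  rw [h2 ⟨_, hs⟩ rfl, h3 ⟨_, hs'⟩ rfl, h1 _ h4, BalTensor.mk_add_right]

theorem TT.powSeq_smul {i : Fin (n + 1)} {p p' : W} (hc : Clears i p.1 p'.1)
    (h : p.1.Generizes p'.1) {d : ℤ} (m : N) (s : O W) (l : loc p'.1 d) :
    EvSeq.mk (TT.powSeq i p p' ((op s : (O W)ᵐᵒᵖ) • m) l) =
      EvSeq.mk (TT.powSeq i p p' m (oAct p' d s l)) := by
  refine EvSeq.mk_eq ?_
  filter_upwards [TT.eventually_powSeq hc ((op s : (O W)ᵐᵒᵖ) • m) l,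
    TT.eventually_powSeq hc m (oAct p' d s l), hc d l l.2] with a h1 h2 hs
  rw [h1 ⟨_, hs⟩ rfl, h2 (oAct p (d + a) s ⟨_, hs⟩) ?_, BalTensor.mk_smul]
  unfold oAct
  rw [coe_locLeft, coe_locLeft, O.coe_eval, O.coe_eval, s.2.2 p p' h, mul_assoc]

/-- The map `m ⊗ l ↦ (m ⊗ l t_i ^ s)_s`. -/
def TT.pow {i : Fin (n + 1)} {p p' : W} (hc : Clears i p.1 p'.1)
    (h : p.1.Generizes p'.1) (d : ℤ) : TT N p' d →+ EvSeq fun s : ℕ => TT N p (d + s) :=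
  BalTensor.lift (AddMonoidHom.mk' (fun m => AddMonoidHom.mk'
      (fun l => EvSeq.mk (TT.powSeq i p p' m l)) (TT.powSeq_add_right hc m))
      fun m m' => AddMonoidHom.ext fun l => TT.powSeq_add_left hc m m' l)
    fun m s l => TT.powSeq_smul hc h m s l

theorem TT.pow_mk {i : Fin (n + 1)} {p p' : W} (hc : Clears i p.1 p'.1)
    (h : p.1.Generizes p'.1) {d : ℤ} (m : N) (l : loc p'.1 d) :
    TT.pow hc h d (BalTensor.mk m l : TT N p' d) = EvSeq.mk (TT.powSeq i p p' m l) := rfl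

/-- Up to large powers of `t_i`, the map `TT.pow` is a left inverse of `TT.incl`; it replaces
exactness of localisation. Sequences modulo eventual equality are needed because the power that
clears a denominator depends on the element. As a consequence, an element that dies after further
localisation is killed by all large powers of `t_i`. -/
theorem TT.pow_incl {i : Fin (n + 1)} {p p' : W} (hc : Clears i p.1 p'.1)
    (h : p.1.Generizes p'.1) {d : ℤ} (x : TT N p d) :
    TT.pow hc h d (TT.incl h d x) =
      EvSeq.mk fun s : ℕ => TT.mul (f := d + s) rfl x (locPow i p.1 s) := by
  let f : TT N p d →+ EvSeq fun s : ℕ => TT N p (d + s) :=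
    EvSeq.mk.comp (AddMonoidHom.pi fun s : ℕ =>
      (TT.mul (f := d + s) rfl : TT N p d →+ _).flip (locPow i p.1 s))
  have hf : (TT.pow hc h d).comp (TT.incl h d) = f := BalTensor.hom_ext fun m l => by
    rw [AddMonoidHom.comp_apply, TT.incl_mk, TT.pow_mk]
    refine EvSeq.mk_eq ?_
    filter_upwards [TT.eventually_powSeq hc m (locIncl h d l)] with s h1
    rw [h1 (locMul p.1 rfl l (locPow i p.1 s)) (by rw [coe_locMul, coe_locIncl, coe_locPow])]
    rfl
  exact DFunLike.congr_fun hf x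

theorem TT.eventually_mul_eq_zero {i : Fin (n + 1)} {p p' : W} (hc : Clears i p.1 p'.1)
    (h : p.1.Generizes p'.1) {d : ℤ} (x : TT N p d) (hx : TT.incl h d x = 0) :
    ∀ᶠ s : ℕ in Filter.atTop, TT.mul (f := d + s) rfl x (locPow i p.1 s) = 0 := by
  refine EvSeq.mk_eq_zero.1 ?_
  rw [← TT.pow_incl hc h, hx, map_zero]

theorem TT.eventually_exists_incl_eq {i : Fin (n + 1)} {p p' : W} (hc : Clears i p.1 p'.1)
    (h : p.1.Generizes p'.1) {d : ℤ} (y : TT N p' d) :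
    ∀ᶠ s : ℕ in Filter.atTop, ∃ x : TT N p (d + s),
      TT.incl h _ x = TT.mul rfl y (locPow i p'.1 s) := by
  induction y using BalTensor.induction with
  | zero => exact Filter.Eventually.of_forall fun s => ⟨0, by simp only [map_zero, AddMonoidHom.zero_apply]⟩
  | add y y' hy hy' =>
    filter_upwards [hy, hy'] with s ⟨x, hx⟩ ⟨x', hx'⟩
    exact ⟨x + x', by rw [map_add, map_add, AddMonoidHom.add_apply, hx, hx']⟩
  | mk m l =>
    filter_upwards [hc d l l.2] with s hs
    refine ⟨BalTensor.mk m ⟨_, hs⟩, ?_⟩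
    rw [TT.incl_mk, TT.mul_mk]
    congr 1

end LocTensor

/-! ### Sections of sheaves over the principal open sets -/

theorem X.nbhd_le {p : X k n q} {V : Opens (X k n q)} (hp : p ∈ V) : X.nbhd k n q p ≤ V :=
  fun _ h => X.Generizes.mem k n q h hp

theorem X.Generizes.trans {p p' p'' : X k n q} (h : p.Generizes p') (h' : p'.Generizes p'') :
    p.Generizes p'' := fun c hc => h' c (h c hc)

/-- Elements of `T[t_c⁻¹ | c ∈ I(p)]_0` as sections over `U_{I(p)}`. -/
def O.const (p : X k n q) : oLoc p →+* O (X.nbhd k n q p) where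
  toFun c := ⟨fun _ => c, fun p' => oLoc_mono p'.2 c.2, fun _ _ _ => rfl⟩
  map_one' := rfl
  map_mul' _ _ := rfl
  map_zero' := rfl
  map_add' _ _ := rfl

theorem O.const_eval (p : X k n q) (f : O (X.nbhd k n q p)) :
    O.const p (O.eval ⟨p, p.mem_nbhd⟩ f) = f :=
  Subtype.ext (funext fun r => f.2.2 ⟨p, p.mem_nbhd⟩ r r.2)

/-- The sections over `U_{I(p)}`. -/
abbrev OMod.st (F : OMod k n q) (p : X k n q) : Type u := F.sec (X.nbhd k n q p)

/-- The restriction of sections from `U_{I(p)}` to `U_{I(p')}`. -/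
def OMod.stRes (F : OMod k n q) {p p' : X k n q} (h : p.Generizes p') : F.st p →+ F.st p' :=
  F.res (X.nbhd_mono h)

theorem OMod.stRes_smul (F : OMod k n q) {p p' : X k n q} (h : p.Generizes p') (c : oLoc p)
    (s : F.st p) : F.stRes h (op (O.const p c) • s) = op (O.const p' (oLocIncl h c)) • F.stRes h s :=
  F.res_smul (X.nbhd_mono h) (O.const p c) s

theorem OMod.res_refl (F : OMod k n q) {V : Opens (X k n q)} (h : V ≤ V) (s : F.sec V) :
    F.res h s = s :=
  congrArg (fun g => g.hom s) (F.val.map_id (Opposite.op V))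

theorem OMod.stRes_stRes (F : OMod k n q) {p p' p'' : X k n q} (h : p.Generizes p')
    (h' : p'.Generizes p'') (h'' : p.Generizes p'') (s : F.st p) :
    F.stRes h' (F.stRes h s) = F.stRes h'' s := F.res_res _ _ s

theorem X.le_iSup_nbhd (V : Opens (X k n q)) : V ≤ ⨆ p : V, X.nbhd k n q p.1 := fun p hp =>
  Opens.mem_iSup.2 ⟨⟨p, hp⟩, p.mem_nbhd⟩

theorem OMod.ext_sec (F : OMod k n q) {V : Opens (X k n q)} {s s' : F.sec V}
    (h : ∀ p (hp : p ∈ V), F.res (X.nbhd_le hp) s = F.res (X.nbhd_le hp) s') : s = s' :=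
  TopCat.Sheaf.eq_of_locally_eq' (X := TopCat.of (X k n q)) ⟨F.val.presheaf, F.isSheaf⟩
    (fun p : V => X.nbhd k n q p.1) V (fun p => homOfLE (X.nbhd_le p.2)) (X.le_iSup_nbhd V) s s'
    fun p => h p.1 p.2

/-- The smallest neighbourhoods of the points of `V` cover `V`. On an overlap of two of them
equality is tested at its points, where both restrictions give the member of the family at that
point. -/
theorem OMod.exists_glue (F : OMod k n q) {V : Opens (X k n q)} (s : ∀ p : V, F.st p.1)
    (hs : ∀ (p p' : V) (h : p.1.Generizes p'.1), F.stRes h (s p) = s p') :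
    ∃ t : F.sec V, ∀ p : V, F.res (X.nbhd_le p.2) t = s p := by
  obtain ⟨t, ht, -⟩ := TopCat.Sheaf.existsUnique_gluing' (X := TopCat.of (X k n q))
    ⟨F.val.presheaf, F.isSheaf⟩
    (fun p : V => X.nbhd k n q p.1) V (fun p => homOfLE (X.nbhd_le p.2)) (X.le_iSup_nbhd V) s
    (fun p p' => F.ext_sec (V := X.nbhd k n q p.1 ⊓ X.nbhd k n q p'.1)
      (s := F.res inf_le_left (s p)) (s' := F.res inf_le_right (s p')) fun p'' h => by
        have hV : p'' ∈ V := X.nbhd_le p.2 h.1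
        rw [F.res_res, F.res_res]
        exact (hs p ⟨p'', hV⟩ h.1).trans (hs p' ⟨p'', hV⟩ h.2).symm)
  exact ⟨t, ht⟩

/-- The maps over `U_{I(p)}` of a morphism. -/
def OMod.stMap {F G : OMod k n q} (f : F ⟶ G) (p : X k n q) : F.st p →+ G.st p :=
  OMod.app f (X.nbhd k n q p)

theorem OMod.stMap_smul {F G : OMod k n q} (f : F ⟶ G) (p : X k n q) (c : O (X.nbhd k n q p))
    (s : F.st p) : OMod.stMap f p (op c • s) = op c • OMod.stMap f p s := OMod.app_smul f _ _ s

theorem OMod.stMap_stRes {F G : OMod k n q} (f : F ⟶ G) {p p' : X k n q} (h : p.Generizes p')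
    (s : F.st p) : OMod.stMap f p' (F.stRes h s) = G.stRes h (OMod.stMap f p s) :=
  OMod.app_res f _ s

theorem OMod.stMap_comp {F G H : OMod k n q} (f : F ⟶ G) (g : G ⟶ H) (p : X k n q) (s : F.st p) :
    OMod.stMap (f ≫ g) p s = OMod.stMap g p (OMod.stMap f p s) := rfl

theorem OMod.stMap_id {F : OMod k n q} (p : X k n q) (s : F.st p) :
    OMod.stMap (𝟙 F) p s = s := rfl

theorem OMod.hom_ext_st {F G : OMod k n q} {f g : F ⟶ G}
    (h : ∀ p s, OMod.stMap f p s = OMod.stMap g p s) : f = g := by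
  refine SheafOfModules.hom_ext (PresheafOfModules.hom_ext fun V => ModuleCat.hom_ext
    (LinearMap.ext fun s => ?_))
  refine G.ext_sec (s := OMod.app f V.unop s) (s' := OMod.app g V.unop s) fun p hp => ?_
  rw [← OMod.app_res, ← OMod.app_res]
  exact h p _

/-- The smallest neighbourhoods form a basis. Injectivity follows by separatedness, and preimages
over them glue because injectivity makes them compatible. -/
theorem OMod.app_bijective {F G : OMod k n q} {f : F ⟶ G}
    (h : ∀ p, Function.Bijective (OMod.stMap f p)) (V : Opens (X k n q)) :
    Function.Bijective (OMod.app f V) := by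
  constructor
  · intro s s' hs
    refine F.ext_sec fun p hp => (h p).1 ?_
    unfold OMod.stMap
    rw [OMod.app_res, OMod.app_res, hs]
  · intro t
    choose s hs using fun p : V => (h p.1).2 (G.res (X.nbhd_le p.2) t)
    obtain ⟨u, hu⟩ := F.exists_glue s fun p p' hp => (h p'.1).1 (by
      rw [OMod.stMap_stRes, hs, hs]
      exact G.res_res _ _ t)
    refine ⟨u, G.ext_sec fun p hp => ?_⟩
    rw [← OMod.app_res, hu ⟨p, hp⟩]
    exact hs ⟨p, hp⟩

theorem OMod.isIso_of_bijective {F G : OMod k n q} {f : F ⟶ G}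
    (h : ∀ p, Function.Bijective (OMod.stMap f p)) : IsIso f := by
  have : IsIso ((SheafOfModules.forget (oSheaf k n q)).map f) := by
    let e : F.val ≅ G.val := PresheafOfModules.isoMk
      (fun V => (LinearEquiv.ofBijective (f.val.app V).hom
        (OMod.app_bijective h V.unop)).toModuleIso) fun V V' g => f.val.naturality g
    exact ⟨e.inv, e.hom_inv_id, e.inv_hom_id⟩
  exact isIso_of_reflects_iso f (SheafOfModules.forget (oSheaf k n q))

theorem OMod.bijective_of_isIso {F G : OMod k n q} (f : F ⟶ G) [IsIso f] (p : X k n q) :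
    Function.Bijective (OMod.stMap f p) := by
  refine Function.bijective_iff_has_inverse.2 ⟨OMod.stMap (inv f) p, fun s => ?_, fun s => ?_⟩
  · rw [← OMod.stMap_comp, IsIso.hom_inv_id, OMod.stMap_id]
  · rw [← OMod.stMap_comp, IsIso.inv_hom_id, OMod.stMap_id]

/-! ### Morphisms and isomorphisms out of glued sheaves -/

namespace Diag

section

variable {W : Opens (X k n q)} (D : Diag k n q W)

/-- The restriction maps of the system are functorial. -/
def Functorial : Prop :=
  (∀ p hp (h : p.Generizes p) (m : D.obj p hp), D.res hp hp h m = m) ∧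
  ∀ {p p' p''} (hp : p ∈ W) (hp' : p' ∈ W) (hp'' : p'' ∈ W) (h : p.Generizes p')
    (h' : p'.Generizes p'') (h'' : p.Generizes p'') (m : D.obj p hp),
    D.res hp' hp'' h' (D.res hp hp' h m) = D.res hp hp'' h'' m

variable {D} in
/-- The sections over `U_{I(p)}` of the sheaf glued from `D`. -/
def evalEquiv (hD : D.Functorial) {p : X k n q} (hp : p ∈ W) :
    D.sec (X.nbhd k n q p) (X.nbhd_le hp) ≃+ D.obj p hp where
  toFun s := s.1 ⟨p, p.mem_nbhd⟩
  invFun m := ⟨fun p' => D.res hp _ p'.2 m, fun p' p'' h => hD.2 _ _ _ p'.2 h p''.2 m⟩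
  left_inv s := Subtype.ext (funext fun p' => s.2 ⟨p, p.mem_nbhd⟩ p' p'.2)
  right_inv m := hD.1 p hp p.mem_nbhd m
  map_add' _ _ := rfl

end

theorem exists_desc_sec (D : Diag k n q ⊤) (F : OMod k n q)
    (f : ∀ p, D.obj p (Opens.mem_top p) →+ F.st p)
    (hres : ∀ {p p'} (h : p.Generizes p') (m : D.obj p (Opens.mem_top p)),
      f p' (D.res (Opens.mem_top p) (Opens.mem_top p') h m) = F.stRes h (f p m)) {V : Opens (X k n q)}
    (s : D.sec V le_top) : ∃ t : F.sec V, ∀ p : V, F.res (X.nbhd_le p.2) t = f p.1 (s.1 p) :=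
  F.exists_glue (fun p => f p.1 (s.1 p)) fun p r h => by
    rw [← hres]; exact congrArg (f r.1) (s.2 p r h)

/-- The morphism of sheaves given by a compatible family of maps `D.obj p → F(U_{I(p)})`. -/
def desc (D : Diag k n q ⊤) (F : OMod k n q)
    (f : ∀ p, D.obj p (Opens.mem_top p) →+ F.st p)
    (hf : ∀ p (c : oLoc p) m, f p (op c • m) = op (O.const p c) • f p m)
    (hres : ∀ {p p'} (h : p.Generizes p') (m : D.obj p (Opens.mem_top p)),
      f p' (D.res (Opens.mem_top p) (Opens.mem_top p') h m) = F.stRes h (f p m)) : D.sheaf ⟶ F where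
  val :=
    { app := fun V => ModuleCat.ofHom (X := D.sheaf.val.obj V) (Y := F.val.obj V)
        { toFun := fun s => (D.exists_desc_sec F f hres (V := V.unop) s).choose
          map_add' := fun s s' => F.ext_sec fun p hp => by
            have h := fun s => (D.exists_desc_sec F f hres (V := V.unop) s).choose_spec ⟨p, hp⟩
            rw [map_add]
            refine (h (s + s')).trans ((map_add (f p) _ _).trans ?_)
            rw [h s, h s']
          map_smul' := fun c s => F.ext_sec fun p hp => by
            have h := fun s => (D.exists_desc_sec F f hres (V := V.unop) s).choose_spec ⟨p, hp⟩
            refine (h (c • s)).trans ?_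
            refine Eq.trans ?_ (F.res_smul (X.nbhd_le hp) (unop c) _).symm
            rw [h s]
            refine (hf p _ _).trans ?_
            congr 2
            refine Subtype.ext (funext fun p' => ?_)
            exact ((unop c : O V.unop).2.2 ⟨p, hp⟩ ⟨p'.1, X.nbhd_le hp p'.2⟩ p'.2) }
      naturality := fun {V V'} g => by
        refine ModuleCat.hom_ext (LinearMap.ext fun s => F.ext_sec
          (s := (D.exists_desc_sec F f hres (V := V'.unop) (D.secRes le_top g.unop.le s)).choose)
          (s' := F.res g.unop.le (D.exists_desc_sec F f hres (V := V.unop) s).choose)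
          fun p hp => ?_)
        have h := fun V s => (D.exists_desc_sec F f hres (V := V) s).choose_spec
        refine (h V'.unop (D.secRes le_top g.unop.le s) ⟨p, hp⟩).trans ?_
        refine Eq.trans ?_ (F.res_res g.unop.le (X.nbhd_le hp) _).symm
        exact (h V.unop s ⟨p, g.unop.le hp⟩).symm }

theorem stMap_desc (D : Diag k n q ⊤) (F : OMod k n q)
    (f : ∀ p, D.obj p (Opens.mem_top p) →+ F.st p)
    (hf : ∀ p (c : oLoc p) m, f p (op c • m) = op (O.const p c) • f p m)
    (hres : ∀ {p p'} (h : p.Generizes p') (m : D.obj p (Opens.mem_top p)),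
      f p' (D.res (Opens.mem_top p) (Opens.mem_top p') h m) = F.stRes h (f p m)) (p : X k n q)
    (s : D.sheaf.st p) :
    OMod.stMap (D.desc F f hf hres) p s =
      f p ((show D.sec (X.nbhd k n q p) le_top from s).1 ⟨p, p.mem_nbhd⟩) := by
  have h := (D.exists_desc_sec F f hres (V := X.nbhd k n q p) s).choose_spec ⟨p, p.mem_nbhd⟩
  rw [F.res_refl] at h
  exact h

end Diag

/-! ### Charts of quasicoherent modules -/

/-- Elements of degree `0` of `T[t_c⁻¹ | c ∈ I(p)]` as elements of the ring `O(U_{I(p)})`. -/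
def toO {p : X k n q} (l : loc p 0) : oLoc p := ⟨l, l.2⟩

/-- The value in `T[t_c⁻¹ | c ∈ I(p)]_0` of a section over `U_{I(p)}`. -/
def evalLoc (p : X k n q) (s : O (X.nbhd k n q p)) : loc p 0 :=
  ⟨s.1 ⟨p, p.mem_nbhd⟩, s.2.1 ⟨p, p.mem_nbhd⟩⟩

theorem const_evalLoc (p : X k n q) (s : O (X.nbhd k n q p)) :
    O.const p (toO (evalLoc p s)) = s := O.const_eval p s

theorem toO_add {p : X k n q} (l l' : loc p 0) : toO (l + l') = toO l + toO l' := rfl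

/-- The map `F(U_{I(p)}) ⊗ T[t_c⁻¹ | c ∈ I(p)]_0 → F(U_{I(p)})`. -/
def Twist.toSec (F : OMod k n q) (p : X k n q) : Twist F 0 p →+ F.st p :=
  BalTensor.lift (AddMonoidHom.mk' (fun m => AddMonoidHom.mk'
      (fun l => (op (O.const p (toO l)) : (O (X.nbhd k n q p))ᵐᵒᵖ) • m) fun l l' => by
        rw [toO_add, map_add, MulOpposite.op_add, add_smul])
      fun m m' => AddMonoidHom.ext fun _ => smul_add _ _ _)
    fun m s l => by
      change (op (O.const p (toO l)) : (O (X.nbhd k n q p))ᵐᵒᵖ) • (op s • m) = _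
      rw [← mul_smul, ← op_mul]
      congr 2
      conv_lhs => rw [← O.const_eval p s, ← map_mul]
      rfl

theorem Twist.toSec_mk (F : OMod k n q) (p : X k n q) (m : F.st p) (l : loc p 0) :
    Twist.toSec F p (BalTensor.mk m l) = (op (O.const p (toO l)) : (O (X.nbhd k n q p))ᵐᵒᵖ) • m := rfl

theorem toO_one (p : X k n q) : toO (locOne p) = 1 := rfl

theorem oAct_locOne (p : X k n q) (l : loc p 0) :
    oAct ⟨p, p.mem_nbhd⟩ 0 (O.const p (toO l)) (locOne p) = l :=
  Subtype.ext (_root_.mul_one _)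

theorem Twist.toSec_mk_one (F : OMod k n q) (p : X k n q) (m : F.st p) :
    Twist.toSec F p (BalTensor.mk m (locOne p)) = m := by
  rw [Twist.toSec_mk, toO_one, map_one, op_one, one_smul]

theorem Twist.mk_toSec (F : OMod k n q) (p : X k n q) (x : Twist F 0 p) :
    BalTensor.mk (Twist.toSec F p x) (locOne p) = x := by
  induction x using BalTensor.induction with
  | zero =>
    rw [map_zero]
    exact congrArg Submodule.Quotient.mk (TensorProduct.tmul_zero _ _)
  | add x y hx hy => rw [map_add, BalTensor.mk_add_left, hx, hy]
  | mk m l => rw [Twist.toSec_mk, BalTensor.mk_smul, oAct_locOne]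

theorem Twist.toSec_bijective (F : OMod k n q) (p : X k n q) :
    Function.Bijective (Twist.toSec F p) :=
  Function.bijective_iff_has_inverse.2 ⟨fun m => BalTensor.mk m (locOne p), Twist.mk_toSec F p,
    Twist.toSec_mk_one F p⟩

/-- Multiplication by elements of `T[t_c⁻¹ | c ∈ I(p)]_e`. -/
def Twist.mul (F : OMod k n q) (p : X k n q) {d e f : ℤ} (h : d + e = f) :
    Twist F d p →+ loc p e →+ Twist F f p :=
  TT.mul (N := F.st p) (p := ⟨p, p.mem_nbhd⟩) h

theorem Twist.mul_mk (F : OMod k n q) (p : X k n q) {d e f : ℤ} (h : d + e = f) (m : F.st p)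
    (l : loc p d) (l' : loc p e) :
    Twist.mul F p h (BalTensor.mk m l) l' = BalTensor.mk m (locMul p h l l') := rfl

theorem Twist.mul_mul (F : OMod k n q) (p : X k n q) {d e f e' g e'' : ℤ} (h : d + e = f)
    (h' : f + e' = g) (h'' : d + e'' = g) (he : e + e' = e'') (x : Twist F d p) (l : loc p e)
    (l' : loc p e') : Twist.mul F p h' (Twist.mul F p h x l) l' =
      Twist.mul F p h'' x (locMul p he l l') := TT.mul_mul (p := ⟨p, p.mem_nbhd⟩) h h' h'' he x l l'

theorem Twist.mul_one (F : OMod k n q) (p : X k n q) {d : ℤ} (h : d + 0 = d) (x : Twist F d p) :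
    Twist.mul F p h x (locOne p) = x := TT.mul_one (p := ⟨p, p.mem_nbhd⟩) h x

theorem Twist.toSec_mul (F : OMod k n q) (p : X k n q) (h : (0 : ℤ) + 0 = 0) (x : Twist F 0 p)
    (l : loc p 0) : Twist.toSec F p (Twist.mul F p h x l) =
      (op (O.const p (toO l)) : (O (X.nbhd k n q p))ᵐᵒᵖ) • Twist.toSec F p x := by
  induction x using BalTensor.induction with
  | zero => simp only [map_zero, AddMonoidHom.zero_apply, smul_zero]
  | add x y hx hy => simp only [map_add, AddMonoidHom.add_apply, smul_add, hx, hy]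
  | mk m l₀ =>
    rw [Twist.mul_mk, Twist.toSec_mk, Twist.toSec_mk, ← mul_smul, ← op_mul, ← map_mul]
    rfl

theorem Twist.res_mul (F : OMod k n q) {p p' : X k n q} (h : p.Generizes p') {d e f : ℤ}
    (hd : d + e = f) (x : Twist F d p) (l : loc p e) :
    Twist.res F f h (Twist.mul F p hd x l) =
      Twist.mul F p' hd (Twist.res F d h x) (locIncl h e l) := by
  induction x using BalTensor.induction with
  | zero => simp only [map_zero, AddMonoidHom.zero_apply]
  | add x y hx hy => simp only [map_add, AddMonoidHom.add_apply, hx, hy]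
  | mk m l₀ => rw [Twist.mul_mk, Twist.res_mk, Twist.res_mk, Twist.mul_mk, locIncl_locMul]

theorem Twist.toSec_res (F : OMod k n q) {p p' : X k n q} (h : p.Generizes p') (x : Twist F 0 p) :
    Twist.toSec F p' (Twist.res F 0 h x) = F.stRes h (Twist.toSec F p x) := by
  induction x using BalTensor.induction with
  | zero => simp only [map_zero]
  | add x y hx hy => simp only [map_add, hx, hy]
  | mk m l =>
    rw [Twist.res_mk, Twist.toSec_mk, Twist.toSec_mk, F.stRes_smul]
    rfl

theorem Twist.res_res (F : OMod k n q) {p p' p'' : X k n q} (h : p.Generizes p')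
    (h' : p'.Generizes p'') (h'' : p.Generizes p'') {d : ℤ} (x : Twist F d p) :
    Twist.res F d h' (Twist.res F d h x) = Twist.res F d h'' x := by
  induction x using BalTensor.induction with
  | zero => simp only [map_zero]
  | add x y hx hy => simp only [map_add, hx, hy]
  | mk m l =>
    rw [Twist.res_mk, Twist.res_mk, Twist.res_mk, locIncl_locIncl h h' h'', F.res_res]

theorem Twist.res_refl (F : OMod k n q) {p : X k n q} (h : p.Generizes p) {d : ℤ}
    (x : Twist F d p) : Twist.res F d h x = x := by
  induction x using BalTensor.induction with
  | zero => simp only [map_zero]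
  | add x y hx hy => simp only [map_add, hx, hy]
  | mk m l => rw [Twist.res_mk, locIncl_refl, F.res_refl]

/-- An element of `T_e` as an element of `T[t_c⁻¹ | c ∈ I(p)]_e`. -/
def phiLoc (p : X k n q) {e : ℕ} (t : TPiece k n q e) : loc p e := ⟨phi k n q t, phi_mem_loc p t.2⟩

theorem Twist.mulT_eq (F : OMod k n q) (p : X k n q) {d f : ℤ} (e : ℕ) (h : d + e = f)
    (t : TPiece k n q e) (x : Twist F d p) :
    Twist.mulT F p e h t x = Twist.mul F p h x (phiLoc p t) := by
  induction x using BalTensor.induction with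
  | zero => simp only [map_zero, AddMonoidHom.zero_apply]
  | add x y hx hy => simp only [map_add, AddMonoidHom.add_apply, hx, hy]
  | mk m l => rfl

theorem phiLoc_tP (p : X k n q) (i : Fin (n + 1)) (s : ℕ) :
    phiLoc p (tP k q i s) = locPow i p s := Subtype.ext (phi_tP i s)

/-- The module `F(U_{I(p)}) ⊗ T[t_c⁻¹ | c ∈ I(p')]_d`, where `I(p) ⊆ I(p')`. -/
abbrev Mix (F : OMod k n q) {p p' : X k n q} (h : p.Generizes p') (d : ℤ) : Type u :=
  TT (W := X.nbhd k n q p) (F.st p) ⟨p', h⟩ d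

/-- The map `F(U_{I(p)}) ⊗ T[t_c⁻¹ | c ∈ I(p')]_d → F(U_{I(p')}) ⊗ T[t_c⁻¹ | c ∈ I(p')]_d`. -/
def Mix.toTwist (F : OMod k n q) {p p' : X k n q} (h : p.Generizes p') (d : ℤ) :
    Mix F h d →+ Twist F d p' :=
  BalTensor.map (F.stRes h) (AddMonoidHom.id _) (O.res (X.nbhd_mono h))
    (fun s m => F.res_smul (X.nbhd_mono h) s m) fun _ _ => rfl

theorem Mix.toTwist_mk (F : OMod k n q) {p p' : X k n q} (h : p.Generizes p') (d : ℤ) (m : F.st p)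
    (l : loc p' d) : Mix.toTwist F h d (BalTensor.mk m l) = BalTensor.mk (F.stRes h m) l := rfl

theorem Mix.toTwist_mul (F : OMod k n q) {p p' : X k n q} (h : p.Generizes p') {d e f : ℤ}
    (hd : d + e = f) (x : Mix F h d) (l : loc p' e) :
    Mix.toTwist F h f (TT.mul hd x l) = Twist.mul F p' hd (Mix.toTwist F h d x) l := by
  induction x using BalTensor.induction with
  | zero => simp only [map_zero, AddMonoidHom.zero_apply]
  | add x y hx hy => simp only [map_add, AddMonoidHom.add_apply, hx, hy]
  | mk m l₀ => rw [TT.mul_mk, Mix.toTwist_mk, Mix.toTwist_mk, Twist.mul_mk]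

theorem Mix.toTwist_incl (F : OMod k n q) {p p₁ p₂ : X k n q} (h₁ : p.Generizes p₁)
    (h₂ : p.Generizes p₂) (h : p₁.Generizes p₂) (d : ℤ) (x : Mix F h₁ d) :
    Mix.toTwist F h₂ d (TT.incl (p := ⟨p₁, h₁⟩) (p' := ⟨p₂, h₂⟩) h d x) =
      Twist.res F d h (Mix.toTwist F h₁ d x) := by
  induction x using BalTensor.induction with
  | zero => simp only [map_zero]
  | add x y hx hy => simp only [map_add, hx, hy]
  | mk m l =>
    rw [TT.incl_mk, Mix.toTwist_mk, Mix.toTwist_mk, Twist.res_mk]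
    congr 1
    exact (F.stRes_stRes h₁ h h₂ m).symm

/-- The map `F(U_{I(p)}) ⊗ O(U_{I(p')}) → F(U_{I(p')})`. -/
def Mix.toSec (F : OMod k n q) {p p' : X k n q} (h : p.Generizes p') : Mix F h 0 →+ F.st p' :=
  (Twist.toSec F p').comp (Mix.toTwist F h 0)

theorem Mix.toSec_mk (F : OMod k n q) {p p' : X k n q} (h : p.Generizes p') (m : F.st p)
    (l : loc p' 0) : Mix.toSec F h (BalTensor.mk m l) =
      (op (O.const p' (toO l)) : (O (X.nbhd k n q p'))ᵐᵒᵖ) • F.stRes h m := rfl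

theorem Mix.toSec_mul (F : OMod k n q) {p p' : X k n q} (h : p.Generizes p')
    (h0 : (0 : ℤ) + 0 = 0) (x : Mix F h 0) (l : loc p' 0) : Mix.toSec F h (TT.mul h0 x l) =
      (op (O.const p' (toO l)) : (O (X.nbhd k n q p'))ᵐᵒᵖ) • Mix.toSec F h x := by
  unfold Mix.toSec
  rw [AddMonoidHom.comp_apply, AddMonoidHom.comp_apply, Mix.toTwist_mul, Twist.toSec_mul]

/-- The restriction of `F` to `U_{I(p)}` is the sheaf associated with `F(U_{I(p)})`. -/
def IsChart (F : OMod k n q) (p : X k n q) : Prop :=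
  ∀ (p' : X k n q) (h : p.Generizes p'), Function.Bijective (Mix.toSec F h)

/-- Multiplication by elements of `T[t_c⁻¹ | c ∈ I(p')]_e`. -/
def Mix.mul (F : OMod k n q) {p p' : X k n q} (h : p.Generizes p') {d e f : ℤ} (hd : d + e = f) :
    Mix F h d →+ loc p' e →+ Mix F h f :=
  TT.mul (N := F.st p) (p := ⟨p', h⟩) hd

theorem Mix.mul_mul (F : OMod k n q) {p p' : X k n q} (h : p.Generizes p') {d e f e' g e'' : ℤ}
    (h₁ : d + e = f) (h₂ : f + e' = g) (h₃ : d + e'' = g) (he : e + e' = e'') (x : Mix F h d)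
    (l : loc p' e) (l' : loc p' e') : Mix.mul F h h₂ (Mix.mul F h h₁ x l) l' =
      Mix.mul F h h₃ x (locMul p' he l l') := TT.mul_mul (p := ⟨p', h⟩) h₁ h₂ h₃ he x l l'

theorem Mix.mul_mk (F : OMod k n q) {p p' : X k n q} (h : p.Generizes p') {d e f : ℤ}
    (hd : d + e = f) (m : F.st p) (l : loc p' d) (l' : loc p' e) :
    Mix.mul F h hd (BalTensor.mk m l) l' = BalTensor.mk m (locMul p' hd l l') := rfl

/-- The map `F(U_{I(p')}) ⊗ T[t_c⁻¹ | c ∈ I(p')]_d → F(U_{I(p)}) ⊗ T[t_c⁻¹ | c ∈ I(p')]_d` given by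
a linear map on sections. -/
def Mix.ofTwist {F : OMod k n q} {p p' : X k n q} (h : p.Generizes p') (d : ℤ)
    (E : F.st p' →+ Mix F h 0) (hE : ∀ (y : F.st p') (s : O (X.nbhd k n q p')), E (op s • y) =
      Mix.mul F h (zero_add 0) (E y) (evalLoc p' s)) : Twist F d p' →+ Mix F h d :=
  BalTensor.lift ((Mix.mul F h (zero_add d)).comp E) fun y s l => by
    rw [AddMonoidHom.comp_apply, AddMonoidHom.comp_apply, hE,
      Mix.mul_mul F h _ _ (zero_add d) (zero_add d)]
    rfl

theorem Mix.ofTwist_mk {F : OMod k n q} {p p' : X k n q} (h : p.Generizes p') (d : ℤ)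
    (E : F.st p' →+ Mix F h 0) (hE : ∀ (y : F.st p') (s : O (X.nbhd k n q p')), E (op s • y) =
      Mix.mul F h (zero_add 0) (E y) (evalLoc p' s)) (m : F.st p') (l : loc p' d) :
    Mix.ofTwist h d E hE (BalTensor.mk m l) = Mix.mul F h (zero_add d) (E m) l := rfl

/-- `IsChart` concerns degree `0` only. In degree `d` the element `y ⊗ l` is sent to the image of
`y` under the inverse in degree `0`, multiplied by `l`; this is balanced because that inverse is
linear over `O(U_{I(p')})`. -/
theorem IsChart.exists_leftInverse {F : OMod k n q} {p : X k n q} (hF : IsChart F p)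
    {p' : X k n q} (h : p.Generizes p') (d : ℤ) :
    ∃ g : Twist F d p' →+ Mix F h d, (∀ x, g (Mix.toTwist F h d x) = x) := by
  let E : Mix F h 0 ≃+ F.st p' := AddEquiv.ofBijective (Mix.toSec F h) (hF _ h)
  have hE : ∀ (y : F.st p') (s : O (X.nbhd k n q p')), E.symm.toAddMonoidHom (op s • y) =
      Mix.mul F h (zero_add 0) (E.symm.toAddMonoidHom y) (evalLoc p' s) := by
    intro y s
    apply E.injective
    refine (E.apply_symm_apply _).trans ?_
    refine Eq.trans ?_ (Mix.toSec_mul F h _ _ _).symm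
    have : Mix.toSec F h (E.symm y) = y := E.apply_symm_apply y
    refine Eq.trans ?_ (congrArg _ this.symm)
    rw [const_evalLoc]
  refine ⟨Mix.ofTwist h d E.symm.toAddMonoidHom hE, fun x => ?_⟩
  induction x using BalTensor.induction with
  | zero => rw [map_zero, map_zero]
  | add x y hx hy => rw [map_add, map_add, hx, hy]
  | mk m l =>
    rw [Mix.toTwist_mk, Mix.ofTwist_mk]
    have : E.symm.toAddMonoidHom (F.stRes h m) = BalTensor.mk m (locOne p') := by
      apply E.injective
      refine (E.apply_symm_apply _).trans ?_
      refine Eq.trans ?_ (Mix.toSec_mk F h _ _).symm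
      rw [toO_one, map_one, op_one, one_smul]
    rw [this, Mix.mul_mk]
    congr 1
    exact Subtype.ext (_root_.one_mul _)

theorem IsChart.toTwist_bijective {F : OMod k n q} {p : X k n q} (hF : IsChart F p)
    {p' : X k n q} (h : p.Generizes p') (d : ℤ) : Function.Bijective (Mix.toTwist F h d) := by
  constructor
  · obtain ⟨g, hg⟩ := hF.exists_leftInverse h d
    exact Function.LeftInverse.injective hg
  · intro y
    induction y using BalTensor.induction with
    | zero => exact ⟨0, map_zero _⟩
    | add y y' hy hy' =>
      obtain ⟨⟨x, rfl⟩, ⟨x', rfl⟩⟩ := And.intro hy hy'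
      exact ⟨x + x', map_add _ _ _⟩
    | mk m l =>
      obtain ⟨z, hz⟩ := (hF _ h).2 m
      refine ⟨TT.mul (zero_add d) z l, ?_⟩
      rw [Mix.toTwist_mul]
      have : Mix.toTwist F h 0 z = BalTensor.mk m (locOne p') := by
        rw [← hz]; exact (Twist.mk_toSec F p' _).symm
      rw [this, Twist.mul_mk]
      congr 1
      exact Subtype.ext (_root_.one_mul _)

/-- On a chart all twisted sections come from the single module `F(U_{I(p)})`. Restriction then
changes only the localisation of `T`, for which denominators can be cleared. -/
theorem IsChart.eventually_mul_eq_zero {F : OMod k n q} {p : X k n q} (hF : IsChart F p)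
    {i : Fin (n + 1)} {p₁ p₂ : X k n q} (h₁ : p.Generizes p₁) (h : p₁.Generizes p₂)
    (hc : Clears i p₁ p₂) {d : ℤ} {x : Twist F d p₁} (hx : Twist.res F d h x = 0) :
    ∀ᶠ s : ℕ in Filter.atTop, Twist.mul F p₁ (f := d + s) rfl x (locPow i p₁ s) = 0 := by
  obtain ⟨z, rfl⟩ := (hF.toTwist_bijective h₁ d).2 x
  rw [← Mix.toTwist_incl F h₁ (h₁.trans h)] at hx
  have := (hF.toTwist_bijective (h₁.trans h) d).1 (hx.trans (map_zero _).symm)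
  filter_upwards [TT.eventually_mul_eq_zero (p := ⟨p₁, h₁⟩) (p' := ⟨p₂, h₁.trans h⟩) hc h z this]
    with s hs
  rw [← Mix.toTwist_mul, hs, map_zero]

theorem IsChart.eventually_exists_res_eq {F : OMod k n q} {p : X k n q} (hF : IsChart F p)
    {i : Fin (n + 1)} {p₁ p₂ : X k n q} (h₁ : p.Generizes p₁) (h : p₁.Generizes p₂)
    (hc : Clears i p₁ p₂) {d : ℤ} (y : Twist F d p₂) :
    ∀ᶠ s : ℕ in Filter.atTop, ∃ x : Twist F (d + s) p₁,
      Twist.res F (d + s) h x = Twist.mul F p₂ rfl y (locPow i p₂ s) := by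
  obtain ⟨z, rfl⟩ := (hF.toTwist_bijective (h₁.trans h) d).2 y
  filter_upwards [TT.eventually_exists_incl_eq (p := ⟨p₁, h₁⟩) (p' := ⟨p₂, h₁.trans h⟩) hc h z]
    with s ⟨x, hx⟩
  refine ⟨Mix.toTwist F h₁ _ x, ?_⟩
  rw [← Mix.toTwist_incl F h₁ (h₁.trans h), hx, ← Mix.toTwist_mul]

theorem IsChart.induction {F : OMod k n q} {p : X k n q} (hF : IsChart F p) {p' : X k n q}
    (h : p.Generizes p') {P : F.st p' → Prop} (zero : P 0) (add : ∀ x y, P x → P y → P (x + y))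
    (smul : ∀ (c : oLoc p') (m : F.st p), P (op (O.const p' c) • F.stRes h m)) (y : F.st p') :
    P y := by
  obtain ⟨x, rfl⟩ := (hF _ h).2 y
  induction x using BalTensor.induction with
  | zero => rw [map_zero]; exact zero
  | add x y hx hy => rw [map_add]; exact add _ _ hx hy
  | mk m l => exact smul (toO l) m

/-- On a chart `F(U_{I(p')})` is the base change of `F(U_{I(p)})`, so semilinear maps out of the
latter extend. -/
theorem IsChart.exists_extend {F : OMod k n q} {p : X k n q} (hF : IsChart F p) {p' : X k n q}
    (h : p.Generizes p') {G : OMod k n q} (u : F.st p →+ G.st p')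
    (hu : ∀ (c : oLoc p) m, u (op (O.const p c) • m) = op (O.const p' (oLocIncl h c)) • u m) :
    ∃ v : F.st p' →+ G.st p', ∀ (c : oLoc p') (m : F.st p),
      v (op (O.const p' c) • F.stRes h m) = op (O.const p' c) • u m := by
  let E : Mix F h 0 ≃+ F.st p' := AddEquiv.ofBijective (Mix.toSec F h) (hF _ h)
  let w : Mix F h 0 →+ G.st p' := BalTensor.lift (AddMonoidHom.mk' (fun m => AddMonoidHom.mk'
      (fun l => (op (O.const p' (toO l)) : (O (X.nbhd k n q p'))ᵐᵒᵖ) • u m) fun l l' => by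
        rw [toO_add, map_add, MulOpposite.op_add, add_smul]) fun m m' => AddMonoidHom.ext fun _ => by
          rw [map_add]; exact smul_add _ _ _) fun m s l => by
      change (op (O.const p' (toO (p := p') l)) : (O (X.nbhd k n q p'))ᵐᵒᵖ) • u (op s • m) =
        (op (O.const p' (toO (p := p') _)) : (O (X.nbhd k n q p'))ᵐᵒᵖ) • u m
      conv_lhs => rw [← O.const_eval p s, hu, ← mul_smul, ← op_mul, ← map_mul]
      congr 3
      refine Subtype.ext ?_
      change (O.eval _ s : Torus k n q) * l = (O.eval _ s : Torus k n q) * l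
      rw [O.coe_eval, O.coe_eval, s.2.2 ⟨p, p.mem_nbhd⟩ ⟨p', h⟩ h]
  refine ⟨w.comp E.symm.toAddMonoidHom, fun c m => ?_⟩
  have : E.symm (op (O.const p' c) • F.stRes h m) = BalTensor.mk m (⟨c, c.2⟩ : loc p' 0) := by
    apply E.injective
    rw [E.apply_symm_apply]
    exact (Mix.toSec_mk F h _ _).symm
  change w (E.symm _) = _
  rw [this]
  rfl

/-- The inverse over `U_{I(p)}` extends to `U_{I(p')}` by base change. That it is inverse to `f`
there need only be tested on the generators, which are restrictions from `U_{I(p)}`. -/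
theorem IsChart.stMap_bijective {F G : OMod k n q} {p : X k n q} (hF : IsChart F p)
    (hG : IsChart G p) {f : F ⟶ G} (hf : Function.Bijective (OMod.stMap f p)) {p' : X k n q}
    (h : p.Generizes p') : Function.Bijective (OMod.stMap f p') := by
  let E : F.st p ≃+ G.st p := AddEquiv.ofBijective (OMod.stMap f p) hf
  have hE : ∀ m, OMod.stMap f p (E.symm m) = m := E.apply_symm_apply
  have hE' : ∀ m, E.symm (OMod.stMap f p m) = m := E.symm_apply_apply
  obtain ⟨v, hv⟩ := hG.exists_extend h ((F.stRes h).comp E.symm.toAddMonoidHom) fun c m => by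
    change F.stRes h (E.symm _) = _ • F.stRes h (E.symm m)
    rw [← F.stRes_smul]
    congr 1
    apply hf.1
    rw [hE, OMod.stMap_smul, hE]
  refine Function.bijective_iff_has_inverse.2 ⟨v, fun x => ?_, fun y => ?_⟩
  · refine hF.induction h (P := fun x => v (OMod.stMap f p' x) = x) (by rw [map_zero, map_zero])
      (fun x y hx hy => by rw [map_add, map_add, hx, hy]) (fun c m => ?_) x
    rw [OMod.stMap_smul, OMod.stMap_stRes, hv]
    exact congrArg (fun m => op (O.const p' c) • F.stRes h m) (hE' m)
  · refine hG.induction h (P := fun x => OMod.stMap f p' (v x) = x) (by rw [map_zero, map_zero])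
      (fun x y hx hy => by rw [map_add, map_add, hx, hy]) (fun c m => ?_) y
    rw [hv, OMod.stMap_smul]
    change op (O.const p' c) • OMod.stMap f p' (F.stRes h (E.symm m)) = _
    rw [OMod.stMap_stRes, hE]

theorem exists_inv (p : X k n q) : ∃ i, p.Inv (.t i) := by
  by_contra! h
  exact p.2.2.2 fun i => not_not.1 (h i)

theorem exists_pt_generizes (p : X k n q) : ∃ i, (pt k q i []).Generizes p := by
  obtain ⟨i, hi⟩ := exists_inv p
  exact ⟨i, pt_generizes fun c hc => by rw [List.mem_singleton.1 hc]; exact hi⟩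

/-- Every point lies in some `U_i`, whose sections over smaller neighbourhoods come from those at
`pt i []` by base change. -/
theorem isIso_of_bijective_pt {F G : OMod k n q} (hF : ∀ i, IsChart F (pt k q i []))
    (hG : ∀ i, IsChart G (pt k q i [])) {f : F ⟶ G}
    (hf : ∀ i, Function.Bijective (OMod.stMap f (pt k q i []))) : IsIso f :=
  OMod.isIso_of_bijective fun p =>
    let ⟨i, hi⟩ := exists_pt_generizes p
    (hF i).stMap_bijective (hG i) (hf i) hi

theorem hom_ext_pt {F G : OMod k n q} (hF : ∀ i, IsChart F (pt k q i [])) {f g : F ⟶ G}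
    (h : ∀ i x, OMod.stMap f (pt k q i []) x = OMod.stMap g (pt k q i []) x) : f = g := by
  refine OMod.hom_ext_st fun p s => ?_
  obtain ⟨i, hi⟩ := exists_pt_generizes p
  refine (hF i).induction hi (P := fun s => OMod.stMap f p s = OMod.stMap g p s)
    (by rw [map_zero, map_zero]) (fun x y hx hy => by rw [map_add, map_add, hx, hy])
    (fun c m => ?_) s
  rw [OMod.stMap_smul, OMod.stMap_smul, OMod.stMap_stRes, OMod.stMap_stRes, h i]

/-! ### Quasicoherence and coherence in terms of charts -/

/-- Among the points where `t_i` does not vanish, `pt i []` is the one that generizes to all others.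
-/
theorem U_eq_nbhd (i : Fin (n + 1)) : U k n q (.t i) = X.nbhd k n q (pt k q i []) := by
  refine le_antisymm (fun p hp => ?_) fun p hp => ?_
  · refine pt_generizes fun c hc => ?_
    rw [List.mem_singleton.1 hc]
    exact hp
  · exact hp _ (pt_inv (List.mem_singleton.2 rfl))

section TildeIso

variable {W : Opens (X k n q)} {N : Type u} [AddCommGroup N] [Module (O W)ᵐᵒᵖ N]

theorem tilde_functorial : (tilde W N).Functorial :=
  ⟨fun p hp h m => TT.incl_refl (p := ⟨p, hp⟩) h 0 m, fun {p p' p''} hp hp' hp'' h h' h'' m =>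
    TT.incl_incl (p := ⟨p, hp⟩) (p' := ⟨p', hp'⟩) (p'' := ⟨p'', hp''⟩) h h' h'' 0 m⟩

variable {F : OMod k n q} (e : TildeIso F W N)

/-- The isomorphism over `U_{I(p)}`. -/
def TildeIso.at {p : X k n q} (hp : p ∈ W) : F.st p ≃+ TT N ⟨p, hp⟩ 0 :=
  (e.equiv (X.nbhd k n q p) (X.nbhd_le hp)).trans (Diag.evalEquiv tilde_functorial hp)

theorem TildeIso.at_smul {p : X k n q} (hp : p ∈ W) (c : oLoc p) (s : F.st p) :
    e.at hp (op (O.const p c) • s) = (op c : (oLoc p)ᵐᵒᵖ) • e.at hp s := by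
  change (e.equiv _ _ _).1 ⟨p, p.mem_nbhd⟩ = _
  rw [e.equiv_smul]
  rfl

theorem TildeIso.at_stRes {p p' : X k n q} (hp : p ∈ W) (hp' : p' ∈ W) (h : p.Generizes p')
    (s : F.st p) : e.at hp' (F.stRes h s) =
      TT.incl (p := ⟨p, hp⟩) (p' := ⟨p', hp'⟩) h 0 (e.at hp s) := by
  change (e.equiv _ _ (F.res _ s)).1 ⟨p', p'.mem_nbhd⟩ = _
  rw [e.equiv_res _ _ (X.nbhd_le hp)]
  exact ((e.equiv _ (X.nbhd_le hp) s).2 ⟨p, p.mem_nbhd⟩ ⟨p', h⟩ h).symm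

/-- The map `N → F(U_{I(p)})`. -/
def TildeIso.toSt {p : X k n q} (hp : p ∈ W) : N →+ F.st p :=
  (e.at hp).symm.toAddMonoidHom.comp
    (AddMonoidHom.mk' (fun m => BalTensor.mk m (locOne p)) fun m m' => BalTensor.mk_add_left m m' _)

theorem TildeIso.at_toSt {p : X k n q} (hp : p ∈ W) (m : N) :
    e.at hp (e.toSt hp m) = BalTensor.mk m (locOne p) := (e.at hp).apply_symm_apply _

theorem TildeIso.smul_toSt {p : X k n q} (hp : p ∈ W) (m : N) (c : oLoc p) :
    op (O.const p c) • e.toSt hp m = (e.at hp).symm (BalTensor.mk m (⟨c, c.2⟩ : loc p 0)) := by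
  apply (e.at hp).injective
  rw [AddEquiv.apply_symm_apply, e.at_smul, e.at_toSt, BalTensor.smul_mk]
  congr 1
  exact Subtype.ext (_root_.one_mul _)

theorem TildeIso.toSt_smul {p : X k n q} (hp : p ∈ W) (m : N) (f : O W) :
    e.toSt hp ((op f : (O W)ᵐᵒᵖ) • m) = op (O.const p (O.eval ⟨p, hp⟩ f)) • e.toSt hp m := by
  rw [e.smul_toSt]
  refine congrArg (e.at hp).symm ((BalTensor.mk_smul _ _ _).trans ?_)
  congr 1
  exact Subtype.ext (_root_.mul_one _)

theorem TildeIso.stRes_toSt {p p' : X k n q} (hp : p ∈ W) (hp' : p' ∈ W) (h : p.Generizes p')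
    (m : N) : F.stRes h (e.toSt hp m) = e.toSt hp' m := by
  apply (e.at hp').injective
  rw [e.at_stRes hp, e.at_toSt, e.at_toSt]
  rfl

/-- The map `N ⊗ O(U_{I(p')}) → F(U_{I(p)}) ⊗ O(U_{I(p')})`. -/
def TildeIso.toMix {p p' : X k n q} (hp : p ∈ W) (hp' : p' ∈ W) (h : p.Generizes p') :
    TT N ⟨p', hp'⟩ 0 →+ Mix F h 0 :=
  BalTensor.map (e.toSt hp) (AddMonoidHom.id _) (O.res (X.nbhd_le hp))
    (fun f m => by
      rw [e.toSt_smul]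
      congr 2
      exact O.const_eval p (O.res (X.nbhd_le hp) f))
    fun _ _ => rfl

theorem TildeIso.toMix_mk {p p' : X k n q} (hp : p ∈ W) (hp' : p' ∈ W) (h : p.Generizes p')
    (m : N) (l : loc p' 0) :
    e.toMix hp hp' h (BalTensor.mk m l) = BalTensor.mk (e.toSt hp m) l := rfl

theorem TildeIso.toMix_mul {p p' : X k n q} (hp : p ∈ W) (hp' : p' ∈ W) (h : p.Generizes p')
    (h0 : (0 : ℤ) + 0 = 0) (x : TT N ⟨p', hp'⟩ 0) (l : loc p' 0) :
    e.toMix hp hp' h (TT.mul h0 x l) = Mix.mul F h h0 (e.toMix hp hp' h x) l := by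
  induction x using BalTensor.induction with
  | zero => simp only [map_zero, AddMonoidHom.zero_apply]
  | add x y hx hy => simp only [map_add, AddMonoidHom.add_apply, hx, hy]
  | mk m l₀ => rw [TT.mul_mk, e.toMix_mk, e.toMix_mk, Mix.mul_mk]

theorem TildeIso.toMix_incl {p p' : X k n q} (hp : p ∈ W) (hp' : p' ∈ W) (h : p.Generizes p')
    (x : TT N ⟨p, hp⟩ 0) :
    e.toMix hp hp' h (TT.incl (p := ⟨p, hp⟩) (p' := ⟨p', hp'⟩) h 0 x) =
      BalTensor.mk ((e.at hp).symm x) (locOne p') := by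
  induction x using BalTensor.induction with
  | zero =>
    simp only [map_zero]
    exact (congrArg Submodule.Quotient.mk (TensorProduct.tmul_zero _ _)).symm
  | add x y hx hy => rw [map_add, map_add, map_add, BalTensor.mk_add_left, hx, hy]
  | mk m l =>
    rw [TT.incl_mk, e.toMix_mk]
    have := e.smul_toSt hp m (toO l)
    refine Eq.trans ?_ (congrArg (fun y => BalTensor.mk y (locOne p')) this)
    rw [BalTensor.mk_smul]
    congr 1
    exact Subtype.ext (_root_.mul_one _).symm

theorem TildeIso.toSec_toMix {p p' : X k n q} (hp : p ∈ W) (hp' : p' ∈ W) (h : p.Generizes p')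
    (x : TT N ⟨p', hp'⟩ 0) : Mix.toSec F h (e.toMix hp hp' h x) = (e.at hp').symm x := by
  induction x using BalTensor.induction with
  | zero => simp only [map_zero]
  | add x y hx hy => rw [map_add, map_add, map_add, hx, hy]
  | mk m l =>
    rw [e.toMix_mk, Mix.toSec_mk, e.stRes_toSt hp hp', e.smul_toSt]
    rfl

theorem TildeIso.toMix_at_toSec {p p' : X k n q} (hp : p ∈ W) (hp' : p' ∈ W) (h : p.Generizes p')
    (x : Mix F h 0) : e.toMix hp hp' h (e.at hp' (Mix.toSec F h x)) = x := by
  induction x using BalTensor.induction with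
  | zero => simp only [map_zero]
  | add x y hx hy => rw [map_add, map_add, map_add, hx, hy]
  | mk m l =>
    rw [Mix.toSec_mk, e.at_smul, e.at_stRes hp,
      TT.smul_eq_mul (p := ⟨p', hp'⟩) (add_zero 0), e.toMix_mul hp hp' h, e.toMix_incl,
      AddEquiv.symm_apply_apply, Mix.mul_mk]
    congr 1
    exact Subtype.ext (_root_.one_mul _)

/-- Here `F(U_{I(p)}) ⊗ O(U_{I(p')})` is `N ⊗ O(U_{I(p)}) ⊗ O(U_{I(p')})`, which collapses to `N ⊗
O(U_{I(p')})`. The map `TildeIso.toMix` realises the collapse backwards. -/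
theorem TildeIso.isChart (e : TildeIso F W N) {p : X k n q} (hp : p ∈ W) : IsChart F p :=
  fun p' h =>
    have hp' : p' ∈ W := X.nbhd_le hp h
    ⟨Function.LeftInverse.injective (g := fun y => e.toMix hp hp' h (e.at hp' y))
      (e.toMix_at_toSec hp hp' h), fun y => ⟨e.toMix hp hp' h (e.at hp' y), by
        rw [e.toSec_toMix, AddEquiv.symm_apply_apply]⟩⟩

end TildeIso

namespace IsChart

variable {F : OMod k n q} {p : X k n q} (hF : IsChart F p)

/-- The isomorphism `F(U_{I(p)}) ⊗ O(U_{I(p')}) ≃ F(U_{I(p')})`. -/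
def equiv {p' : X k n q} (h : p.Generizes p') : Mix F h 0 ≃+ F.st p' :=
  AddEquiv.ofBijective (Mix.toSec F h) (hF p' h)

theorem equiv_incl {p₁ p₂ : X k n q} (h₁ : p.Generizes p₁) (h₂ : p.Generizes p₂)
    (h : p₁.Generizes p₂) (x : Mix F h₁ 0) :
    hF.equiv h₂ (TT.incl (p := ⟨p₁, h₁⟩) (p' := ⟨p₂, h₂⟩) h 0 x) = F.stRes h (hF.equiv h₁ x) := by
  change Twist.toSec F p₂ (Mix.toTwist F h₂ 0 _) = F.stRes h (Twist.toSec F p₁ _)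
  rw [Mix.toTwist_incl F h₁ h₂ h, Twist.toSec_res]

theorem equiv_smul {p' : X k n q} (h : p.Generizes p') (c : oLoc p') (x : Mix F h 0) :
    hF.equiv h ((op c : (oLoc p')ᵐᵒᵖ) • x) = op (O.const p' c) • hF.equiv h x := by
  have := TT.smul_eq_mul (p := ⟨p', h⟩) (add_zero 0) x c
  exact (congrArg (hF.equiv h) this).trans (Mix.toSec_mul F h (add_zero 0) x _)

/-- The map `F(V) → Ñ(V)`, where `N = F(U_{I(p)})`. -/
def toTilde (V : Opens (X k n q)) (hV : V ≤ X.nbhd k n q p) :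
    F.sec V →+ (tilde (X.nbhd k n q p) (F.st p)).sec V hV where
  toFun s := ⟨fun p' => (hF.equiv (hV p'.2)).symm (F.res (X.nbhd_le p'.2) s), fun p₁ p₂ h => by
    apply (hF.equiv (hV p₂.2)).injective
    refine (hF.equiv_incl (hV p₁.2) (hV p₂.2) h _).trans ?_
    rw [AddEquiv.apply_symm_apply, AddEquiv.apply_symm_apply]
    exact F.res_res _ _ s⟩
  map_zero' := Subtype.ext (funext fun p' => (congrArg (hF.equiv (hV p'.2)).symm
    (map_zero (F.res (X.nbhd_le p'.2)))).trans (map_zero _))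
  map_add' s s' := Subtype.ext (funext fun p' => (congrArg (hF.equiv (hV p'.2)).symm
    (map_add (F.res (X.nbhd_le p'.2)) s s')).trans (map_add _ _ _))

theorem toTilde_apply {V : Opens (X k n q)} (hV : V ≤ X.nbhd k n q p) (s : F.sec V) (p' : V) :
    (hF.toTilde V hV s).1 p' = (hF.equiv (hV p'.2)).symm (F.res (X.nbhd_le p'.2) s) := rfl

theorem toTilde_bijective (V : Opens (X k n q)) (hV : V ≤ X.nbhd k n q p) :
    Function.Bijective (hF.toTilde V hV) := by
  constructor
  · intro s s' hs
    refine F.ext_sec fun p' hp' => ?_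
    exact (hF.equiv (hV hp')).symm.injective (congrArg
      (fun t : (tilde (X.nbhd k n q p) (F.st p)).sec V hV => t.1 ⟨p', hp'⟩) hs)
  · intro t
    obtain ⟨s, hs⟩ := F.exists_glue (V := V) (fun p' => hF.equiv (hV p'.2) (t.1 p'))
      fun p₁ p₂ h => by
        exact (hF.equiv_incl (hV p₁.2) (hV p₂.2) h _).symm.trans
          (congrArg (hF.equiv (hV p₂.2)) (t.2 p₁ p₂ h))
    refine ⟨s, Subtype.ext (funext fun p' => ?_)⟩
    rw [toTilde_apply, hs p']
    exact AddEquiv.symm_apply_apply _ _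

/-- The isomorphism of `F|_{U_{I(p)}}` with `Ñ`, where `N = F(U_{I(p)})`. -/
def tildeIso : TildeIso F (X.nbhd k n q p) (F.st p) where
  equiv V hV := AddEquiv.ofBijective (hF.toTilde V hV) (hF.toTilde_bijective V hV)
  equiv_smul V hV f s := Subtype.ext (funext fun p' => by
    apply (hF.equiv (hV p'.2)).injective
    refine (AddEquiv.apply_symm_apply _ _).trans ?_
    refine Eq.trans ?_ (hF.equiv_smul (hV p'.2) (O.eval p' f) _).symm
    refine Eq.trans ?_ (congrArg _ (AddEquiv.apply_symm_apply _ _).symm)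
    rw [F.res_smul]
    congr 2
    exact (O.const_eval p'.1 (O.res (X.nbhd_le p'.2) f)).symm)
  equiv_res V V' hV h s := Subtype.ext (funext fun p' =>
    congrArg (hF.equiv (hV (h p'.2))).symm (F.res_res _ _ s))

end IsChart

/-- The chart condition no longer mentions `N`: if any `N` works for `U_i`, then so does the module
of sections over `U_i`. -/
theorem quasicoherent_iff {F : OMod k n q} :
    quasicoherent k n q F ↔ ∀ i, IsChart F (pt k q i []) := by
  refine forall_congr' fun i => ?_
  rw [U_eq_nbhd]
  exact ⟨fun ⟨_, _, _, ⟨e⟩⟩ => e.isChart (pt k q i []).mem_nbhd,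
    fun h => ⟨_, _, _, ⟨h.tildeIso⟩⟩⟩

theorem TildeIso.finite {F : OMod k n q} {p : X k n q} {N : Type u} [AddCommGroup N]
    [Module (O (X.nbhd k n q p))ᵐᵒᵖ N] [Module.Finite (O (X.nbhd k n q p))ᵐᵒᵖ N]
    (e : TildeIso F (X.nbhd k n q p) N) : Module.Finite (O (X.nbhd k n q p))ᵐᵒᵖ (F.st p) := by
  let g : N →ₗ[(O (X.nbhd k n q p))ᵐᵒᵖ] F.st p :=
    { toFun := e.toSt p.mem_nbhd
      map_add' := map_add _
      map_smul' := fun f m => by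
        refine (e.toSt_smul p.mem_nbhd m (unop f)).trans ?_
        rw [O.const_eval]
        rfl }
  refine Module.Finite.of_surjective g fun y => ?_
  obtain ⟨x, rfl⟩ := (e.at p.mem_nbhd).symm.surjective y
  induction x using BalTensor.induction with
  | zero => exact ⟨0, by rw [map_zero, map_zero]⟩
  | add x y hx hy =>
    obtain ⟨⟨x', hx⟩, ⟨y', hy⟩⟩ := And.intro hx hy
    exact ⟨x' + y', by rw [map_add, map_add, hx, hy]⟩
  | mk m l =>
    refine ⟨(op (O.const p (toO l)) : (O (X.nbhd k n q p))ᵐᵒᵖ) • m, ?_⟩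
    rw [map_smul]
    exact e.smul_toSt p.mem_nbhd m (toO l)

theorem coherent_iff {F : OMod k n q} :
    coherent k n q F ↔ ∀ i, IsChart F (pt k q i []) ∧
      Module.Finite (O (X.nbhd k n q (pt k q i [])))ᵐᵒᵖ (F.st (pt k q i [])) := by
  refine forall_congr' fun i => ?_
  rw [U_eq_nbhd]
  refine ⟨fun ⟨N, _, _, hN, ⟨e⟩⟩ => ⟨e.isChart (pt k q i []).mem_nbhd, e.finite⟩,
    fun h => ⟨_, _, _, h.2, ⟨h.1.tildeIso⟩⟩⟩

/-! ### Localisations of graded modules -/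

namespace modLoc

variable {M : GrMod k n q} {p : X k n q}

theorem mk_add_left {d : ℤ} (m m' : M.comp d) (l : loc p (-d)) :
    (mk (m + m') l : modLoc M p) = mk m l + mk m' l :=
  congrArg Submodule.Quotient.mk ((congrArg (DirectSum.of (LocTensor M p) d)
    (TensorProduct.tmul_add l m m')).trans (map_add (DirectSum.of (LocTensor M p) d) _ _))

/-- The map `m ↦ m ⊗ l`. -/
def mkHom {d : ℤ} (l : loc p (-d)) : M.comp d →+ modLoc M p :=
  AddMonoidHom.mk' (fun m => mk m l) fun m m' => mk_add_left m m' l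

theorem mk_zero_left {d : ℤ} (l : loc p (-d)) : (mk 0 l : modLoc M p) = 0 := map_zero (mkHom l)

theorem mk_act {d f : ℤ} (e : ℕ) (h : d + e = f) (m : M.comp d) (t : TPiece k n q e)
    (l : loc p (-f)) : (mk (M.act e h m t) l : modLoc M p) = mk m (tMulLoc p e h t l) :=
  (Submodule.Quotient.eq _).2 (Submodule.subset_span ⟨d, f, e, h, m, t, l, rfl⟩)

theorem smul_mem_locRel (c : (oLoc p)ᵐᵒᵖ) {x : ⨁ d : ℤ, LocTensor M p d} (hx : x ∈ locRel M p) :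
    c • x ∈ locRel M p := by
  obtain ⟨d, f, e, h, m, t, l, rfl⟩ := hx
  refine ⟨d, f, e, h, m, t, c • l, ?_⟩
  rw [smul_sub, ← DirectSum.of_smul, ← DirectSum.of_smul]
  congr 2
  refine congrArg (fun l' => LocTensor.mk m l') (Subtype.ext ?_)
  rw [coe_op_smul_loc, coe_tMulLoc, coe_tMulLoc, coe_op_smul_loc, mul_assoc]

/-- The additive map out of the direct sum given by a family of biadditive maps. -/
def sumLift {G : Type*} [AddCommGroup G] (f : ∀ d, M.comp d →+ loc p (-d) →+ G) :
    (⨁ d : ℤ, LocTensor M p d) →+ G :=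
  DirectSum.toAddMonoid fun d => (TensorProduct.liftAddHom (f d).flip fun r l m => by simp :
    loc p (-d) ⊗[ℤ] M.comp d →+ G)

theorem sumLift_of {G : Type*} [AddCommGroup G] (f : ∀ d, M.comp d →+ loc p (-d) →+ G) {d : ℤ}
    (m : M.comp d) (l : loc p (-d)) :
    sumLift f (DirectSum.of (LocTensor M p) d (.mk m l)) = f d m l :=
  (DirectSum.toAddMonoid_of _ _ _).trans rfl

/-- The additive map out of `M[t_c⁻¹ | c ∈ I(p)]_0` given by a balanced family of biadditive maps. -/
def lift {G : Type*} [AddCommGroup G] (f : ∀ d, M.comp d →+ loc p (-d) →+ G)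
    (hf : ∀ (d f' : ℤ) (e : ℕ) (h : d + e = f') (m : M.comp d) (t : TPiece k n q e)
      (l : loc p (-f')), f f' (M.act e h m t) l = f d m (tMulLoc p e h t l)) : modLoc M p →+ G :=
  QuotientAddGroup.lift (Submodule.span (oLoc p)ᵐᵒᵖ (locRel M p)).toAddSubgroup (sumLift f)
    fun a ha => by
      refine Submodule.closure_induction (p := fun a _ => sumLift f a = 0) ?_ ?_ ?_ ha
      · exact map_zero _
      · intro x y _ _ hx hy; rw [map_add, hx, hy, add_zero]
      · intro c x hx
        obtain ⟨d, f', e, h, m, t, l, hx⟩ := smul_mem_locRel c hx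
        rw [hx, map_sub, sumLift_of, sumLift_of, hf, sub_self]

theorem lift_mk {G : Type*} [AddCommGroup G] (f : ∀ d, M.comp d →+ loc p (-d) →+ G)
    (hf : ∀ (d f' : ℤ) (e : ℕ) (h : d + e = f') (m : M.comp d) (t : TPiece k n q e)
      (l : loc p (-f')), f f' (M.act e h m t) l = f d m (tMulLoc p e h t l)) {d : ℤ} (m : M.comp d)
    (l : loc p (-d)) : lift f hf (mk m l) = f d m l := sumLift_of f m l

theorem mk_tP {i : Fin (n + 1)} (hp : p.Inv (.t i)) {d f : ℤ} (s : ℕ) (h : d + s = f)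
    (m : M.comp d) : (mk (M.act s h m (tP k q i s)) (tz hp (-f)) : modLoc M p) =
      mk m (tz hp (-d)) := by
  rw [mk_act]
  congr 1
  refine Subtype.ext ?_
  rw [coe_tMulLoc, phi_tP, coe_tz, coe_tz, ← Units.val_mul, ← zpow_natCast, ← zpow_add]
  congr 2
  omega

end modLoc

theorem inv_pt (i : Fin (n + 1)) : (pt k q i []).Inv (.t i) := pt_inv (List.mem_singleton.2 rfl)

namespace modLoc

variable {M : GrMod k n q} {i : Fin (n + 1)}

/-- Common denominators: for large `s` the element `l t_i ^ s` comes from `T` and is absorbed into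
the numerator, and two numerators are brought to the same degree by powers of `t_i`. -/
theorem exists_eq_mk (x : modLoc M (pt k q i [])) :
    ∃ (d : ℤ) (m : M.comp d), x = mk m (tz (inv_pt i) (-d)) := by
  induction x using modLoc.induction with
  | zero => exact ⟨0, 0, (mk_zero_left _).symm⟩
  | add x y hx hy =>
    obtain ⟨d, m, rfl⟩ := hx
    obtain ⟨e, m', rfl⟩ := hy
    obtain ⟨s, hs⟩ : ∃ s : ℕ, (s : ℤ) = max d e - d := ⟨(max d e - d).toNat, by omega⟩
    obtain ⟨s', hs'⟩ : ∃ s : ℕ, (s : ℤ) = max d e - e := ⟨(max d e - e).toNat, by omega⟩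
    refine ⟨max d e, M.act s (by omega) m (tP k q i s) + M.act s' (by omega) m' (tP k q i s'), ?_⟩
    rw [mk_add_left, mk_tP, mk_tP]
  | @mk d m l =>
    obtain ⟨s, hs, hsd⟩ := ((eventually_mul_tU_pow_mem_phi l.2).and
      (Filter.eventually_ge_atTop d.toNat)).exists
    obtain ⟨e, he⟩ : ∃ e : ℕ, (e : ℤ) = -d + s := ⟨(-d + s).toNat, by omega⟩
    obtain ⟨r, hr, hr'⟩ := hs e he
    refine ⟨s, M.act e (by omega) m ⟨r, hr⟩, ?_⟩
    rw [mk_act]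
    congr 1
    refine Subtype.ext ?_
    rw [coe_tMulLoc, coe_tz]
    change _ = phi k n q r * _
    rw [hr', mul_assoc, ← Units.val_mul, ← zpow_natCast, ← zpow_add, add_neg_cancel, zpow_zero,
      Units.val_one, mul_one]

open Classical in
/-- The sequence `(m l t_i ^ s)_s`, where defined. -/
def powSeq {d : ℤ} (m : M.comp d) (l : loc (pt k q i []) (-d)) (s : ℕ) : M.comp s :=
  if h : ∃ (e : ℕ) (_ : d + e = s) (r : TPiece k n q e),
      phi k n q r = l * ((tU k n q i ^ s : (Torus k n q)ˣ) : Torus k n q) then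
    M.act h.choose h.choose_spec.choose m h.choose_spec.choose_spec.choose
  else 0

theorem powSeq_eq {d : ℤ} (m : M.comp d) (l : loc (pt k q i []) (-d)) {s e : ℕ} (h : d + e = s)
    (r : TPiece k n q e)
    (hr : phi k n q r = l * ((tU k n q i ^ s : (Torus k n q)ˣ) : Torus k n q)) :
    powSeq m l s = M.act e h m r := by
  have h' : ∃ (e : ℕ) (_ : d + e = s) (r : TPiece k n q e),
      phi k n q r = l * ((tU k n q i ^ s : (Torus k n q)ˣ) : Torus k n q) := ⟨e, h, r, hr⟩
  rw [powSeq, dif_pos h']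
  exact GrMod.act_congr _ _ _ _ _
    (phi_injective (h'.choose_spec.choose_spec.choose_spec.trans hr.symm))

theorem eventually_exists_powSeq {d : ℤ} (l : loc (pt k q i []) (-d)) :
    ∀ᶠ s : ℕ in Filter.atTop, ∃ (e : ℕ) (_ : d + e = s) (r : TPiece k n q e),
      phi k n q r = l * ((tU k n q i ^ s : (Torus k n q)ˣ) : Torus k n q) := by
  filter_upwards [eventually_mul_tU_pow_mem_phi l.2, Filter.eventually_ge_atTop d.toNat]
    with s hs hsd
  obtain ⟨e, he⟩ : ∃ e : ℕ, (e : ℤ) = -d + s := ⟨(-d + s).toNat, by omega⟩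
  obtain ⟨r, hr, hr'⟩ := hs e he
  exact ⟨e, by omega, ⟨r, hr⟩, hr'⟩

/-- The biadditive map `(m, l) ↦ (m l t_i ^ s)_s`. -/
def powHom (M : GrMod k n q) (i : Fin (n + 1)) (d : ℤ) :
    M.comp d →+ loc (pt k q i []) (-d) →+ EvSeq fun s : ℕ => M.comp s :=
  AddMonoidHom.mk' (fun m => AddMonoidHom.mk' (fun l => EvSeq.mk (powSeq m l))
    fun l l' => EvSeq.mk_eq_add (by
      filter_upwards [eventually_exists_powSeq l, eventually_exists_powSeq l']
        with s ⟨e, h, r, hr⟩ ⟨e', h', r', hr'⟩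
      obtain rfl : e = e' := by omega
      rw [powSeq_eq m l h r hr, powSeq_eq m l' h r' hr', powSeq_eq m (l + l') h (r + r'), map_add]
      rw [Submodule.coe_add, Submodule.coe_add, map_add, hr, hr', add_mul]))
    fun m m' => AddMonoidHom.ext fun l => EvSeq.mk_eq_add (by
      filter_upwards [eventually_exists_powSeq l] with s ⟨e, h, r, hr⟩
      rw [powSeq_eq m l h r hr, powSeq_eq m' l h r hr, powSeq_eq (m + m') l h r hr, map_add,
        AddMonoidHom.add_apply])

/-- The map `m ⊗ l ↦ (m l t_i ^ s)_s`. -/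
def pow (M : GrMod k n q) (i : Fin (n + 1)) :
    modLoc M (pt k q i []) →+ EvSeq fun s : ℕ => M.comp s :=
  lift (powHom M i) fun d f e h m t l => EvSeq.mk_eq (by
    filter_upwards [eventually_exists_powSeq l] with s ⟨e', h', r, hr⟩
    rw [powSeq_eq _ l h' r hr, powSeq_eq m (tMulLoc _ e h t l) (by push_cast; omega)
      ⟨t * r, mul_mem_TPiece t.2 r.2⟩, M.act_act]
    rw [map_mul, hr, coe_tMulLoc, mul_assoc])

theorem pow_mk {d : ℤ} (m : M.comp d) (l : loc (pt k q i []) (-d)) :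
    pow M i (mk m l) = EvSeq.mk (powSeq m l) := lift_mk (powHom M i) _ m l

/-- The map `pow` sends the fraction `m t_i ^ (-d)` to the sequence of the products `m t_i ^ (s -
d)`, and a zero class means that these vanish eventually. -/
theorem exists_act_tP_eq_zero {d : ℤ} {m : M.comp d}
    (h : (mk m (tz (inv_pt i) (-d)) : modLoc M (pt k q i [])) = 0) :
    ∃ s : ℕ, M.act s rfl m (tP k q i s) = 0 := by
  have h' := congrArg (pow M i) h
  rw [pow_mk, map_zero, EvSeq.mk_eq_zero] at h'
  obtain ⟨s, hs, hsd⟩ := (h'.and (Filter.eventually_ge_atTop d.toNat)).exists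
  obtain ⟨e, he⟩ : ∃ e : ℕ, d + (e : ℤ) = s := ⟨(-d + s).toNat, by omega⟩
  refine ⟨e, ?_⟩
  rw [powSeq_eq m _ he (tP k q i e)] at hs
  -- The two vanishing statements live in the degrees `s` and `d + e`, which are equal only
  -- propositionally.
  · generalize_proofs hx
    revert hs
    generalize (s : ℤ) = f at he
    subst he
    exact id
  · rw [phi_tP, coe_tz, ← Units.val_mul, ← zpow_natCast, ← zpow_natCast, ← zpow_add]
    congr 2
    omega

theorem mk_eq_zero {d f : ℤ} {m : M.comp d} {s : ℕ} (hf : d + s = f)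
    (h : M.act s hf m (tP k q i s) = 0) :
    (mk m (tz (inv_pt i) (-d)) : modLoc M (pt k q i [])) = 0 := by
  rw [← mk_tP (inv_pt i) s hf, h, mk_zero_left]

end modLoc

/-! ### Morphisms with torsion kernel and cokernel -/

theorem GrMod.TorsionMod.exists_act_tP_mem {M : GrMod k n q} {P : ∀ d, AddSubgroup (M.comp d)}
    {d : ℤ} {m : M.comp d} (h : M.TorsionMod P m) (i : Fin (n + 1)) :
    ∃ s : ℕ, M.act s rfl m (tP k q i s) ∈ P _ := by
  obtain ⟨s, hs⟩ := h
  exact ⟨s, hs s rfl _ (tP_mem_TPlus_pow i s)⟩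

/-- Powers of `t_i` lie in powers of `T_+`, so they detect torsion, and elements of the localisation
are single fractions with denominator a power of `t_i`. -/
theorem modLocMap_bijective_of_isoModTors {M N : GrMod k n q} {f : M ⟶ N}
    (hf : isoModTors k n q f) (i : Fin (n + 1)) :
    Function.Bijective (modLocMap f (.refl (pt k q i []))) := by
  constructor
  · refine (injective_iff_map_eq_zero _).2 fun x hx => ?_
    obtain ⟨d, m, rfl⟩ := modLoc.exists_eq_mk x
    rw [modLocMap_mk, locIncl_refl] at hx
    obtain ⟨s, hs⟩ := modLoc.exists_act_tP_eq_zero hx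
    rw [← f.app_act] at hs
    obtain ⟨s', hs'⟩ := (hf.1 _ _ hs).exists_act_tP_mem i
    rw [← modLoc.mk_tP (inv_pt i) s rfl]
    exact modLoc.mk_eq_zero rfl hs'
  · intro y
    obtain ⟨d, m, rfl⟩ := modLoc.exists_eq_mk y
    obtain ⟨s, m', hs⟩ := (hf.2 d m).exists_act_tP_mem i
    refine ⟨modLoc.mk m' (tz (inv_pt i) _), ?_⟩
    rw [modLocMap_mk, locIncl_refl, hs, modLoc.mk_tP]

/-- Bijectivity on the `i`-th chart yields an exponent for `t_i` only. The exponents for all `i` are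
combined into one power of `T_+` by `GrMod.torsionMod_of_forall`. -/
theorem isoModTors_of_modLocMap_bijective [NeZero n] {M N : GrMod k n q} {f : M ⟶ N}
    (hf : ∀ i, Function.Bijective (modLocMap f (.refl (pt k q i [])))) : isoModTors k n q f := by
  constructor
  · intro d m hm
    refine GrMod.torsionMod_of_forall (P := fun _ => ⊥) ?_ m fun i => ?_
    · intro d f e h m r hm
      rw [AddSubgroup.mem_bot] at hm ⊢
      rw [hm, map_zero, AddMonoidHom.zero_apply]
    · refine modLoc.exists_act_tP_eq_zero ((hf i).1 ?_)
      rw [modLocMap_mk, hm, modLoc.mk_zero_left, map_zero]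
  · intro d m
    refine GrMod.torsionMod_of_forall (P := fun e => (f.app e).range) ?_ m fun i => ?_
    · rintro d f' e h _ r ⟨m, rfl⟩
      exact ⟨M.act e h m r, f.app_act e h m r⟩
    · obtain ⟨x, hx⟩ := (hf i).2 (modLoc.mk m (tz (inv_pt i) (-d)))
      obtain ⟨e, m', rfl⟩ := modLoc.exists_eq_mk x
      rw [modLocMap_mk, locIncl_refl] at hx
      obtain ⟨s, hs⟩ : ∃ s : ℕ, d + (s : ℤ) = max d e := ⟨(max d e - d).toNat, by omega⟩
      obtain ⟨s', hs'⟩ : ∃ s : ℕ, e + (s : ℤ) = max d e := ⟨(max d e - e).toNat, by omega⟩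
      -- The preimage and `m` are brought to the common degree `max d e`. The difference vanishes in
      -- the localisation, so a power of `t_i` moves `m` into the range of `f`.
      have h0 : (modLoc.mk (f.app _ (M.act s' hs' m' (tP k q i s')) - N.act s hs m (tP k q i s))
          (tz (inv_pt i) (-(max d e))) : modLoc N (pt k q i [])) = 0 := by
        change modLoc.mkHom _ _ = _
        rw [map_sub]
        change modLoc.mk _ _ - modLoc.mk _ _ = _
        rw [f.app_act, modLoc.mk_tP, modLoc.mk_tP, hx, sub_self]
      obtain ⟨u, hu⟩ := modLoc.exists_act_tP_eq_zero h0
      rw [map_sub, AddMonoidHom.sub_apply, sub_eq_zero, ← f.app_act] at hu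
      refine ⟨s + u, ?_⟩
      have hd : d + ((s + u : ℕ) : ℤ) = max d e + u := by push_cast; omega
      rw [GrMod.act_act_eq hs rfl hd m _ _ (tP k q i (s + u)) (tP_mul i s u)] at hu
      have hu' : N.act (s + u) hd m (tP k q i (s + u)) ∈ (f.app _).range := ⟨_, hu⟩
      clear hu
      generalize max d e + (u : ℤ) = g at hd hu'
      subst hd
      exact hu'

/-! ### The sheaf `𝛑 M` -/

theorem modLocMap_id_refl {M : GrMod k n q} {p : X k n q} (h : p.Generizes p) (x : modLoc M p) :
    modLocMap (𝟙 M) h x = x := by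
  induction x using modLoc.induction with
  | zero => rw [map_zero]
  | add x y hx hy => rw [map_add, hx, hy]
  | mk m l => rw [modLocMap_mk, locIncl_refl]; rfl

theorem modLocMap_id_comp {M : GrMod k n q} {p p' p'' : X k n q} (h : p.Generizes p')
    (h' : p'.Generizes p'') (h'' : p.Generizes p'') (x : modLoc M p) :
    modLocMap (𝟙 M) h' (modLocMap (𝟙 M) h x) = modLocMap (𝟙 M) h'' x := by
  induction x using modLoc.induction with
  | zero => simp only [map_zero]
  | add x y hx hy => simp only [map_add, hx, hy]
  | mk m l => rw [modLocMap_mk, modLocMap_mk, modLocMap_mk, locIncl_locIncl h h' h'']; rfl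

theorem piDiag_functorial (M : GrMod k n q) : (piDiag M).Functorial :=
  ⟨fun _ _ h m => modLocMap_id_refl h m, fun _ _ _ f g h m => modLocMap_id_comp f g h m⟩

/-- The sections of `𝛑 M` over `U_{I(p)}`. -/
def piSt (M : GrMod k n q) (p : X k n q) : ((bpi k n q).obj M).st p ≃+ modLoc M p :=
  Diag.evalEquiv (piDiag_functorial M) (Opens.mem_top p)

theorem piSt_smul (M : GrMod k n q) (p : X k n q) (c : oLoc p) (s : ((bpi k n q).obj M).st p) :
    piSt M p (op (O.const p c) • s) = (op c : (oLoc p)ᵐᵒᵖ) • piSt M p s := rfl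

theorem piSt_symm_smul (M : GrMod k n q) (p : X k n q) (c : oLoc p) (x : modLoc M p) :
    (piSt M p).symm ((op c : (oLoc p)ᵐᵒᵖ) • x) = op (O.const p c) • (piSt M p).symm x := by
  apply (piSt M p).injective
  rw [piSt_smul, AddEquiv.apply_symm_apply, AddEquiv.apply_symm_apply]

theorem piSt_stRes (M : GrMod k n q) {p p' : X k n q} (h : p.Generizes p')
    (s : ((bpi k n q).obj M).st p) :
    piSt M p' (((bpi k n q).obj M).stRes h s) = modLocMap (𝟙 M) h (piSt M p s) :=
  ((show (piDiag M).sec (X.nbhd k n q p) le_top from s).2 ⟨p, p.mem_nbhd⟩ ⟨p', h⟩ h).symm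

theorem piSt_stMap {M N : GrMod k n q} (f : M ⟶ N) (p : X k n q)
    (s : ((bpi k n q).obj M).st p) :
    piSt N p (OMod.stMap ((bpi k n q).map f) p s) = modLocMap f (.refl p) (piSt M p s) := rfl

theorem stMap_bpi_bijective_iff {M N : GrMod k n q} (f : M ⟶ N) (p : X k n q) :
    Function.Bijective (OMod.stMap ((bpi k n q).map f) p) ↔
      Function.Bijective (modLocMap f (.refl p)) := by
  have : modLocMap f (.refl p) ∘ piSt M p = piSt N p ∘ OMod.stMap ((bpi k n q).map f) p :=
    funext fun s => (piSt_stMap f p s).symm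
  rw [← Function.Bijective.of_comp_iff _ (piSt M p).bijective, this,
    Function.Bijective.of_comp_iff' (piSt N p).bijective]

/-- The section `m ⊗ l` of `𝛑 M` over `U_{I(p)}`. -/
def piMk {M : GrMod k n q} {p : X k n q} {d : ℤ} (m : M.comp d) (l : loc p (-d)) :
    ((bpi k n q).obj M).st p := (piSt M p).symm (modLoc.mk m l)

theorem piMk_add_left {M : GrMod k n q} {p : X k n q} {d : ℤ} (m m' : M.comp d) (l : loc p (-d)) :
    piMk (m + m') l = piMk m l + piMk m' l := by
  unfold piMk; rw [modLoc.mk_add_left, map_add]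

theorem piMk_act {M : GrMod k n q} {p : X k n q} {d f : ℤ} (e : ℕ) (h : d + e = f) (m : M.comp d)
    (t : TPiece k n q e) (l : loc p (-f)) :
    piMk (M.act e h m t) l = piMk m (tMulLoc p e h t l) := by
  unfold piMk; rw [modLoc.mk_act]

theorem piSt_piMk {M : GrMod k n q} {p : X k n q} {d : ℤ} (m : M.comp d) (l : loc p (-d)) :
    piSt M p (piMk m l) = modLoc.mk m l := (piSt M p).apply_symm_apply _

theorem smul_piMk {M : GrMod k n q} {p : X k n q} {d : ℤ} (m : M.comp d) (l l' : loc p (-d))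
    (c : oLoc p) (h : (l * c : Torus k n q) = l') :
    op (O.const p c) • piMk m l = piMk m l' := by
  unfold piMk
  rw [← piSt_symm_smul, modLoc.smul_mk]
  congr 2
  exact Subtype.ext h

theorem stRes_piMk {M : GrMod k n q} {p p' : X k n q} (h : p.Generizes p') {d : ℤ} (m : M.comp d)
    (l : loc p (-d)) : ((bpi k n q).obj M).stRes h (piMk m l) = piMk m (locIncl h _ l) := by
  apply (piSt M p').injective
  rw [piSt_stRes, piSt_piMk, piSt_piMk, modLocMap_mk]
  rfl

theorem stMap_piMk {M N : GrMod k n q} (f : M ⟶ N) {p : X k n q} {d : ℤ} (m : M.comp d)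
    (l : loc p (-d)) : OMod.stMap ((bpi k n q).map f) p (piMk m l) = piMk (f.app d m) l := by
  apply (piSt N p).injective
  rw [piSt_stMap, piSt_piMk, piSt_piMk, modLocMap_mk, locIncl_refl]

theorem piMk_induction {M : GrMod k n q} {p : X k n q} {P : ((bpi k n q).obj M).st p → Prop}
    (zero : P 0) (add : ∀ x y, P x → P y → P (x + y))
    (mk : ∀ {d : ℤ} (m : M.comp d) (l : loc p (-d)), P (piMk m l))
    (x : ((bpi k n q).obj M).st p) : P x := by
  obtain ⟨x, rfl⟩ := (piSt M p).symm.surjective x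
  induction x using modLoc.induction with
  | zero => rw [map_zero]; exact zero
  | add x y hx hy => rw [map_add]; exact add _ _ hx hy
  | mk m l => exact mk m l

/-- A factor `c` of degree `0` can be moved across the tensor sign. -/
theorem mk_piMk_eq {M : GrMod k n q} {p p' : X k n q} (h : p.Generizes p')
    {d e : ℤ} (m : M.comp d) (l₁ l₂ : loc p (-d)) (l₁' l₂' : loc p' e) (c : oLoc p)
    (h₁ : (l₁ * c : Torus k n q) = l₂) (h₂ : (c * l₂' : Torus k n q) = l₁') :
    (BalTensor.mk (piMk m l₂) l₂' : Mix ((bpi k n q).obj M) h e) = BalTensor.mk (piMk m l₁) l₁' := by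
  rw [← smul_piMk m l₁ l₂ c h₁, BalTensor.mk_smul]
  congr 1
  exact Subtype.ext h₂

/-- The biadditive map `(m, l) ↦ (m ⊗ t_i ^ (-d)) ⊗ t_i ^ d l`. -/
def piMixHom (M : GrMod k n q) {i : Fin (n + 1)} {p p' : X k n q} (h : p.Generizes p')
    (hp : p.Inv (.t i)) (d : ℤ) : M.comp d →+ loc p' (-d) →+ Mix ((bpi k n q).obj M) h 0 :=
  AddMonoidHom.mk' (fun m => AddMonoidHom.mk' (fun l => BalTensor.mk (piMk m (tz hp (-d)))
    (locMul p' (add_neg_cancel d) (tz (h _ hp) d) l)) fun l l' => by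
      rw [map_add, BalTensor.mk_add_right]) fun m m' => AddMonoidHom.ext fun l =>
        (congrArg (fun y => BalTensor.mk y _) (piMk_add_left m m' _)).trans
          (BalTensor.mk_add_left _ _ _)

theorem piMixHom_apply (M : GrMod k n q) {i : Fin (n + 1)} {p p' : X k n q} (h : p.Generizes p')
    (hp : p.Inv (.t i)) {d : ℤ} (m : M.comp d) (l : loc p' (-d)) : piMixHom M h hp d m l =
      BalTensor.mk (piMk m (tz hp (-d))) (locMul p' (add_neg_cancel d) (tz (h _ hp) d) l) := rfl

theorem tz_mul_mem_oLoc {p : X k n q} {i : Fin (n + 1)} (hp : p.Inv (.t i)) {d : ℤ}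
    (l : loc p (-d)) : ((tU k n q i ^ d : (Torus k n q)ˣ) : Torus k n q) * l ∈ oLoc p := by
  have := mul_mem_loc (tU_zpow_mem_loc hp d) l.2
  rwa [add_neg_cancel] at this

theorem tz_neg_mul {p : X k n q} {i : Fin (n + 1)} (hp : p.Inv (.t i)) (d : ℤ)
    (x : Torus k n q) :
    (tz hp (-d) : Torus k n q) * (((tU k n q i ^ d : (Torus k n q)ˣ) : Torus k n q) * x) = x := by
  rw [coe_tz, ← mul_assoc, ← Units.val_mul, ← zpow_add, neg_add_cancel, zpow_zero, Units.val_one,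
    one_mul]

/-- The inverse of the map `(𝛑 M)(U_{I(p)}) ⊗ O(U_{I(p')}) → (𝛑 M)(U_{I(p')})`. -/
def piMix (M : GrMod k n q) {i : Fin (n + 1)} {p p' : X k n q} (h : p.Generizes p')
    (hp : p.Inv (.t i)) : modLoc M p' →+ Mix ((bpi k n q).obj M) h 0 :=
  modLoc.lift (piMixHom M h hp) fun d f e hd m t l => by
    rw [piMixHom_apply, piMixHom_apply, piMk_act]
    refine mk_piMk_eq h m _ _ _ _ ⟨_, tz_mul_mem_oLoc hp (tMulLoc p e hd t (tz hp (-f)))⟩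
      ?_ ?_
    · exact tz_neg_mul hp d _
    · change ((tU k n q i ^ d : (Torus k n q)ˣ) : Torus k n q) * (phi k n q t *
        ((tU k n q i ^ (-f) : (Torus k n q)ˣ) : Torus k n q)) *
        (((tU k n q i ^ f : (Torus k n q)ˣ) : Torus k n q) * l) =
        ((tU k n q i ^ d : (Torus k n q)ˣ) : Torus k n q) * (phi k n q t * l)
      rw [mul_assoc, mul_assoc, ← mul_assoc _ _ (l : Torus k n q), ← Units.val_mul, ← zpow_add,
        neg_add_cancel, zpow_zero, Units.val_one, one_mul]

theorem piMix_mk {M : GrMod k n q} {i : Fin (n + 1)} {p p' : X k n q} (h : p.Generizes p')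
    (hp : p.Inv (.t i)) {d : ℤ} (m : M.comp d) (l : loc p' (-d)) :
    piMix M h hp (modLoc.mk m l) =
      BalTensor.mk (piMk m (tz hp (-d))) (locMul p' (add_neg_cancel d) (tz (h _ hp) d) l) :=
  modLoc.lift_mk (piMixHom M h hp) _ m l

theorem piMix_toSec {M : GrMod k n q} {i : Fin (n + 1)} {p p' : X k n q} (h : p.Generizes p')
    (hp : p.Inv (.t i)) (x : Mix ((bpi k n q).obj M) h 0) :
    piMix M h hp (piSt M p' (Mix.toSec _ h x)) = x := by
  induction x using BalTensor.induction with
  | zero => simp only [map_zero]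
  | add x y hx hy => rw [map_add, map_add, map_add, hx, hy]
  | mk x l =>
    rw [Mix.toSec_mk, piSt_smul, piSt_stRes]
    refine piMk_induction (P := fun x => piMix M h hp ((op (toO l) : (oLoc p')ᵐᵒᵖ) •
      modLocMap (𝟙 M) h (piSt M p x)) = BalTensor.mk x l) ?_ ?_ ?_ x
    · simp only [map_zero, smul_zero]
      exact (congrArg Submodule.Quotient.mk (TensorProduct.tmul_zero _ _)).symm
    · intro x y hx hy
      rw [map_add, map_add, smul_add, map_add, hx, hy, BalTensor.mk_add_left]
    · intro d m l₀
      rw [piSt_piMk, modLocMap_mk, modLoc.smul_mk, piMix_mk]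
      refine (mk_piMk_eq h m _ _ _ _ ⟨_, tz_mul_mem_oLoc hp l₀⟩ ?_ ?_).symm
      · exact tz_neg_mul hp d _
      · rw [coe_locMul, coe_op_smul_loc, coe_locIncl, coe_tz, ← mul_assoc]
        rfl

theorem toSec_piMix {M : GrMod k n q} {i : Fin (n + 1)} {p p' : X k n q} (h : p.Generizes p')
    (hp : p.Inv (.t i)) (x : modLoc M p') :
    Mix.toSec _ h (piMix M h hp x) = (piSt M p').symm x := by
  induction x using modLoc.induction with
  | zero => simp only [map_zero]
  | add x y hx hy => rw [map_add, map_add, map_add, hx, hy]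
  | mk m l =>
    rw [piMix_mk, Mix.toSec_mk, stRes_piMk]
    refine smul_piMk m _ _ _ ?_
    exact tz_neg_mul (h _ hp) _ _

/-- Where `t_i` is invertible it is a unit of degree `1`. Every `m ⊗ l` with `m` of degree `d` then
equals `m ⊗ t_i ^ (-d)` times the element `t_i ^ d l` of degree `0`, so the sections are obtained by
base change. -/
theorem isChart_bpi (M : GrMod k n q) {i : Fin (n + 1)} {p : X k n q} (hp : p.Inv (.t i)) :
    IsChart ((bpi k n q).obj M) p := fun p' h =>
  ⟨Function.LeftInverse.injective (g := fun y => piMix M h hp (piSt M p' y)) (piMix_toSec h hp),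
    fun y => ⟨piMix M h hp (piSt M p' y), by rw [toSec_piMix, AddEquiv.symm_apply_apply]⟩⟩

theorem isChart_bpi_pt (M : GrMod k n q) (i : Fin (n + 1)) :
    IsChart ((bpi k n q).obj M) (pt k q i []) := isChart_bpi M (inv_pt i)

theorem quasicoherent_bpi (M : GrMod k n q) : quasicoherent k n q ((bpi k n q).obj M) :=
  quasicoherent_iff.2 (isChart_bpi_pt M)

theorem isIso_bpi_map {M N : GrMod k n q} {f : M ⟶ N} (hf : isoModTors k n q f) :
    IsIso ((bpi k n q).map f) :=
  isIso_of_bijective_pt (isChart_bpi_pt M) (isChart_bpi_pt N) fun i =>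
    (stMap_bpi_bijective_iff f _).2 (modLocMap_bijective_of_isoModTors hf i)

theorem isoModTors_of_isIso [NeZero n] {M N : GrMod k n q} {f : M ⟶ N}
    (hf : IsIso ((bpi k n q).map f)) : isoModTors k n q f :=
  isoModTors_of_modLocMap_bijective fun _ =>
    (stMap_bpi_bijective_iff f _).1 (OMod.bijective_of_isIso _ _)

/-! ### The counit -/

theorem pt_generizes_pt {i i' : Fin (n + 1)} {J J' : List (Fin (n + 1))}
    (h : ∀ c ∈ i :: J, c ∈ i' :: J') : (pt k q i J).Generizes (pt k q i' J') :=
  pt_generizes fun c hc => pt_inv (h c hc)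

/-- The value over `U_{I(p)}` of a global section of `F(d)`. -/
def gAt (F : OMod k n q) {d : ℤ} (p : X k n q) : (gammaObj F).comp d →+ Twist F d p :=
  AddMonoidHom.mk' (fun S => (show (twistDiag F d).sec ⊤ le_top from S).1 ⟨p, Opens.mem_top p⟩)
    fun _ _ => rfl

theorem gAt_act (F : OMod k n q) {d f : ℤ} (e : ℕ) (h : d + e = f) (S : (gammaObj F).comp d)
    (t : TPiece k n q e) (p : X k n q) :
    gAt F p ((gammaObj F).act e h S t) = Twist.mul F p h (gAt F p S) (phiLoc p t) :=
  Twist.mulT_eq F p e h t (gAt F p S)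

theorem res_gAt (F : OMod k n q) {d : ℤ} {p p' : X k n q} (h : p.Generizes p')
    (S : (gammaObj F).comp d) : Twist.res F d h (gAt F p S) = gAt F p' S :=
  (show (twistDiag F d).sec ⊤ le_top from S).2 ⟨p, Opens.mem_top p⟩ ⟨p', Opens.mem_top p'⟩ h

theorem gammaObj_ext (F : OMod k n q) {d : ℤ} {S S' : (gammaObj F).comp d}
    (h : ∀ p, gAt F p S = gAt F p S') : S = S' :=
  Subtype.ext (funext fun p => h p.1)

theorem gammaObj_ext_pt (F : OMod k n q) {d : ℤ} {S S' : (gammaObj F).comp d}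
    (h : ∀ i, gAt F (pt k q i []) S = gAt F (pt k q i []) S') : S = S' := by
  refine gammaObj_ext F fun p => ?_
  obtain ⟨i, hi⟩ := exists_pt_generizes p
  rw [← res_gAt F hi, ← res_gAt F hi, h i]

/-- The overlap of the charts `U_i` and `U_j` is the smallest neighbourhood of `pt i [j]`, so
compatibility at these points is compatibility on all pairwise overlaps. -/
theorem exists_gammaObj (F : OMod k n q) {d : ℤ} (x : ∀ i, Twist F d (pt k q i []))
    (hx : ∀ i j, Twist.res F d (pt_generizes_pt (i' := i) (J' := [j]) (by simp)) (x i) =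
      Twist.res F d (pt_generizes_pt (i' := i) (J' := [j]) (by simp)) (x j)) :
    ∃ S : (gammaObj F).comp d, ∀ i, gAt F (pt k q i []) S = x i := by
  have key : ∀ (p : X k n q) (i j : Fin (n + 1)) (hi : (pt k q i []).Generizes p)
      (hj : (pt k q j []).Generizes p), Twist.res F d hi (x i) = Twist.res F d hj (x j) := by
    intro p i j hi hj
    have h : (pt k q i [j]).Generizes p := pt_generizes fun c hc => by
      simp only [List.mem_cons, List.not_mem_nil, or_false] at hc
      rcases hc with rfl | rfl
      · exact hi _ (inv_pt c)
      · exact hj _ (inv_pt c)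
    rw [← Twist.res_res F (pt_generizes_pt (i' := i) (J' := [j]) (by simp)) h hi, hx i j,
      Twist.res_res F _ h hj]
  choose i hi using fun p : X k n q => exists_pt_generizes p
  refine ⟨⟨fun p => Twist.res F d (hi p.1) (x (i p.1)), fun p p' h => ?_⟩, fun j => ?_⟩
  · exact (Twist.res_res F _ h ((hi p.1).trans h) _).trans (key _ _ _ _ _)
  · exact (key _ _ j _ (.refl _)).trans (Twist.res_refl F _ _)

/-- The biadditive map `(S, l) ↦ S_p l`. -/
def epsHom (F : OMod k n q) (p : X k n q) (d : ℤ) :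
    (gammaObj F).comp d →+ loc p (-d) →+ F.st p :=
  AddMonoidHom.mk' (fun S => (Twist.toSec F p).comp
    (Twist.mul F p (add_neg_cancel d) (gAt F p S))) fun S S' => AddMonoidHom.ext fun l => by
      rw [map_add, map_add]
      exact map_add (Twist.toSec F p) _ _

theorem epsHom_apply (F : OMod k n q) (p : X k n q) {d : ℤ} (S : (gammaObj F).comp d)
    (l : loc p (-d)) :
    epsHom F p d S l = Twist.toSec F p (Twist.mul F p (add_neg_cancel d) (gAt F p S) l) := rfl

/-- The map `Γ_*(F)[t_c⁻¹ | c ∈ I(p)]_0 → F(U_{I(p)})`. -/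
def epsAt (F : OMod k n q) (p : X k n q) : modLoc (gammaObj F) p →+ F.st p :=
  modLoc.lift (epsHom F p) fun d f e h S t l => by
    rw [epsHom_apply, epsHom_apply, gAt_act, Twist.mul_mul F p h _ (add_neg_cancel d)
      (by omega : (e : ℤ) + -f = -d)]
    rfl

theorem epsAt_mk (F : OMod k n q) (p : X k n q) {d : ℤ} (S : (gammaObj F).comp d)
    (l : loc p (-d)) : epsAt F p (modLoc.mk S l) =
      Twist.toSec F p (Twist.mul F p (add_neg_cancel d) (gAt F p S) l) :=
  modLoc.lift_mk (epsHom F p) _ S l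

theorem epsAt_smul (F : OMod k n q) (p : X k n q) (c : oLoc p) (x : modLoc (gammaObj F) p) :
    epsAt F p ((op c : (oLoc p)ᵐᵒᵖ) • x) = op (O.const p c) • epsAt F p x := by
  induction x using modLoc.induction with
  | zero => rw [smul_zero, map_zero, smul_zero]
  | add x y hx hy => rw [smul_add, map_add, map_add, hx, hy, smul_add]
  | mk S l =>
    rw [modLoc.smul_mk, epsAt_mk, epsAt_mk]
    have := Twist.toSec_mul F p (add_zero 0)
      (Twist.mul F p (add_neg_cancel _) (gAt F p S) l) ⟨c, c.2⟩
    rw [Twist.mul_mul F p _ _ (add_neg_cancel _) (add_zero _)] at this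
    exact this

theorem epsAt_res (F : OMod k n q) {p p' : X k n q} (h : p.Generizes p')
    (x : modLoc (gammaObj F) p) :
    epsAt F p' (modLocMap (𝟙 _) h x) = F.stRes h (epsAt F p x) := by
  induction x using modLoc.induction with
  | zero => simp only [map_zero]
  | add x y hx hy => simp only [map_add, hx, hy]
  | mk S l =>
    rw [modLocMap_mk, epsAt_mk, epsAt_mk, ← Twist.toSec_res, Twist.res_mul, res_gAt]
    rfl

/-- The morphism `𝛑 Γ_*(F) → F`. -/
def eps (F : OMod k n q) : (bpi k n q).obj (gammaObj F) ⟶ F :=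
  (piDiag (gammaObj F)).desc F (epsAt F) (epsAt_smul F) fun h x => epsAt_res F h x

theorem stMap_eps (F : OMod k n q) (p : X k n q)
    (s : ((bpi k n q).obj (gammaObj F)).st p) :
    OMod.stMap (eps F) p s = epsAt F p (piSt _ p s) := Diag.stMap_desc _ _ _ _ _ p s

theorem stMap_eps_bijective_iff (F : OMod k n q) (p : X k n q) :
    Function.Bijective (OMod.stMap (eps F) p) ↔ Function.Bijective (epsAt F p) := by
  have : ⇑(OMod.stMap (eps F) p) = epsAt F p ∘ piSt _ p := funext (stMap_eps F p)
  rw [this, Function.Bijective.of_comp_iff _ (piSt _ p).bijective]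

theorem Twist.map_mul {F G : OMod k n q} (f : F ⟶ G) (p : X k n q) {d e f' : ℤ} (h : d + e = f')
    (x : Twist F d p) (l : loc p e) :
    Twist.map f f' p (Twist.mul F p h x l) = Twist.mul G p h (Twist.map f d p x) l := by
  induction x using BalTensor.induction with
  | zero => simp only [map_zero, AddMonoidHom.zero_apply]
  | add x y hx hy => simp only [map_add, AddMonoidHom.add_apply, hx, hy]
  | mk m l₀ => rw [Twist.mul_mk, Twist.map_mk, Twist.map_mk, Twist.mul_mk]

theorem Twist.toSec_map {F G : OMod k n q} (f : F ⟶ G) (p : X k n q) (x : Twist F 0 p) :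
    Twist.toSec G p (Twist.map f 0 p x) = OMod.stMap f p (Twist.toSec F p x) := by
  induction x using BalTensor.induction with
  | zero => simp only [map_zero]
  | add x y hx hy => simp only [map_add, hx, hy]
  | mk m l => rw [Twist.map_mk, Twist.toSec_mk, Twist.toSec_mk, OMod.stMap_smul]; rfl

theorem eps_naturality {F G : OMod k n q} (f : F ⟶ G) :
    (bpi k n q).map (gammaMap f) ≫ eps G = eps F ≫ f := by
  refine OMod.hom_ext_st fun p s => ?_
  rw [OMod.stMap_comp, OMod.stMap_comp, stMap_eps, stMap_eps, piSt_stMap]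
  generalize piSt _ p s = x
  induction x using modLoc.induction with
  | zero => simp only [map_zero]
  | add x y hx hy => simp only [map_add, hx, hy]
  | mk S l =>
    rw [modLocMap_mk, locIncl_refl]
    refine (epsAt_mk G p _ l).trans ?_
    rw [epsAt_mk, ← Twist.toSec_map, Twist.map_mul]
    rfl

theorem Twist.mul_tz_cancel (F : OMod k n q) {p : X k n q} {i : Fin (n + 1)} (hp : p.Inv (.t i))
    {d e f : ℤ} (h : d + e = f) (h' : f + -e = d) (x : Twist F d p) :
    Twist.mul F p h' (Twist.mul F p h x (tz hp e)) (tz hp (-e)) = x := by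
  rw [Twist.mul_mul F p h h' (add_zero d) (add_neg_cancel e), locMul_tz_tz, tz_zero, Twist.mul_one]

/-- If `S t_i ^ (-d)` is zero, then `S` vanishes on `U_i`, hence on each overlap of `U_i` with
another chart. On every chart it is therefore killed by large powers of `t_i`, and one power serves
the finitely many charts. -/
theorem epsAt_injective {F : OMod k n q} (hF : ∀ i, IsChart F (pt k q i [])) (i : Fin (n + 1)) :
    Function.Injective (epsAt F (pt k q i [])) := by
  refine (injective_iff_map_eq_zero _).2 fun x hx => ?_
  obtain ⟨d, S, rfl⟩ := modLoc.exists_eq_mk x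
  rw [epsAt_mk] at hx
  have h0 : Twist.mul F _ (add_neg_cancel d) (gAt F _ S) (tz (inv_pt i) (-d)) = 0 :=
    (Twist.toSec_bijective F _).1 (hx.trans (map_zero _).symm)
  have h1 : gAt F (pt k q i []) S = 0 := by
    have := Twist.mul_tz_cancel F (inv_pt i) (add_neg_cancel d) (by omega) (gAt F _ S)
    rw [h0, map_zero] at this
    exact this.symm
  have h2 : ∀ j, ∀ᶠ s : ℕ in Filter.atTop, Twist.mul F (pt k q j []) (f := d + s) rfl
      (gAt F _ S) (locPow i (pt k q j []) s) = 0 := fun j => by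
    refine (hF j).eventually_mul_eq_zero (.refl _)
      (pt_generizes_pt (i' := j) (J' := [i]) (by simp)) (clears_pt j i []) ?_
    rw [res_gAt, ← res_gAt F (pt_generizes_pt (i := i) (J := []) (by simp)), h1, map_zero]
  obtain ⟨s, hs⟩ := (Filter.eventually_all.2 h2).exists
  refine modLoc.mk_eq_zero (s := s) rfl (gammaObj_ext_pt F fun j => ?_)
  rw [gAt_act, phiLoc_tP, hs j, map_zero]

/-- A section over `U_i` extends to every chart after multiplication by a power of `t_i`. The
extensions need not agree on overlaps, but they do after a further power. -/
theorem epsAt_surjective {F : OMod k n q} (hF : ∀ i, IsChart F (pt k q i [])) (i : Fin (n + 1)) :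
    Function.Surjective (epsAt F (pt k q i [])) := by
  intro y
  let y' : Twist F 0 (pt k q i []) := BalTensor.mk y (locOne _)
  have h1 : ∀ j, ∀ᶠ s : ℕ in Filter.atTop, ∃ x : Twist F (0 + s) (pt k q j []),
      Twist.res F _ (pt_generizes_pt (i' := j) (J' := [i]) (by simp)) x =
        Twist.mul F _ rfl (Twist.res F 0 (pt_generizes_pt (by simp)) y') (locPow i _ s) := fun j =>
    (hF j).eventually_exists_res_eq (.refl _) _ (clears_pt j i []) _
  obtain ⟨s, hs⟩ := (Filter.eventually_all.2 h1).exists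
  choose x hx using hs
  -- The differences on `U_j ∩ U_l` vanish on the triple overlap with `U_i`, where both sides
  -- restrict to `y t_i ^ s`.
  have h2 : ∀ j l, ∀ᶠ r : ℕ in Filter.atTop, Twist.mul F (pt k q j [l]) (f := (0 + s : ℤ) + r) rfl
      (Twist.res F _ (pt_generizes_pt (by simp)) (x j) -
        Twist.res F _ (pt_generizes_pt (by simp)) (x l)) (locPow i _ r) = 0 := fun j l => by
    refine (hF j).eventually_mul_eq_zero (pt_generizes_pt (by simp))
      (pt_generizes_pt (i' := j) (J' := [i, l]) (by simp)) (clears_pt j i [l]) ?_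
    have e : ∀ a (h : (pt k q a [i]).Generizes (pt k q j [i, l]))
        (h' : (pt k q a []).Generizes (pt k q j [l])),
        Twist.res F _ (pt_generizes_pt (i' := j) (J' := [i, l]) (by simp))
          (Twist.res F _ h' (x a)) = Twist.mul F _ rfl
            (Twist.res F 0 (pt_generizes_pt (by simp)) y') (locPow i (pt k q j [i, l]) s) := by
      intro a h h'
      rw [Twist.res_res F h' _ (h'.trans (pt_generizes_pt (by simp))),
        ← Twist.res_res F (pt_generizes_pt (by simp)) h, hx a, Twist.res_mul, locIncl_locPow,
        Twist.res_res]
    rw [map_sub, e j (pt_generizes_pt (by simp)), e l (pt_generizes_pt (by simp)), sub_self]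
  obtain ⟨r, hr⟩ := (Filter.eventually_all.2 fun j => Filter.eventually_all.2 (h2 j)).exists
  obtain ⟨S, hS⟩ := exists_gammaObj F (fun j => Twist.mul F (pt k q j []) (f := (0 + s : ℤ) + r) rfl
    (x j) (locPow i _ r)) fun j l => by
      rw [Twist.res_mul, Twist.res_mul, locIncl_locPow, locIncl_locPow, ← sub_eq_zero,
        ← AddMonoidHom.sub_apply, ← map_sub]
      exact hr j l
  refine ⟨modLoc.mk S (tz (inv_pt i) _), ?_⟩
  -- On `U_i` itself the extension is exactly `y t_i ^ s`, since `pt i [i]` and `pt i []` generize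
  -- each other. Dividing by `t_i ^ (s + r)` therefore returns `y`.
  have hxi : x i = Twist.mul F _ rfl y' (locPow i _ s) := by
    have h : (pt k q i [i]).Generizes (pt k q i []) := pt_generizes_pt (by simp)
    have := congrArg (Twist.res F _ h) (hx i)
    rw [Twist.res_res F _ h (.refl _), Twist.res_refl, Twist.res_mul, locIncl_locPow,
      Twist.res_res F _ h (.refl _), Twist.res_refl] at this
    exact this
  have ht : ∀ s : ℕ, locPow i (pt k q i []) s = tz (inv_pt i) s := fun s => Subtype.ext (by
    rw [coe_locPow, coe_tz, zpow_natCast])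
  rw [epsAt_mk, hS, hxi, ht, ht, Twist.mul_mul F _ _ _ (by omega : (0 : ℤ) + (s + r) = 0 + s + r) rfl,
    locMul_tz_tz, Twist.mul_mul F _ _ _ (add_zero 0) (by omega), locMul_tz_tz, tz_zero,
    Twist.mul_one]
  exact Twist.toSec_mk_one F _ y

theorem isIso_eps {F : OMod k n q} (hF : ∀ i, IsChart F (pt k q i [])) : IsIso (eps F) :=
  isIso_of_bijective_pt (isChart_bpi_pt _) hF fun i => (stMap_eps_bijective_iff F _).2
    ⟨epsAt_injective hF i, epsAt_surjective hF i⟩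

/-! ### The unit -/

/-- The element `(m ⊗ t_i ^ (-d)) ⊗ t_i ^ d` of `(𝛑 M)(U_{I(p)}) ⊗ T[t_c⁻¹ | c ∈ I(p)]_d`. -/
def etaTwist {M : GrMod k n q} {i : Fin (n + 1)} {p : X k n q} (hp : p.Inv (.t i)) {d : ℤ}
    (m : M.comp d) : Twist ((bpi k n q).obj M) d p := BalTensor.mk (piMk m (tz hp (-d))) (tz hp d)

theorem etaTwist_add {M : GrMod k n q} {i : Fin (n + 1)} {p : X k n q} (hp : p.Inv (.t i)) {d : ℤ}
    (m m' : M.comp d) : etaTwist hp (m + m') = etaTwist hp m + etaTwist hp m' := by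
  unfold etaTwist
  rw [piMk_add_left, BalTensor.mk_add_left]

theorem twist_mk_piMk_eq {M : GrMod k n q} {p : X k n q} {d e : ℤ} (m : M.comp d)
    (l₁ l₂ : loc p (-d)) (l₁' l₂' : loc p e) (c : oLoc p) (h₁ : (l₁ * c : Torus k n q) = l₂)
    (h₂ : (c * l₂' : Torus k n q) = l₁') :
    (BalTensor.mk (piMk m l₂) l₂' : Twist ((bpi k n q).obj M) e p) =
      BalTensor.mk (piMk m l₁) l₁' :=
  mk_piMk_eq (.refl p) m l₁ l₂ l₁' l₂' c h₁ h₂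

/-- The choice of `i` does not matter, since `t_j ^ d t_i ^ (-d)` has degree `0` and passes through
the tensor sign. Hence the local elements form a global section. -/
theorem etaTwist_eq {M : GrMod k n q} {i j : Fin (n + 1)} {p : X k n q} (hi : p.Inv (.t i))
    (hj : p.Inv (.t j)) {d : ℤ} (m : M.comp d) : etaTwist hi m = etaTwist hj m := by
  refine twist_mk_piMk_eq m _ _ _ _ ⟨_, tz_mul_mem_oLoc hj (tz hi (-d))⟩ (tz_neg_mul hj d _) ?_
  change ((tU k n q j ^ d : (Torus k n q)ˣ) : Torus k n q) *
    ((tU k n q i ^ (-d) : (Torus k n q)ˣ) : Torus k n q) *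
    ((tU k n q i ^ d : (Torus k n q)ˣ) : Torus k n q) = _
  rw [mul_assoc, ← Units.val_mul, ← zpow_add, neg_add_cancel, zpow_zero, Units.val_one, mul_one,
    coe_tz]

theorem etaTwist_act {M : GrMod k n q} {i : Fin (n + 1)} {p : X k n q} (hp : p.Inv (.t i))
    {d f : ℤ} (e : ℕ) (h : d + e = f) (m : M.comp d) (t : TPiece k n q e) :
    etaTwist hp (M.act e h m t) = Twist.mul _ p h (etaTwist hp m) (phiLoc p t) := by
  unfold etaTwist
  rw [piMk_act, Twist.mul_mk]
  refine twist_mk_piMk_eq m _ _ _ _ ⟨_, tz_mul_mem_oLoc hp (tMulLoc p e h t (tz hp (-f)))⟩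
    (tz_neg_mul hp d _) ?_
  change ((tU k n q i ^ d : (Torus k n q)ˣ) : Torus k n q) * (phi k n q t *
    ((tU k n q i ^ (-f) : (Torus k n q)ˣ) : Torus k n q)) *
    ((tU k n q i ^ f : (Torus k n q)ˣ) : Torus k n q) =
    ((tU k n q i ^ d : (Torus k n q)ˣ) : Torus k n q) * phi k n q t
  rw [mul_assoc, mul_assoc, ← Units.val_mul, ← zpow_add, neg_add_cancel, zpow_zero, Units.val_one,
    mul_one]

theorem res_etaTwist {M : GrMod k n q} {i : Fin (n + 1)} {p p' : X k n q} (h : p.Generizes p')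
    (hp : p.Inv (.t i)) {d : ℤ} (m : M.comp d) :
    Twist.res _ d h (etaTwist hp m) = etaTwist (h _ hp) m := by
  unfold etaTwist
  rw [Twist.res_mk]
  exact congrArg₂ BalTensor.mk (stRes_piMk h m _) rfl

theorem map_etaTwist {M N : GrMod k n q} (f : M ⟶ N) {i : Fin (n + 1)} {p : X k n q}
    (hp : p.Inv (.t i)) {d : ℤ} (m : M.comp d) :
    Twist.map ((bpi k n q).map f) d p (etaTwist hp m) = etaTwist hp (f.app d m) := by
  unfold etaTwist
  rw [Twist.map_mk]
  exact congrArg (fun y => BalTensor.mk y _) (stMap_piMk f m _)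

/-- The map `M → Γ_*(𝛑 M)`. -/
def eta (M : GrMod k n q) : M ⟶ gammaObj ((bpi k n q).obj M) where
  app d := AddMonoidHom.mk' (fun m => ⟨fun p => etaTwist (exists_inv p.1).choose_spec m,
    fun p p' h => (res_etaTwist h _ m).trans (etaTwist_eq _ _ m)⟩) fun m m' =>
      Subtype.ext (funext fun p => etaTwist_add _ m m')
  app_act e h m t := gammaObj_ext _ fun p => by
    rw [gAt_act]
    exact etaTwist_act _ e h m t

theorem gAt_eta {M : GrMod k n q} {i : Fin (n + 1)} {p : X k n q} (hp : p.Inv (.t i)) {d : ℤ}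
    (m : M.comp d) : gAt _ p ((eta M).app d m) = etaTwist hp m := etaTwist_eq _ _ m

theorem eta_naturality {M N : GrMod k n q} (f : M ⟶ N) :
    f ≫ eta N = eta M ≫ gammaMap ((bpi k n q).map f) := by
  refine GrMod.Hom.ext (funext fun d => AddMonoidHom.ext fun m => gammaObj_ext _ fun p => ?_)
  obtain ⟨i, hp⟩ := exists_inv p
  exact (gAt_eta hp (f.app d m)).trans ((map_etaTwist f hp m).symm.trans
    (congrArg (Twist.map ((bpi k n q).map f) d p) (gAt_eta hp m).symm))

theorem bpi_map_eta_eps (M : GrMod k n q) :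
    (bpi k n q).map (eta M) ≫ eps ((bpi k n q).obj M) = 𝟙 _ := by
  refine OMod.hom_ext_st fun p s => ?_
  rw [OMod.stMap_comp, OMod.stMap_id, stMap_eps]
  obtain ⟨i, hp⟩ := exists_inv p
  refine piMk_induction (P := fun s => epsAt _ p (piSt _ p
    (OMod.stMap ((bpi k n q).map (eta M)) p s)) = s) ?_ ?_ ?_ s
  · simp only [map_zero]
  · intro x y hx hy
    rw [map_add, map_add, map_add, hx, hy]
  · intro d m l
    rw [stMap_piMk, piSt_piMk, epsAt_mk, gAt_eta hp]
    unfold etaTwist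
    rw [Twist.mul_mk, Twist.toSec_mk]
    exact smul_piMk m _ _ _ (tz_neg_mul hp d _)

/-- Since `𝛑 M` is quasicoherent, `eps` is invertible there. The triangle identity makes `𝛑 eta` its
inverse, and `𝛑` inverts nothing beyond `isoModTors`. -/
theorem isoModTors_eta [NeZero n] (M : GrMod k n q) : isoModTors k n q (eta M) := by
  refine isoModTors_of_isIso ?_
  have := isIso_eps (isChart_bpi_pt M)
  have : IsIso ((bpi k n q).map (eta M) ≫ eps ((bpi k n q).obj M)) := by
    rw [bpi_map_eta_eps]; infer_instance
  exact IsIso.of_isIso_comp_right _ (eps ((bpi k n q).obj M))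

/-! ### The equivalence of `QGr T` and `Mod O_𝔛` -/

variable (k n q) in
/-- The functor `𝛑`, with values in the category of quasicoherent modules. -/
abbrev qpi : GrMod k n q ⥤ QCoh k n q := (quasicoherent k n q).lift (bpi k n q) quasicoherent_bpi

theorem qpi_inverts : (isoModTors k n q).IsInvertedBy (qpi k n q) := fun _ _ f hf =>
  (ObjectProperty.isIso_hom_iff ((qpi k n q).map f)).1 (isIso_bpi_map hf)

variable (k n q) in
/-- The functor `QGr T → Mod O_𝔛` induced by `𝛑`. -/
abbrev piBar : QGr k n q ⥤ QCoh k n q := Localization.Construction.lift (qpi k n q) qpi_inverts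

variable (k n q) in
/-- The functor `π Γ_* : Mod O_𝔛 → QGr T`. -/
abbrev piGamma : QCoh k n q ⥤ QGr k n q :=
  (quasicoherent k n q).ι ⋙ gamma k n q ⋙ (isoModTors k n q).Q

variable (k n q) in
/-- The isomorphism `𝛑 Γ_* ≅ 𝟭`. -/
def epsIso : (quasicoherent k n q).ι ⋙ gamma k n q ⋙ qpi k n q ≅ 𝟭 (QCoh k n q) :=
  NatIso.ofComponents (fun F =>
    (quasicoherent k n q).isoMk
      (@asIso _ _ _ _ (eps F.obj) (isIso_eps (quasicoherent_iff.1 F.property)))) fun f =>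
      ObjectProperty.hom_ext _ (eps_naturality f.hom)

variable (k n q) in
/-- The isomorphism `𝟭 ≅ π̄ (π Γ_*)`. -/
def unitQCoh : 𝟭 (QCoh k n q) ≅ piGamma k n q ⋙ piBar k n q :=
  (epsIso k n q).symm ≪≫ Functor.isoWhiskerLeft ((quasicoherent k n q).ι ⋙ gamma k n q)
    -- The functor induced on the localisation composes with `Q` to `qpi` on the nose.
    (eqToIso (Localization.Construction.fac (qpi k n q) qpi_inverts).symm)

variable (k n q) in
/-- The isomorphism `π Γ_* 𝛑 ≅ π`. -/
def etaIso [NeZero n] : qpi k n q ⋙ piGamma k n q ≅ (isoModTors k n q).Q :=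
  (NatIso.ofComponents (F := (isoModTors k n q).Q) (G := qpi k n q ⋙ piGamma k n q) (fun M =>
    @asIso _ _ _ _ ((isoModTors k n q).Q.map (eta M))
      ((isoModTors k n q).Q_inverts (eta M) (isoModTors_eta M))) fun {M N} f => by
      change (isoModTors k n q).Q.map f ≫ (isoModTors k n q).Q.map (eta N) =
        (isoModTors k n q).Q.map (eta M) ≫ (isoModTors k n q).Q.map (gammaMap ((bpi k n q).map f))
      rw [← Functor.map_comp, ← Functor.map_comp, eta_naturality]).symm

variable (k n q) in
/-- The isomorphism `(π Γ_*) π̄ ≅ 𝟭`. -/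
def counitQGr [NeZero n] : piBar k n q ⋙ piGamma k n q ≅ 𝟭 (QGr k n q) :=
  -- Isomorphisms between functors on the localisation can be given after composition with `Q`,
  -- where `π̄` becomes `qpi` and `etaIso` applies.
  letI : Localization.Lifting (isoModTors k n q).Q (isoModTors k n q) (qpi k n q) (piBar k n q) :=
    ⟨eqToIso (Localization.Construction.fac (qpi k n q) qpi_inverts)⟩
  Localization.liftNatIso (isoModTors k n q).Q (isoModTors k n q) (qpi k n q ⋙ piGamma k n q)
    (isoModTors k n q).Q (piBar k n q ⋙ piGamma k n q) (𝟭 (QGr k n q)) (etaIso k n q)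

variable (k n q) in
/-- The functors `π Γ_*` and `π̄` are quasi-inverse equivalences of categories. -/
def qcohEquiv [NeZero n] : QCoh k n q ≌ QGr k n q :=
  CategoryTheory.Equivalence.mk (piGamma k n q) (piBar k n q) (unitQCoh k n q) (counitQGr k n q)

/-! ### Noetherian objects -/

/-- An equivalence induces an order isomorphism between the posets of subobjects. -/
theorem isNoetherianObject_functor_obj {C D : Type*} [Category* C] [Category* D] (e : C ≌ D) {Y : C}
    (h : isNoetherianObject Y) : isNoetherianObject (e.functor.obj Y) := by
  have : WellFoundedGT (Subobject Y) := h
  have f := (Subobject.lowerEquivalence (MonoOver.congr Y e)).symm.toOrderIso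
  exact f.strictMono.wellFoundedGT

/-! ### Graded submodules and monomorphisms of quasicoherent modules. -/

/-- A graded submodule. -/
def GrMod.sub (M : GrMod k n q) (P : ∀ d, AddSubgroup (M.comp d)) (hP : M.Stable P) :
    GrMod k n q where
  comp d := P d
  act {d f} e h := AddMonoidHom.mk' (fun m => AddMonoidHom.mk'
    (fun r => (⟨M.act e h m r, hP e h m r m.2⟩ : P f)) fun r r' => Subtype.ext (map_add _ _ _))
      fun m m' => AddMonoidHom.ext fun r => Subtype.ext (by
        change M.act e h (m + m' : M.comp d) r = M.act e h m r + M.act e h m' r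
        rw [map_add, AddMonoidHom.add_apply])
  act_act e e' h h' h'' m r r' := Subtype.ext (M.act_act e e' h h' h'' m r r')
  act_one h m := Subtype.ext (M.act_one h m)

/-- The inclusion of a graded submodule. -/
def GrMod.subι (M : GrMod k n q) {P : ∀ d, AddSubgroup (M.comp d)} (hP : M.Stable P) :
    M.sub P hP ⟶ M where
  app d := (P d).subtype
  app_act _ _ _ _ := rfl

/-- The zero homomorphism. -/
def GrMod.zeroHom (M N : GrMod k n q) : M ⟶ N where
  app _ := 0
  app_act e h m r := by
    rw [AddMonoidHom.zero_apply, AddMonoidHom.zero_apply, map_zero, AddMonoidHom.zero_apply]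

/-- The inclusion of a graded submodule in a bigger one. -/
def GrMod.subMap (M : GrMod k n q) {P P' : ∀ d, AddSubgroup (M.comp d)} (hP : M.Stable P)
    (hP' : M.Stable P') (h : ∀ d, P d ≤ P' d) : M.sub P hP ⟶ M.sub P' hP' where
  app d := AddSubgroup.inclusion (h d)
  app_act _ _ _ _ := rfl

theorem stMap_comp_eps_mk {M : GrMod k n q} {F : OMod k n q} (f : M ⟶ gammaObj F) {p : X k n q}
    {d : ℤ} (m : M.comp d) (l : loc p (-d)) :
    OMod.stMap ((bpi k n q).map f ≫ eps F) p (piMk m l) = epsAt F p (modLoc.mk (f.app d m) l) := by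
  rw [OMod.stMap_comp, stMap_piMk, stMap_eps, piSt_piMk]

/-- Monomorphisms are tested only against quasicoherent modules. The test object is `𝛑` of the
kernel of `Γ_*(f)`: its inclusion and the zero map agree after composition with `f`, hence induce
the same morphism to `F`. -/
theorem injective_of_mono {F G : QCoh k n q} (f : F ⟶ G) [Mono f] (i : Fin (n + 1)) :
    Function.Injective (OMod.stMap f.hom (pt k q i [])) := by
  have hF := quasicoherent_iff.1 F.property
  have hG := quasicoherent_iff.1 G.property
  refine (injective_iff_map_eq_zero _).2 fun x hx => ?_
  let P : ∀ d, AddSubgroup ((gammaObj F.obj).comp d) := fun d => ((gammaMap f.hom).app d).ker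
  have hP : (gammaObj F.obj).Stable P := fun {d f'} e h m r hm => by
    change (gammaMap f.hom).app f' _ = 0
    rw [(gammaMap f.hom).app_act, show (gammaMap f.hom).app d m = 0 from hm, map_zero,
      AddMonoidHom.zero_apply]
  let ι := (gammaObj F.obj).subι hP
  let z := GrMod.zeroHom ((gammaObj F.obj).sub P hP) (gammaObj F.obj)
  have hz : ι ≫ gammaMap f.hom = z ≫ gammaMap f.hom :=
    GrMod.Hom.ext (funext fun d => AddMonoidHom.ext fun m =>
      (show (gammaMap f.hom).app d m.1 = 0 from m.2).trans
        (map_zero ((gammaMap f.hom).app d)).symm)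
  let A : QCoh k n q := (qpi k n q).obj ((gammaObj F.obj).sub P hP)
  have h1 : (bpi k n q).map ι ≫ eps F.obj = (bpi k n q).map z ≫ eps F.obj := by
    let a : A ⟶ F := ObjectProperty.homMk ((bpi k n q).map ι ≫ eps F.obj)
    let b : A ⟶ F := ObjectProperty.homMk ((bpi k n q).map z ≫ eps F.obj)
    have hab : a = b := by
      rw [← cancel_mono f]
      refine ObjectProperty.hom_ext _ ?_
      change ((bpi k n q).map ι ≫ eps F.obj) ≫ f.hom = ((bpi k n q).map z ≫ eps F.obj) ≫ f.hom
      rw [Category.assoc, Category.assoc, ← eps_naturality, ← Functor.map_comp_assoc,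
        ← Functor.map_comp_assoc, hz]
    exact congrArg (fun c : A ⟶ F => c.hom) hab
  obtain ⟨x, rfl⟩ := epsAt_surjective hF i x
  obtain ⟨d, S, rfl⟩ := modLoc.exists_eq_mk x
  rw [← piSt_piMk, ← stMap_eps, ← OMod.stMap_comp, ← eps_naturality, stMap_comp_eps_mk] at hx
  obtain ⟨s, hs⟩ := modLoc.exists_act_tP_eq_zero
    (epsAt_injective hG i (hx.trans (map_zero _).symm))
  rw [← (gammaMap f.hom).app_act] at hs
  -- For a section `S t_i ^ (-d)` killed by `f`, the multiple `S t_i ^ s` lies in the kernel of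
  -- `Γ_*(f)`. There the inclusion acts as zero, and dividing by the power of `t_i` shows that the
  -- section vanishes.
  let S' : ((gammaObj F.obj).sub P hP).comp _ := (⟨_, hs⟩ : P _)
  have h2 : OMod.stMap ((bpi k n q).map ι ≫ eps F.obj) (pt k q i []) (piMk S' (tz (inv_pt i) _)) =
    OMod.stMap ((bpi k n q).map z ≫ eps F.obj) (pt k q i []) (piMk S' (tz (inv_pt i) _)) := by
      rw [h1]
  rw [← modLoc.mk_tP (inv_pt i) s rfl]
  refine (stMap_comp_eps_mk ι S' _).symm.trans (h2.trans ((stMap_comp_eps_mk z S' _).trans ?_))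
  change epsAt F.obj _ (modLoc.mk 0 _) = 0
  rw [modLoc.mk_zero_left, map_zero]

theorem mono_of_injective {F G : QCoh k n q} (f : F ⟶ G)
    (h : ∀ i, Function.Injective (OMod.stMap f.hom (pt k q i []))) : Mono f where
  right_cancellation {H} a b hab := by
    refine ObjectProperty.hom_ext _ (hom_ext_pt (quasicoherent_iff.1 H.property) fun i x => h i ?_)
    have := congrArg (fun c => OMod.stMap c.hom (pt k q i []) x) hab
    exact this

theorem isIso_of_bijective {F G : QCoh k n q} (f : F ⟶ G)
    (h : ∀ i, Function.Bijective (OMod.stMap f.hom (pt k q i []))) : IsIso f :=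
  (ObjectProperty.isIso_hom_iff f).1 (isIso_of_bijective_pt (quasicoherent_iff.1 F.property)
    (quasicoherent_iff.1 G.property) h)

/-- The map on sections over `U_{I(p)}` as a linear map. -/
def OMod.stLin {F G : OMod k n q} (f : F ⟶ G) (p : X k n q) :
    F.st p →ₗ[(O (X.nbhd k n q p))ᵐᵒᵖ] G.st p where
  toFun := OMod.stMap f p
  map_add' := map_add _
  map_smul' c s := OMod.stMap_smul f p (unop c) s

/-- The sections over the charts of a subobject. -/
def chartSub (F : QCoh k n q) (A : Subobject F) (i : Fin (n + 1)) :
    (Submodule (O (X.nbhd k n q (pt k q i [])))ᵐᵒᵖ (F.obj.st (pt k q i []))) :=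
  LinearMap.range (OMod.stLin A.arrow.hom (pt k q i []))

/-- If two nested subobjects have the same sections over every chart, the inclusion between them is
bijective on charts and hence an isomorphism. -/
theorem chartSub_strictMono (F : QCoh k n q) : StrictMono (chartSub F) := by
  have hmono : Monotone (chartSub F) := fun A B hAB i => by
    rintro _ ⟨x, rfl⟩
    refine ⟨OMod.stMap (A.ofLE B hAB).hom _ x, ?_⟩
    have := congrArg (fun c => OMod.stMap c.hom (pt k q i []) x) (Subobject.ofLE_arrow hAB)
    exact this
  refine fun A B h => lt_of_le_not_ge (hmono h.le) fun hBA => h.not_ge ?_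
  have : IsIso (A.ofLE B h.le) := by
    have hc : ∀ i x, OMod.stMap B.arrow.hom (pt k q i [])
        (OMod.stMap (A.ofLE B h.le).hom _ x) = OMod.stMap A.arrow.hom _ x := fun i x =>
      congrArg (fun c => OMod.stMap c.hom (pt k q i []) x) (Subobject.ofLE_arrow h.le)
    refine isIso_of_bijective _ fun i => ⟨injective_of_mono _ i, fun y => ?_⟩
    obtain ⟨x, hx⟩ := hBA i ⟨y, rfl⟩
    exact ⟨x, injective_of_mono B.arrow i ((hc i x).trans hx)⟩
  exact Subobject.le_of_comm (inv (A.ofLE B h.le))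
    ((IsIso.inv_comp_eq _).2 (Subobject.ofLE_arrow h.le).symm)

theorem isNoetherianRing_O_chart (i : Fin (n + 1)) :
    IsNoetherianRing (O (X.nbhd k n q (pt k q i [])))ᵐᵒᵖ := by
  have := isNoetherianRing_oLoc_pt (k := k) (q := q) i
  exact isNoetherianRing_of_surjective _ _ (RingHom.op (O.const (pt k q i []))) fun f =>
    ⟨op (O.eval ⟨_, X.mem_nbhd _⟩ (unop f)), congrArg op (O.const_eval _ (unop f))⟩

theorem isNoetherianObject_of_coherent {F : QCoh k n q} (hF : coherent k n q F.obj) :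
    isNoetherianObject F := by
  have h : ∀ i, WellFoundedGT
      (Submodule (O (X.nbhd k n q (pt k q i [])))ᵐᵒᵖ (F.obj.st (pt k q i []))) := fun i => by
    have := isNoetherianRing_O_chart (k := k) (q := q) i
    have := (coherent_iff.1 hF i).2
    have : IsNoetherian (O (X.nbhd k n q (pt k q i [])))ᵐᵒᵖ (F.obj.st (pt k q i [])) :=
      isNoetherian_of_isNoetherianRing_of_finite _ _
    infer_instance
  -- The ascending chain conditions over the finitely many charts are combined in order-dual form.
  have : WellFoundedLT (∀ i, (Submodule (O (X.nbhd k n q (pt k q i [])))ᵐᵒᵖ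
      (F.obj.st (pt k q i [])))ᵒᵈ) := Pi.wellFoundedLT
  have : WellFoundedGT (Subobject F) := by
    let g : Subobject F → ∀ i, (Submodule (O (X.nbhd k n q (pt k q i [])))ᵐᵒᵖ
      (F.obj.st (pt k q i [])))ᵒᵈ := fun A i => OrderDual.toDual (chartSub F A i)
    have hg : StrictAnti g := fun A B h => chartSub_strictMono F h
    exact hg.wellFoundedGT
  exact this

/-! ### Coherent modules and noetherian objects -/

section ChartLift

variable (F : QCoh k n q) (i : Fin (n + 1))

/-- The sections of the twists of `F` which lie in a given submodule over the `i`-th chart. -/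
def chartLift (Q : Submodule (O (X.nbhd k n q (pt k q i [])))ᵐᵒᵖ (F.obj.st (pt k q i []))) (d : ℤ) :
    AddSubgroup ((gammaObj F.obj).comp d) :=
  Q.toAddSubgroup.comap ((epsAt F.obj (pt k q i [])).comp (modLoc.mkHom (tz (inv_pt i) (-d))))

variable {F i}

theorem mem_chartLift {Q : Submodule (O (X.nbhd k n q (pt k q i [])))ᵐᵒᵖ (F.obj.st (pt k q i []))}
    {d : ℤ} {S : (gammaObj F.obj).comp d} : S ∈ chartLift F i Q d ↔
      epsAt F.obj (pt k q i []) (modLoc.mk S (tz (inv_pt i) (-d))) ∈ Q := Iff.rfl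

/-- The element `t_i ^ d l` has degree `0`, so `S ⊗ l` is a multiple of `S ⊗ t_i ^ (-d)` over the
ring of the chart. Membership for one denominator thus implies it for all. -/
theorem epsAt_mk_mem
    {Q : Submodule (O (X.nbhd k n q (pt k q i [])))ᵐᵒᵖ (F.obj.st (pt k q i []))} {d : ℤ}
    {S : (gammaObj F.obj).comp d} (hS : S ∈ chartLift F i Q d) (l : loc (pt k q i []) (-d)) :
    epsAt F.obj (pt k q i []) (modLoc.mk S l) ∈ Q := by
  have h : (modLoc.mk S l : modLoc (gammaObj F.obj) (pt k q i [])) =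
      (op ⟨_, tz_mul_mem_oLoc (inv_pt i) l⟩ : (oLoc (pt k q i []))ᵐᵒᵖ) •
        modLoc.mk S (tz (inv_pt i) (-d)) := by
    rw [modLoc.smul_mk]
    exact congrArg _ (Subtype.ext (tz_neg_mul (inv_pt i) d (l : Torus k n q)).symm)
  rw [h, epsAt_smul]
  exact Q.smul_mem _ hS

theorem stable_chartLift
    (Q : Submodule (O (X.nbhd k n q (pt k q i [])))ᵐᵒᵖ (F.obj.st (pt k q i []))) :
    (gammaObj F.obj).Stable (chartLift F i Q) := fun {d f} e h m r hm => by
  rw [mem_chartLift, modLoc.mk_act]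
  exact epsAt_mk_mem hm _

variable (F i) in
/-- The homomorphism to `F` from the quasicoherent module generated by the sections of the twists of
`F` which lie in a given submodule over the `i`-th chart. -/
def chartLiftHom (Q : Submodule (O (X.nbhd k n q (pt k q i [])))ᵐᵒᵖ (F.obj.st (pt k q i []))) :
    (qpi k n q).obj ((gammaObj F.obj).sub _ (stable_chartLift Q)) ⟶ F :=
  ObjectProperty.homMk ((bpi k n q).map ((gammaObj F.obj).subι (stable_chartLift Q)) ≫ eps F.obj)

/-- If a fraction `S t_j ^ (-d)` becomes zero in `F`, then a power of `t_j` kills `S` in `Γ_*(F)`,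
and therefore already in the graded submodule. -/
instance mono_chartLiftHom
    (Q : Submodule (O (X.nbhd k n q (pt k q i [])))ᵐᵒᵖ (F.obj.st (pt k q i []))) :
    Mono (chartLiftHom F i Q) := by
  refine mono_of_injective _ fun j => (injective_iff_map_eq_zero _).2 fun x hx => ?_
  obtain ⟨x, rfl⟩ := (piSt _ _).symm.surjective x
  obtain ⟨d, S, rfl⟩ := modLoc.exists_eq_mk x
  have h := (stMap_comp_eps_mk ((gammaObj F.obj).subι (stable_chartLift Q)) S
    (tz (inv_pt j) (-d))).symm.trans hx
  obtain ⟨s, hs⟩ := modLoc.exists_act_tP_eq_zero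
    (epsAt_injective (quasicoherent_iff.1 F.property) j (h.trans (map_zero _).symm))
  rw [← modLoc.mk_tP (inv_pt j) s rfl, show ((gammaObj F.obj).sub _ (stable_chartLift Q)).act s rfl S
    (tP k q j s) = 0 from Subtype.ext hs, modLoc.mk_zero_left, map_zero]

/-- The subobject remembers `Q`: each section over the chart is a fraction `S t_i ^ (-d)`, and it
lies in `Q` exactly when `S` belongs to the graded submodule. -/
theorem range_chartLiftHom
    (Q : Submodule (O (X.nbhd k n q (pt k q i [])))ᵐᵒᵖ (F.obj.st (pt k q i []))) :
    LinearMap.range (OMod.stLin (chartLiftHom F i Q).hom (pt k q i [])) = Q := by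
  refine le_antisymm ?_ fun y hy => ?_
  · rintro _ ⟨x, rfl⟩
    obtain ⟨x, rfl⟩ := (piSt _ _).symm.surjective x
    obtain ⟨d, S, rfl⟩ := modLoc.exists_eq_mk x
    have h := stMap_comp_eps_mk ((gammaObj F.obj).subι (stable_chartLift Q)) S
      (tz (inv_pt i) (-d))
    exact (congrArg (· ∈ Q) h).mpr S.2
  · obtain ⟨x, rfl⟩ := epsAt_surjective (quasicoherent_iff.1 F.property) i y
    obtain ⟨d, S, rfl⟩ := modLoc.exists_eq_mk x
    let S' : ((gammaObj F.obj).sub _ (stable_chartLift Q)).comp d := (⟨S, hy⟩ : chartLift F i Q d)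
    exact ⟨piMk S' (tz (inv_pt i) (-d)),
      stMap_comp_eps_mk ((gammaObj F.obj).subι (stable_chartLift Q)) S' (tz (inv_pt i) (-d))⟩

variable (F i) in
-- This transfers the ascending chain condition from the subobjects of `F` to the submodules of its
-- sections over one chart, which are then finitely generated.
theorem chartLiftHom_strictMono : StrictMono fun Q => Subobject.mk (chartLiftHom F i Q) := by
  have hle : ∀ Q Q', Subobject.mk (chartLiftHom F i Q) ≤ Subobject.mk (chartLiftHom F i Q') →
      Q ≤ Q' := fun Q Q' h => by
    rw [← range_chartLiftHom Q, ← range_chartLiftHom Q']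
    rintro _ ⟨x, rfl⟩
    refine ⟨OMod.stMap (Subobject.ofMkLEMk _ _ h).hom _ x, ?_⟩
    exact congrArg (fun c => OMod.stMap c.hom (pt k q i []) x) (Subobject.ofMkLEMk_comp h)
  refine fun Q Q' h => lt_of_le_not_ge ?_ fun h' => h.not_ge (hle _ _ h')
  refine Subobject.mk_le_mk_of_comm ((qpi k n q).map ((gammaObj F.obj).subMap (stable_chartLift Q)
    (stable_chartLift Q') fun d S hS => h.le hS)) (ObjectProperty.hom_ext _ ?_)
  change (bpi k n q).map _ ≫ (bpi k n q).map _ ≫ eps F.obj = (bpi k n q).map _ ≫ eps F.obj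
  rw [← Functor.map_comp_assoc]
  rfl

end ChartLift

theorem coherent_of_isNoetherianObject {F : QCoh k n q} (hF : isNoetherianObject F) :
    coherent k n q F.obj := by
  refine coherent_iff.2 fun i => ⟨quasicoherent_iff.1 F.property i, ?_⟩
  have : WellFoundedGT (Subobject F) := hF
  have : IsNoetherian (O (X.nbhd k n q (pt k q i [])))ᵐᵒᵖ (F.obj.st (pt k q i [])) :=
    isNoetherian_iff'.2 (chartLiftHom_strictMono F i).wellFoundedGT
  infer_instance

/-! ### Restriction of the equivalence to coherent modules and noetherian objects. -/

variable [NeZero n]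

theorem isNoetherianObject_piGamma (F : Coh k n q) :
    isNoetherianObject ((ObjectProperty.ιOfLE coherent_le ⋙ piGamma k n q).obj F) :=
  isNoetherianObject_functor_obj (qcohEquiv k n q)
    (isNoetherianObject_of_coherent (F := ⟨F.obj, coherent_le _ F.property⟩) F.property)

theorem coherent_piBar (N : Qgr k n q) :
    coherent k n q ((isNoetherianObject.ι ⋙ piBar k n q ⋙ (quasicoherent k n q).ι).obj N) :=
  coherent_of_isNoetherianObject
    (isNoetherianObject_functor_obj (qcohEquiv k n q).symm N.property)

variable (k n q) in
/-- The equivalence of the category of coherent `O_𝔛`-modules and of `qgr T`. -/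
def cohEquiv : Coh k n q ≌ Qgr k n q :=
  CategoryTheory.Equivalence.mk
    (isNoetherianObject.lift (ObjectProperty.ιOfLE coherent_le ⋙ piGamma k n q)
      isNoetherianObject_piGamma)
    ((coherent k n q).lift (isNoetherianObject.ι ⋙ piBar k n q ⋙ (quasicoherent k n q).ι)
      coherent_piBar)
    (NatIso.ofComponents (fun F => (coherent k n q).isoMk
      ((quasicoherent k n q).ι.mapIso ((unitQCoh k n q).app
        ((ObjectProperty.ιOfLE coherent_le).obj F)))) fun f => ObjectProperty.hom_ext _
          (congrArg (fun c => c.hom) ((unitQCoh k n q).hom.naturality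
            ((ObjectProperty.ιOfLE coherent_le).map f))))
    (NatIso.ofComponents (fun N => isNoetherianObject.isoMk ((counitQGr k n q).app N.obj))
      fun f => ObjectProperty.hom_ext _ ((counitQGr k n q).hom.naturality f.hom))

end QKleinian

end

theorem mainTheorem4 {k : Type u} [Field k] [IsAlgClosed k] [CharZero k] (n : ℕ) (hn : 2 ≤ n)
    (q : kˣ) :
    ∃ (hqc : ∀ M : QKleinian.GrMod k n q,
        QKleinian.quasicoherent k n q ((QKleinian.bpi k n q).obj M))
      (hinv : (QKleinian.isoModTors k n q).IsInvertedBy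
        ((QKleinian.quasicoherent k n q).lift (QKleinian.bpi k n q) hqc)),
      let piBar : QKleinian.QGr k n q ⥤ QKleinian.QCoh k n q :=
        Localization.Construction.lift
          ((QKleinian.quasicoherent k n q).lift (QKleinian.bpi k n q) hqc) hinv
      let Γ : QKleinian.QCoh k n q ⥤ QKleinian.QGr k n q :=
        (QKleinian.quasicoherent k n q).ι ⋙ QKleinian.gamma k n q ⋙ (QKleinian.isoModTors k n q).Q
      (∃ e : QKleinian.QCoh k n q ≌ QKleinian.QGr k n q, e.functor = Γ ∧ e.inverse = piBar) ∧
      ∃ (h₁ : ∀ F : QKleinian.Coh k n q, isNoetherianObject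
          (((ObjectProperty.ιOfLE QKleinian.coherent_le) ⋙ Γ).obj F))
        (h₂ : ∀ N : QKleinian.Qgr k n q, QKleinian.coherent k n q
          ((isNoetherianObject.ι ⋙ piBar ⋙ (QKleinian.quasicoherent k n q).ι).obj N)),
        ∃ e' : QKleinian.Coh k n q ≌ QKleinian.Qgr k n q,
          e'.functor = isNoetherianObject.lift (ObjectProperty.ιOfLE QKleinian.coherent_le ⋙ Γ) h₁ ∧
          e'.inverse = (QKleinian.coherent k n q).lift
            (isNoetherianObject.ι ⋙ piBar ⋙ (QKleinian.quasicoherent k n q).ι) h₂ := by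
  have : NeZero n := ⟨by omega⟩
  exact ⟨QKleinian.quasicoherent_bpi, QKleinian.qpi_inverts, ⟨QKleinian.qcohEquiv k n q, rfl, rfl⟩,
    QKleinian.isNoetherianObject_piGamma, QKleinian.coherent_piBar, QKleinian.cohEquiv k n q,
    rfl, rfl⟩
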